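/- **Parameter theory.** Fix a first-order language $L$ with equality, an $L$-structure $M$, and a binary function symbol $(\cdot,\cdot)$ of $L$ (pairing) whose interpretation is injective: $(a,b)=(c,d)$ in $M$ implies $a=c$ and $b=d$. An $\mathcal X$-formula is a quantifier-free $L$-formula with variables of sort $\mathsf X$. Let $SAT_{\mathcal X}$ be a decision procedure for satisfiability of $\mathcal X$-formulas in $M$. **The language.** There are variables $x,n,\dots$ of sort $\mathsf X$, ranging over $M$, and variables $X,N,\dots$ of sort $\mathsf{Set}$, ranging over finite subsets of $M$. The $\mathsf X$-terms are the $L$-terms. Set terms are: a set variable; $\varnothing$; $\{t\sqcup A\}$, denoting $\{t\}\cup A$; and restricted intensional sets (RIS) $\{c:D\mid\phi @ p\}$, where $D$ is a set term, the control variable $c$ is bound in $\phi$ and $p$, the filter $\phi$ is an $\mathcal X$-formula, and the pattern $p$ is either $c$ or $(c,t)$ with $t$ an $\mathsf X$-term. This RIS denotes $\{p(d): d\in D,\ \phi(d)\}$. Constraints are $A=B$, $A\ne B$, $t\in A$, $t\notin A$, $un(A,B,C)$ (meaning $A\cup B=C$), $A\parallel B$ (meaning $A\cap B=\varnothing$),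 $set(a)$ ($a$ is of sort $\mathsf{Set}$) and $isX(a)$ ($a$ is of sort $\mathsf X$). RIS-formulas are built from constraints, $\mathcal X$-formulas, $true$ and $false$ with $\wedge$ and $\vee$. A solution of a formula is an assignment of its variables that makes it true. *Notation.* $\{t_0,\dots,t_k\sqcup A\}$ is the iterated $\{\cdot\sqcup\cdot\}$. A *variable-RIS* is a RIS whose domain is a set variable or a variable-RIS. $\bar X$ stands for a set variable or a variable-RIS. $E$ stands for $\varnothing$ or a RIS whose domain is such an $E$. In a RIS, $\boldsymbol X$ stands for $\{b_1,\dots,b_a\sqcup X\}$ with $a\ge 0$, and $\boldsymbol N$ for the same term with $X$ replaced by $N$. The letters $n$ (sort $\mathsf X$) and $N,N_1,N_2$ (sort $\mathsf{Set}$) always denote distinct fresh variables. $\phi,p$ and $\gamma,q$ are filters and patterns, and $\Delta_n(A,B)$ is $(n\in A\wedge n\notin B)\vee(n\notin A\wedge n\in B)$. **Rewrite rules for $=$.** 1. $E=E'\to true$; $\ X=X\to true$; $\ E=\{t\sqcup A\}\to false$. 2. $X=\{t_0,\dots,t_k\sqcup S\}\to X=\{t_0,\dots,t_k\sqcup S[X\mapsto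 N]\}$ for $S=X$ or $S=\{c:\boldsymbol X\mid\phi @ c\}$. 3. If $X$ occurs in another constraint other than $set$, $isX$ constraints, and $A$ is not of the form $\{c:\{d\sqcup D\}\mid\phi@p\}$: keep $X=A$ and substitute $A$ for $X$ in the rest. An equation $A=X$ with $A$ not a variable is treated in the same way. 4. $\{t\sqcup A\}=\{s\sqcup B\}\to(t=s\wedge A=\{s\sqcup B\})\vee(t=s\wedge\{s\sqcup A\}=B)\vee(t=s\wedge A=B)\vee(A=\{s\sqcup N\}\wedge\{t\sqcup N\}=B)$. 5. $\{t_0,\dots,t_m\sqcup R\}=\{s_0,\dots,s_k\sqcup S\}$, where $(R,S)$ is $(X,X)$, $(\{c:\boldsymbol X\mid\phi@c\},X)$, $(\{c:\boldsymbol X\mid\phi@c\},\{c:X\mid\gamma@c\})$, or $(\{c:\boldsymbol X\mid\phi@p\},\{c:X\mid\gamma@q\})$ with $p,q\neq c$. Write $T=\{t_1,\dots,t_m\sqcup\cdot\}$, $U=\{s_0,\dots,s_k\sqcup\cdot\}$, $U_j$ for $U$ without $s_j$, and $R',S'$ for $R,S$ with $X$ replaced by $N$. The right-hand side is the disjunction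 of the following. - For each $j\le k$, $t_0=s_j$ together with one of: - $R=\{t_0\sqcup N_1\}\wedge t_0\notin N_1\wedge S=\{t_0\sqcup N_2\}\wedge t_0\notin N_2\wedge T(N_1)=U_j(N_2)$; - $t_0\notin R\wedge t_0\notin S\wedge T(R)=U_j(S)$; - $R=\{t_0\sqcup N\}\wedge t_0\notin N\wedge t_0\notin S\wedge T(N)=U_j(S)$; - $t_0\notin R\wedge S=\{s_j\sqcup N\}\wedge s_j\notin N\wedge T(R)=U_j(N)$; - $T(R)=U(S)$; - $\{t_0\sqcup T(R)\}=U_j(S)$. - In the first three cases for $(R,S)$: $X=\{t_0\sqcup N\}\wedge G\wedge T(R')=U(S')$, where $G$ is $\gamma(t_0)$ if $S=\{c:X\mid\gamma@c\}$ and $true$ if $S=X$. - In the fourth case: $X=\{n\sqcup N\}\wedge\gamma(n)\wedge t_0=q(n)\wedge\big(\neg\phi(n)\vee(\phi(n)\wedge p(n)\notin\{s_0,\dots,s_k\}\wedge t_0=p(n))\big)\wedge T(R')=U(S')$; and, for each $j\le k$, $X=\{n\sqcup N\}\wedge\gamma(n)\wedge t_0=q(n)\wedge\phi(n)\wedge p(n)=s_j\wedge\{p(n)\sqcup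 T(R')\}=U(S')$. - If instead $R=X$ and $S=\{c:X\mid\gamma@c\}$, the two sides are exchanged. 6. $\{c:\{d\sqcup D\}\mid\phi@p\}=E\to\neg\phi(d)\wedge\{c:D\mid\phi@p\}=\varnothing$. 7. If $B$ is not of the form $E$: $\{c:\{d\sqcup D\}\mid\phi@p\}=B\to(\phi(d)\wedge\{p(d)\sqcup\{c:D\mid\phi@p\}\}=B)\vee(\neg\phi(d)\wedge\{c:D\mid\phi@p\}=B)$. 8. $\{c:X\mid\gamma@c\}=\{t_0,\dots,t_m\sqcup R\}\to X=\{t_0\sqcup N\}\wedge\gamma(t_0)\wedge\{c:N\mid\gamma@c\}=\{t_1,\dots,t_m\sqcup R[X\mapsto N]\}$ for $R=X$ or $R=\{c:\boldsymbol X\mid\phi@c\}$. 9. For $p,q\ne c$: $\{c:X\mid\gamma@q\}=\{t_0,\dots,t_m\sqcup\{c:\boldsymbol X\mid\phi@p\}\}\to X=\{n\sqcup N\}\wedge\gamma(n)\wedge t_0=q(n)\wedge(\neg\phi(n)\vee t_0=p(n))\wedge\{c:N\mid\gamma@q\}=\{t_1,\dots,t_m\sqcup\{c:\boldsymbol N\mid\phi@p\}\}$.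 10. $\{c:\bar X\mid\phi@p\}=\{t\sqcup A\}\to\bar X=\{n\sqcup N\}\wedge\phi(n)\wedge t=p(n)\wedge\{c:N\mid\phi@p\}=A$. The rule $E=\{t\sqcup A\}\to false$ of item 1 and the rules of items 2 and 6–10 are also used with the two sides of the equation exchanged. **For $\neq$.** $E\ne E'\to false$; $X\neq X\to false$; $A\neq X\to X\neq A$ ($A$ neither a variable nor a RIS); $E\ne\{t\sqcup B\}\to true$ and $\{t\sqcup B\}\neq E\to true$; $A\neq B\to\Delta_n(A,B)$ if $A$ or $B$ is a RIS, or both are of the form $\{\cdot\sqcup\cdot\}$, or $A=X$ and $B$ is $\{t_0,\dots,t_k\sqcup X\}$ or $\{t_0,\dots,t_k\sqcup R\}$ with $R$ a RIS. **For $\in$.** $t\in E\to false$; $t\in\{s\sqcup A\}\to t=s\vee t\in A$; $t\in X\to X=\{t\sqcup N\}$; $t\in\{c:D\mid\phi@p\}\to n\in D\wedge\phi(n)\wedge t=p(n)$. **For $\notin$.** $t\notin E\to true$; $t\notin\{s\sqcup A\}\to t\neq s\wedge t\notin A$; $t\notin\{c:\{d\sqcup D\}\mid\phi@p\}\to(\phi(d)\wedge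 t\ne p(d)\wedge t\notin\{c:D\mid\phi@p\})\vee(\neg\phi(d)\wedge t\notin\{c:D\mid\phi@p\})$. **For $un$.** - $un(X,X,B)\to X=B$; $un(A,B,E)\to A=\varnothing\wedge B=\varnothing$; $un(E,A,B)\to B=A$; $un(A,E,B)\to B=A$. - $un(\{t\sqcup C\},A,\bar X)$ and $un(A,\{t\sqcup C\},\bar X)$ both rewrite to $\{t\sqcup C\}=\{t\sqcup N_1\}\wedge t\notin N_1\wedge\bar X=\{t\sqcup N\}\wedge\big((t\notin A\wedge un(N_1,A,N))\vee(A=\{t\sqcup N_2\}\wedge t\notin N_2\wedge un(N_1,N_2,N))\big)$. - $un(A,B,\{t\sqcup C\})\to\{t\sqcup C\}=\{t\sqcup N\}\wedge\big((A=\{t\sqcup N_1\}\wedge t\notin N_1\wedge un(N_1,B,N))\vee(B=\{t\sqcup N_1\}\wedge t\notin N_1\wedge un(A,N_1,N))\vee(A=\{t\sqcup N_1\}\wedge t\notin N_1\wedge B=\{t\sqcup N_2\}\wedge t\notin N_2\wedge un(N_1,N_2,N))\big)$. - If some argument is of the form $\{c:\{d\sqcup D\}\mid\phi@p\}$, each such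 argument is replaced by a fresh set variable $V$ (a different one for each argument) and the constraint $(V=\{p(d)\sqcup\{c:D\mid\phi@p\}\}\wedge\phi(d))\vee(V=\{c:D\mid\phi@p\}\wedge\neg\phi(d))$ is added. **For $\parallel$** (and symmetrically). $X\parallel X\to X=\varnothing$; $A\parallel E\to true$; $A\parallel\{t\sqcup B\}\to t\notin A\wedge A\parallel B$; $A\parallel\{c:\{d\sqcup D\}\mid\phi@p\}\to(\phi(d)\wedge p(d)\notin A\wedge A\parallel\{c:D\mid\phi@p\})\vee(\neg\phi(d)\wedge A\parallel\{c:D\mid\phi@p\})$. **For sorts.** $set(\varnothing)\to true$; $set(\{t\sqcup A\})\to set(A)$; $set$ of a RIS $\to true$; $set(t)\to false$ for an $\mathsf X$-term $t$; $isX$ of $\varnothing$, $\{t\sqcup A\}$ or a RIS $\to false$; $isX(t)\to true$ for a non-variable $\mathsf X$-term $t$. **Nested domains.** Let $f(A)$ be a $=$, $\notin$, $un$ or $\parallel$ constraint with a distinguished set argument $A$. If $D$ is a RIS that is neither a variable-RIS nor of the form $E$, then $f(\{c:D\mid\phi@p\})\to(D=\{n\sqcup N\}\wedge f(\{c:\{n\sqcup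 N\}\mid\phi@p\}))\vee(D=\varnothing\wedge f(\{c:\varnothing\mid\phi@p\}))$. **The solver $SAT_{RIS}$.** It works on conjunctions. Every disjunction, in the input or created by a rule, is a non-deterministic choice, and all choices are explored; a conjunction that contains $false$ becomes $false$. Whenever several rules apply, any of them may be used. - $\mathsf{STEP}$ exhaustively applies the rules for $=$, then those for $\neq$, $\in$, $\notin$, $un$, $\parallel$, $set$, $isX$, in this order (each rule for a predicate being applied to the constraints with that predicate). Then `sort_infer` adds the sort constraint $set(X)$ or $isX(x)$ for every variable occurring in a constraint, and `sort_check` replaces the conjunction by $false$ if its sort constraints are unsatisfiable. - `remove_neq` exhaustively rewrites constraints $X\neq B$ to $(n\in X\wedge n\notin B)\vee(n\in B\wedge n\notin X)$, where $X$ is an argument of a $un$-constraint or the innermost domain of a variable-RIS that is an argument of a $=$, $\notin$ or $un$ constraint. - Given $\Phi$, the solver first runs `sort_infer`. It then repeats the following until the conjunction no longer changes: repeat $\mathsf{STEP}$ until nothing changes; then apply `remove_neq`. (Conjunctions are compared up to order and repetition of conjuncts.) - Finally, each resulting conjunction is written as $\Phi_{\mathcal S}\wedge\Phi_{\mathcal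 X}$, with $\Phi_{\mathcal X}$ its $\mathcal X$-formulas, and the solver returns $\Phi_{\mathcal S}\wedge\Phi_{\mathcal X}$ if $SAT_{\mathcal X}$ finds $\Phi_{\mathcal X}$ satisfiable, and $\Phi_{\mathcal S}\wedge false$ otherwise. **Theorem (Equisatisfiability).** Let $\Phi$ be a RIS-formula (in particular, any admissible one) and let $\Phi_1,\dots,\Phi_n$ be the collection of formulas returned by a run of $SAT_{RIS}(\Phi)$ that terminates along all its non-deterministic branches. Then $\Phi_1\vee\dots\vee\Phi_n$ is equisatisfiable with $\Phi$, in the following strong sense. 1. For every solution $\sigma$ of $\Phi$ there are an $i$ and a solution $\sigma'$ of $\Phi_i$ that agrees with $\sigma$ on all variables of $\Phi$; that is, $\sigma$, extended to the fresh variables, solves $\Phi_i$. 2. For every $i$, every solution of $\Phi_i$ is a solution of $\Phi$. -/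

import Mathlib

universe u v w

namespace RIS



noncomputable section

/-! ## The parameter theory: quantifier-free formulas over a first-order language with equality -/

/-- Quantifier-free formulas over the language `L` with variables in `α`. -/
inductive QF (L : FirstOrder.Language.{u, v}) (α : Type) : Type (max u v)
  | tru : QF L α
  | eq (t s : L.Term α) : QF L α
  | rel {n : ℕ} (R : L.Relations n) (ts : Fin n → L.Term α) : QF L α
  | neg (φ : QF L α) : QF L α
  | and (φ ψ : QF L α) : QF L α
  | or (φ ψ : QF L α) : QF L α

namespace QF

variable {L : FirstOrder.Language.{u, v}} {M : Type w} [L.Structure M] {α β : Type}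

/-- Truth of a quantifier-free formula in the structure `M` under the assignment `e`. -/
def Realize (e : α → M) : QF L α → Prop
  | tru => True
  | eq t s => t.realize e = s.realize e
  | rel R ts => FirstOrder.Language.Structure.RelMap R (fun i => (ts i).realize e)
  | neg φ => ¬ φ.Realize e
  | and φ ψ => φ.Realize e ∧ ψ.Realize e
  | or φ ψ => φ.Realize e ∨ ψ.Realize e

/-- Simultaneous substitution of terms for variables. -/
def subst (f : α → L.Term β) : QF L α → QF L β
  | tru => tru
  | eq t s => eq (t.subst f) (s.subst f)
  | rel R ts => rel R (fun i => (ts i).subst f)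
  | neg φ => neg (φ.subst f)
  | and φ ψ => and (φ.subst f) (ψ.subst f)
  | or φ ψ => or (φ.subst f) (ψ.subst f)

/-- The variables of a quantifier-free formula. -/
def vars [DecidableEq α] : QF L α → Finset α
  | tru => ∅
  | eq t s => t.varFinset ∪ s.varFinset
  | rel _ ts => Finset.univ.biUnion (fun i => (ts i).varFinset)
  | neg φ => φ.vars
  | and φ ψ => φ.vars ∪ ψ.vars
  | or φ ψ => φ.vars ∪ ψ.vars

/-- Conjunction of a finite list of formulas. -/
def conj (l : List (QF L α)) : QF L α := l.foldr and tru

end QF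

/-! ## Terms, constraints and formulas

There are two disjoint countable supplies of variables, both indexed by `ℕ`: those of sort `X`
(ranging over `M`) and those of sort `Set` (ranging over finite subsets of `M`).  Inside a filter
or a pattern the variables are `Option ℕ`: `none` is the bound control variable of the restricted
intensional set, and `some x` is the free variable `x`. -/

/-- The pattern of a RIS with control variable `c`: either `c` itself or `(c, t)`. -/
inductive Pat (L : FirstOrder.Language.{u, v}) : Type (max u v)
  | ctrl : Pat L
  | pair (t : L.Term (Option ℕ)) : Pat L

/-- Set terms.  `ext t A` is `{t ⊔ A}` and `ris D φ p` is `{c : D | φ @ p}`. -/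
inductive STerm (L : FirstOrder.Language.{u, v}) : Type (max u v)
  | var (X : ℕ) : STerm L
  | emp : STerm L
  | ext (t : L.Term ℕ) (A : STerm L) : STerm L
  | ris (D : STerm L) (φ : QF L (Option ℕ)) (p : Pat L) : STerm L

/-- Arguments of the sort constraints `set` and `isX`: terms of either sort. -/
inductive Arg (L : FirstOrder.Language.{u, v}) : Type (max u v)
  | ofSet (A : STerm L) : Arg L
  | ofX (t : L.Term ℕ) : Arg L

/-- The primitive predicate symbols of the language (other than those of the parameter theory). -/
inductive Pred : Type
  | eq | neq | mem | nmem | un | disj | isSet | isX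

/-- Primitive constraints; `un A B C` says `A ∪ B = C` and `disj A B` says `A ∩ B = ∅`. -/
inductive Constr (L : FirstOrder.Language.{u, v}) : Type (max u v)
  | eq (A B : STerm L) : Constr L
  | neq (A B : STerm L) : Constr L
  | mem (t : L.Term ℕ) (A : STerm L) : Constr L
  | nmem (t : L.Term ℕ) (A : STerm L) : Constr L
  | un (A B C : STerm L) : Constr L
  | disj (A B : STerm L) : Constr L
  | isSet (a : Arg L) : Constr L
  | isX (a : Arg L) : Constr L

/-- RIS-formulas (`fls` is the answer `false` of the solver). -/
inductive Form (L : FirstOrder.Language.{u, v}) : Type (max u v)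
  | tru : Form L
  | fls : Form L
  | con (c : Constr L) : Form L
  | xf (φ : QF L ℕ) : Form L
  | and (Φ Ψ : Form L) : Form L
  | or (Φ Ψ : Form L) : Form L

/-- The conjuncts of the formulas handled by the solver. -/
inductive Lit (L : FirstOrder.Language.{u, v}) : Type (max u v)
  | fls : Lit L
  | con (c : Constr L) : Lit L
  | xf (φ : QF L ℕ) : Lit L

infixr:35 " ⩑ " => Form.and
infixr:30 " ⩒ " => Form.or

variable {L : FirstOrder.Language.{u, v}}

/-! ## Free variables -/

def Pat.vars : Pat L → Finset (Option ℕ)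
  | .ctrl => {none}
  | .pair t => insert none t.varFinset

/-- Free variables of sort `X`. -/
def STerm.xvars : STerm L → Finset ℕ
  | .var _ => ∅
  | .emp => ∅
  | .ext t A => t.varFinset ∪ A.xvars
  | .ris D φ p => D.xvars ∪ (Finset.eraseNone φ.vars ∪ Finset.eraseNone p.vars)

/-- Variables of sort `Set`. -/
def STerm.svars : STerm L → Finset ℕ
  | .var X => {X}
  | .emp => ∅
  | .ext _ A => A.svars
  | .ris D _ _ => D.svars

def Arg.xvars : Arg L → Finset ℕ
  | .ofSet A => A.xvars
  | .ofX t => t.varFinset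

def Arg.svars : Arg L → Finset ℕ
  | .ofSet A => A.svars
  | .ofX _ => ∅

def Constr.xvars : Constr L → Finset ℕ
  | .eq A B => A.xvars ∪ B.xvars
  | .neq A B => A.xvars ∪ B.xvars
  | .mem t A => t.varFinset ∪ A.xvars
  | .nmem t A => t.varFinset ∪ A.xvars
  | .un A B C => A.xvars ∪ (B.xvars ∪ C.xvars)
  | .disj A B => A.xvars ∪ B.xvars
  | .isSet a => a.xvars
  | .isX a => a.xvars

def Constr.svars : Constr L → Finset ℕ
  | .eq A B => A.svars ∪ B.svars
  | .neq A B => A.svars ∪ B.svars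
  | .mem _ A => A.svars
  | .nmem _ A => A.svars
  | .un A B C => A.svars ∪ (B.svars ∪ C.svars)
  | .disj A B => A.svars ∪ B.svars
  | .isSet a => a.svars
  | .isX a => a.svars

def Form.xvars : Form L → Finset ℕ
  | .tru => ∅
  | .fls => ∅
  | .con c => c.xvars
  | .xf φ => φ.vars
  | .and Φ Ψ => Φ.xvars ∪ Ψ.xvars
  | .or Φ Ψ => Φ.xvars ∪ Ψ.xvars

def Form.svars : Form L → Finset ℕ
  | .tru => ∅
  | .fls => ∅
  | .con c => c.svars
  | .xf _ => ∅
  | .and Φ Ψ => Φ.svars ∪ Ψ.svars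
  | .or Φ Ψ => Φ.svars ∪ Ψ.svars

/-! ## Semantics -/

/-- An assignment of elements of `M` to the variables of sort `X` and of finite subsets of `M` to
the variables of sort `Set`. -/
structure Val (M : Type w) where
  x : ℕ → M
  s : ℕ → Finset M

section Semantics

variable {M : Type w} [L.Structure M]

/-- The environment of filters and patterns: the control variable is assigned `d`. -/
def env (e : ℕ → M) (d : M) : Option ℕ → M
  | none => d
  | some x => e x

/-- The value of a pattern at `d`, where `pr` is the pairing symbol. -/
def Pat.eval (pr : L.Functions 2) (e : ℕ → M) (d : M) : Pat L → M
  | .ctrl => d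
  | .pair t => FirstOrder.Language.Structure.funMap pr ![d, t.realize (env e d)]

/-- The set denoted by a set term (it is always finite, see `STerm.eval_finite`). -/
def STerm.eval (pr : L.Functions 2) (σ : Val M) : STerm L → Set M
  | .var X => ↑(σ.s X)
  | .emp => ∅
  | .ext t A => {t.realize σ.x} ∪ A.eval pr σ
  | .ris D φ p => {y | ∃ d, d ∈ D.eval pr σ ∧ φ.Realize (env σ.x d) ∧ y = p.eval pr σ.x d}

theorem STerm.eval_finite (pr : L.Functions 2) (σ : Val M) (A : STerm L) :
    (A.eval pr σ).Finite := by
  induction A with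
  | var X => exact (σ.s X).finite_toSet
  | emp => exact Set.finite_empty
  | ext t A ih => exact (Set.finite_singleton _).union ih
  | ris D φ p ih =>
    refine (ih.image (fun d => p.eval pr σ.x d)).subset ?_
    rintro y ⟨d, hd, -, rfl⟩
    exact ⟨d, hd, rfl⟩

def Constr.Holds (pr : L.Functions 2) (σ : Val M) : Constr L → Prop
  | .eq A B => A.eval pr σ = B.eval pr σ
  | .neq A B => ¬ A.eval pr σ = B.eval pr σ
  | .mem t A => t.realize σ.x ∈ A.eval pr σ
  | .nmem t A => ¬ t.realize σ.x ∈ A.eval pr σ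
  | .un A B C => A.eval pr σ ∪ B.eval pr σ = C.eval pr σ
  | .disj A B => A.eval pr σ ∩ B.eval pr σ = ∅
  | .isSet (.ofSet _) => True
  | .isSet (.ofX _) => False
  | .isX (.ofSet _) => False
  | .isX (.ofX _) => True

/-- `Φ.Holds pr σ`: the assignment `σ` is a solution of `Φ`. -/
def Form.Holds (pr : L.Functions 2) (σ : Val M) : Form L → Prop
  | .tru => True
  | .fls => False
  | .con c => c.Holds pr σ
  | .xf φ => φ.Realize σ.x
  | .and Φ Ψ => Φ.Holds pr σ ∧ Ψ.Holds pr σ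
  | .or Φ Ψ => Φ.Holds pr σ ∨ Ψ.Holds pr σ

end Semantics

/-! ## Auxiliary operations on terms and formulas -/

/-- The substitution that replaces the control variable by `d`. -/
def inst (d : L.Term ℕ) : Option ℕ → L.Term ℕ
  | none => d
  | some x => FirstOrder.Language.Term.var x

/-- The instance `φ(d)` of a filter. -/
def at' (φ : QF L (Option ℕ)) (d : L.Term ℕ) : QF L ℕ := φ.subst (inst d)

/-- The instance `p(d)` of a pattern. -/
def Pat.app (pr : L.Functions 2) (p : Pat L) (d : L.Term ℕ) : L.Term ℕ :=
  match p with
  | .ctrl => d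
  | .pair t => FirstOrder.Language.Functions.apply₂ pr d (t.subst (inst d))

/-- `{t₁, …, tₙ ⊔ A}`. -/
def extL (ts : List (L.Term ℕ)) (A : STerm L) : STerm L := ts.foldr STerm.ext A

/-- Substitution of the set term `A` for the set variable `X`. -/
def STerm.subst (X : ℕ) (A : STerm L) : STerm L → STerm L
  | .var Y => if Y = X then A else .var Y
  | .emp => .emp
  | .ext t B => .ext t (STerm.subst X A B)
  | .ris D φ p => .ris (STerm.subst X A D) φ p

def Arg.subst (X : ℕ) (A : STerm L) : Arg L → Arg L
  | .ofSet B => .ofSet (STerm.subst X A B)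
  | .ofX t => .ofX t

def Constr.subst (X : ℕ) (A : STerm L) : Constr L → Constr L
  | .eq B C => .eq (STerm.subst X A B) (STerm.subst X A C)
  | .neq B C => .neq (STerm.subst X A B) (STerm.subst X A C)
  | .mem t B => .mem t (STerm.subst X A B)
  | .nmem t B => .nmem t (STerm.subst X A B)
  | .un B C D => .un (STerm.subst X A B) (STerm.subst X A C) (STerm.subst X A D)
  | .disj B C => .disj (STerm.subst X A B) (STerm.subst X A C)
  | .isSet a => .isSet (a.subst X A)
  | .isX a => .isX (a.subst X A)

def Lit.subst (X : ℕ) (A : STerm L) : Lit L → Lit L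
  | .fls => .fls
  | .con c => .con (c.subst X A)
  | .xf φ => .xf φ

def Constr.pred : Constr L → Pred
  | .eq _ _ => .eq
  | .neq _ _ => .neq
  | .mem _ _ => .mem
  | .nmem _ _ => .nmem
  | .un _ _ _ => .un
  | .disj _ _ => .disj
  | .isSet _ => .isSet
  | .isX _ => .isX

/-- The symbols other than the sort symbols `set` and `isX`. -/
def Pred.IsSetPred : Pred → Prop
  | .isSet => False
  | .isX => False
  | _ => True

def STerm.IsVar : STerm L → Prop
  | .var _ => True
  | _ => False

def STerm.IsRIS : STerm L → Prop
  | .ris _ _ _ => True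
  | _ => False

/-- Variable-RIS: the domain is a variable or, recursively, a variable-RIS. -/
def STerm.IsVarRIS : STerm L → Prop
  | .ris D _ _ => D.IsVar ∨ D.IsVarRIS
  | _ => False

/-- A set variable or a variable-RIS. -/
def STerm.IsBar (A : STerm L) : Prop := A.IsVar ∨ A.IsVarRIS

/-- The empty set term, or (recursively) a RIS with empty domain. -/
def STerm.IsEmp : STerm L → Prop
  | .emp => True
  | .ris D _ _ => D.IsEmp
  | _ => False

/-- A RIS whose domain is of the form `{d ⊔ D}`. -/
def STerm.IsExtRIS : STerm L → Prop
  | .ris (.ext _ _) _ _ => True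
  | _ => False

/-- `X` is the (innermost) domain of the variable-RIS `A`. -/
def STerm.HasDomVar (X : ℕ) : STerm L → Prop
  | .ris D _ _ => D = .var X ∨ D.HasDomVar X
  | _ => False

abbrev eqF (A B : STerm L) : Form L := .con (.eq A B)
abbrev memF (t : L.Term ℕ) (A : STerm L) : Form L := .con (.mem t A)
abbrev nmemF (t : L.Term ℕ) (A : STerm L) : Form L := .con (.nmem t A)
abbrev unF (A B C : STerm L) : Form L := .con (.un A B C)
abbrev disjF (A B : STerm L) : Form L := .con (.disj A B)
/-- `t =ₓ s`. -/
abbrev teqF (t s : L.Term ℕ) : Form L := .xf (.eq t s)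
/-- `t ≠ₓ s`. -/
abbrev tneF (t s : L.Term ℕ) : Form L := .xf (.neg (.eq t s))
/-- The filter holds at `d`. -/
abbrev posF (φ : QF L (Option ℕ)) (d : L.Term ℕ) : Form L := .xf (at' φ d)
/-- The filter fails at `d`. -/
abbrev negF (φ : QF L (Option ℕ)) (d : L.Term ℕ) : Form L := .xf (.neg (at' φ d))

def bigOr : List (Form L) → Form L
  | [] => .fls
  | [Φ] => Φ
  | Φ :: Ψ :: l => Φ ⩒ bigOr (Ψ :: l)

/-! ## Rewrite rules

In every rule `n` (of sort `X`) and `N`, `N₁`, `N₂` (of sort `Set`) are the fresh variables. -/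

/-- The six disjuncts, for each `j`, that correspond to `t₀ = sⱼ` in the rules for
`{t₀, t₁, …, tₘ ⊔ R} = {s₀, …, sₖ ⊔ S}`; `ss` is the list `s₀, …, sₖ`. -/
def sixBranches (N N₁ N₂ : ℕ) (t₀ : L.Term ℕ) (ts ss : List (L.Term ℕ)) (R S : STerm L) :
    Form L :=
  bigOr ((List.finRange ss.length).map fun j =>
    let sj := ss.get j
    let ss' := ss.eraseIdx j
    (teqF t₀ sj
      ⩑ eqF (.ext t₀ (.var N₁)) R ⩑ nmemF t₀ (.var N₁)
      ⩑ eqF (.ext t₀ (.var N₂)) S ⩑ nmemF t₀ (.var N₂)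
      ⩑ eqF (extL ts (.var N₁)) (extL ss' (.var N₂)))
    ⩒ (teqF t₀ sj ⩑ nmemF t₀ R ⩑ nmemF t₀ S ⩑ eqF (extL ts R) (extL ss' S))
    ⩒ (teqF t₀ sj
      ⩑ eqF (.ext t₀ (.var N)) R ⩑ nmemF t₀ (.var N) ⩑ nmemF t₀ S
      ⩑ eqF (extL ts (.var N)) (extL ss' S))
    ⩒ (teqF t₀ sj
      ⩑ nmemF t₀ R ⩑ eqF (.ext sj (.var N)) S ⩑ nmemF sj (.var N)
      ⩑ eqF (extL ts R) (extL ss' (.var N)))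
    ⩒ (teqF t₀ sj ⩑ eqF (extL ts R) (extL ss S))
    ⩒ (teqF t₀ sj ⩑ eqF (extL (t₀ :: ts) R) (extL ss' S)))

/-- Right-hand side of the rule for `{t₀, ts ⊔ R} = {ss ⊔ S}` where `R` and `S` share the set
variable `X` and are variables or RIS whose pattern is the control variable; `R'` and `S'` are `R`
and `S` with `X` replaced by `N`, and `g` is the filter condition on `t₀` coming from `S`. -/
def sharedCtrlRhs (N N₁ N₂ X : ℕ) (t₀ : L.Term ℕ) (ts ss : List (L.Term ℕ))
    (R S R' S' : STerm L) (g : Form L) : Form L :=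
  sixBranches N N₁ N₂ t₀ ts ss R S
  ⩒ (eqF (.var X) (.ext t₀ (.var N)) ⩑ g ⩑ eqF (extL ts R') (extL ss S'))

/-- Right-hand side of the analogous rule for two RIS `{{bs ⊔ X} | φ @ p}` and `{X | γ @ q}` whose
patterns are not the control variable. -/
def sharedPairRhs (pr : L.Functions 2) (n N N₁ N₂ X : ℕ) (t₀ : L.Term ℕ)
    (ts ss bs : List (L.Term ℕ)) (φ γ : QF L (Option ℕ)) (p q : Pat L) : Form L :=
  let x : L.Term ℕ := FirstOrder.Language.Term.var n
  let R' : STerm L := .ris (extL bs (.var N)) φ p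
  let S' : STerm L := .ris (.var N) γ q
  sixBranches N N₁ N₂ t₀ ts ss (.ris (extL bs (.var X)) φ p) (.ris (.var X) γ q)
  ⩒ (eqF (.var X) (.ext x (.var N)) ⩑ posF γ x ⩑ teqF t₀ (q.app pr x)
      ⩑ (negF φ x
          ⩒ (posF φ x ⩑ nmemF (p.app pr x) (extL ss .emp) ⩑ teqF t₀ (p.app pr x)))
      ⩑ eqF (extL ts R') (extL ss S'))
  ⩒ bigOr (ss.map fun sj =>
      eqF (.var X) (.ext x (.var N)) ⩑ posF γ x ⩑ teqF t₀ (q.app pr x)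
      ⩑ posF φ x ⩑ teqF (p.app pr x) sj
      ⩑ eqF (extL (p.app pr x :: ts) R') (extL ss S'))

/-- Rules for equality `A = B` that are used as they stand. -/
inductive EqRule (pr : L.Functions 2) (n N N₁ N₂ : ℕ) : STerm L → STerm L → Form L → Prop
  | emp_emp {A B : STerm L} : A.IsEmp → B.IsEmp → EqRule pr n N N₁ N₂ A B .tru
  | var_self (X : ℕ) : EqRule pr n N N₁ N₂ (.var X) (.var X) .tru
  | shared_var_var (X : ℕ) (t₀ s₀ : L.Term ℕ) (ts ss : List (L.Term ℕ)) :
      EqRule pr n N N₁ N₂ (extL (t₀ :: ts) (.var X)) (extL (s₀ :: ss) (.var X))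
        (sharedCtrlRhs N N₁ N₂ X t₀ ts (s₀ :: ss) (.var X) (.var X) (.var N) (.var N) .tru)
  | shared_ris_var (X : ℕ) (t₀ s₀ : L.Term ℕ) (ts ss bs : List (L.Term ℕ))
      (φ : QF L (Option ℕ)) :
      EqRule pr n N N₁ N₂ (extL (t₀ :: ts) (.ris (extL bs (.var X)) φ .ctrl))
        (extL (s₀ :: ss) (.var X))
        (sharedCtrlRhs N N₁ N₂ X t₀ ts (s₀ :: ss) (.ris (extL bs (.var X)) φ .ctrl) (.var X)
          (.ris (extL bs (.var N)) φ .ctrl) (.var N) .tru)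
  | shared_ris_ris (X : ℕ) (t₀ s₀ : L.Term ℕ) (ts ss bs : List (L.Term ℕ))
      (φ γ : QF L (Option ℕ)) :
      EqRule pr n N N₁ N₂ (extL (t₀ :: ts) (.ris (extL bs (.var X)) φ .ctrl))
        (extL (s₀ :: ss) (.ris (.var X) γ .ctrl))
        (sharedCtrlRhs N N₁ N₂ X t₀ ts (s₀ :: ss)
          (.ris (extL bs (.var X)) φ .ctrl) (.ris (.var X) γ .ctrl)
          (.ris (extL bs (.var N)) φ .ctrl) (.ris (.var N) γ .ctrl) (posF γ t₀))
  | shared_var_ris (X : ℕ) (t₀ s₀ : L.Term ℕ) (ts ss : List (L.Term ℕ)) (γ : QF L (Option ℕ)) :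
      EqRule pr n N N₁ N₂ (extL (t₀ :: ts) (.var X)) (extL (s₀ :: ss) (.ris (.var X) γ .ctrl))
        (eqF (extL (s₀ :: ss) (.ris (.var X) γ .ctrl)) (extL (t₀ :: ts) (.var X)))
  | shared_pair (X : ℕ) (t₀ s₀ : L.Term ℕ) (ts ss bs : List (L.Term ℕ))
      (φ γ : QF L (Option ℕ)) (p q : Pat L) : p ≠ .ctrl → q ≠ .ctrl →
      EqRule pr n N N₁ N₂ (extL (t₀ :: ts) (.ris (extL bs (.var X)) φ p))
        (extL (s₀ :: ss) (.ris (.var X) γ q))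
        (sharedPairRhs pr n N N₁ N₂ X t₀ ts (s₀ :: ss) bs φ γ p q)
  | ext_ext (t s : L.Term ℕ) (A B : STerm L) :
      EqRule pr n N N₁ N₂ (.ext t A) (.ext s B)
        ((teqF t s ⩑ eqF A (.ext s B))
          ⩒ (teqF t s ⩑ eqF (.ext s A) B)
          ⩒ (teqF t s ⩑ eqF A B)
          ⩒ (eqF A (.ext s (.var N)) ⩑ eqF (.ext t (.var N)) B))

/-- Rules for equality `A = B` that also apply with the two sides exchanged. -/
inductive EqRuleSym (pr : L.Functions 2) (n N : ℕ) : STerm L → STerm L → Form L → Prop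
  | var_ext_var (X : ℕ) (t₀ : L.Term ℕ) (ts : List (L.Term ℕ)) :
      EqRuleSym pr n N (.var X) (extL (t₀ :: ts) (.var X))
        (eqF (.var X) (extL (t₀ :: ts) (.var N)))
  | var_ext_ris (X : ℕ) (t₀ : L.Term ℕ) (ts bs : List (L.Term ℕ)) (φ : QF L (Option ℕ)) :
      EqRuleSym pr n N (.var X) (extL (t₀ :: ts) (.ris (extL bs (.var X)) φ .ctrl))
        (eqF (.var X) (extL (t₀ :: ts) (.ris (extL bs (.var N)) φ .ctrl)))
  | emp_ext {A : STerm L} (t : L.Term ℕ) (B : STerm L) : A.IsEmp →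
      EqRuleSym pr n N A (.ext t B) .fls
  | ris_emp (d : L.Term ℕ) (D : STerm L) (φ : QF L (Option ℕ)) (p : Pat L) {B : STerm L} :
      B.IsEmp →
      EqRuleSym pr n N (.ris (.ext d D) φ p) B (negF φ d ⩑ eqF (.ris D φ p) .emp)
  | ris_any (d : L.Term ℕ) (D : STerm L) (φ : QF L (Option ℕ)) (p : Pat L) {B : STerm L} :
      ¬ B.IsEmp →
      EqRuleSym pr n N (.ris (.ext d D) φ p) B
        ((posF φ d ⩑ eqF (.ext (p.app pr d) (.ris D φ p)) B)
          ⩒ (negF φ d ⩑ eqF (.ris D φ p) B))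
  | varris_shared_var (X : ℕ) (t₀ : L.Term ℕ) (ts : List (L.Term ℕ)) (γ : QF L (Option ℕ)) :
      EqRuleSym pr n N (.ris (.var X) γ .ctrl) (extL (t₀ :: ts) (.var X))
        (eqF (.var X) (.ext t₀ (.var N)) ⩑ posF γ t₀
          ⩑ eqF (.ris (.var N) γ .ctrl) (extL ts (.var N)))
  | varris_shared_ris (X : ℕ) (t₀ : L.Term ℕ) (ts bs : List (L.Term ℕ))
      (φ γ : QF L (Option ℕ)) :
      EqRuleSym pr n N (.ris (.var X) γ .ctrl)
        (extL (t₀ :: ts) (.ris (extL bs (.var X)) φ .ctrl))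
        (eqF (.var X) (.ext t₀ (.var N)) ⩑ posF γ t₀
          ⩑ eqF (.ris (.var N) γ .ctrl) (extL ts (.ris (extL bs (.var N)) φ .ctrl)))
  | varris_shared_pair (X : ℕ) (t₀ : L.Term ℕ) (ts bs : List (L.Term ℕ))
      (φ γ : QF L (Option ℕ)) (p q : Pat L) : p ≠ .ctrl → q ≠ .ctrl →
      EqRuleSym pr n N (.ris (.var X) γ q) (extL (t₀ :: ts) (.ris (extL bs (.var X)) φ p))
        (eqF (.var X) (.ext (FirstOrder.Language.Term.var n) (.var N)) ⩑ posF γ (FirstOrder.Language.Term.var n)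
          ⩑ teqF t₀ (q.app pr (FirstOrder.Language.Term.var n))
          ⩑ (negF φ (FirstOrder.Language.Term.var n) ⩒ teqF t₀ (p.app pr (FirstOrder.Language.Term.var n)))
          ⩑ eqF (.ris (.var N) γ q) (extL ts (.ris (extL bs (.var N)) φ p)))
  | varris_ext {D : STerm L} (φ : QF L (Option ℕ)) (p : Pat L) (t : L.Term ℕ) (A : STerm L) :
      D.IsBar →
      EqRuleSym pr n N (.ris D φ p) (.ext t A)
        (eqF D (.ext (FirstOrder.Language.Term.var n) (.var N)) ⩑ posF φ (FirstOrder.Language.Term.var n)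
          ⩑ teqF t (p.app pr (FirstOrder.Language.Term.var n)) ⩑ eqF (.ris (.var N) φ p) A)

/-- `A` and `B` are distinguished by the element `n`. -/
def differ (n : ℕ) (A B : STerm L) : Form L :=
  (memF (FirstOrder.Language.Term.var n) A ⩑ nmemF (FirstOrder.Language.Term.var n) B)
    ⩒ (nmemF (FirstOrder.Language.Term.var n) A ⩑ memF (FirstOrder.Language.Term.var n) B)

/-- Rules for `A ≠ B`. -/
inductive NeqRule (n : ℕ) : STerm L → STerm L → Form L → Prop
  | emp_emp {A B : STerm L} : A.IsEmp → B.IsEmp → NeqRule n A B .fls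
  | var_self (X : ℕ) : NeqRule n (.var X) (.var X) .fls
  | swap {A : STerm L} (X : ℕ) : ¬ A.IsVar → ¬ A.IsRIS →
      NeqRule n A (.var X) (.con (.neq (.var X) A))
  | emp_ext {A : STerm L} (t : L.Term ℕ) (B : STerm L) : A.IsEmp → NeqRule n A (.ext t B) .tru
  | ext_emp {A : STerm L} (t : L.Term ℕ) (B : STerm L) : A.IsEmp → NeqRule n (.ext t B) A .tru
  | var_ext_var (X : ℕ) (t₀ : L.Term ℕ) (ts : List (L.Term ℕ)) :
      NeqRule n (.var X) (extL (t₀ :: ts) (.var X)) (differ n (.var X) (extL (t₀ :: ts) (.var X)))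
  | var_ext_ris (X : ℕ) (t₀ : L.Term ℕ) (ts : List (L.Term ℕ)) (D : STerm L)
      (φ : QF L (Option ℕ)) (p : Pat L) :
      NeqRule n (.var X) (extL (t₀ :: ts) (.ris D φ p))
        (differ n (.var X) (extL (t₀ :: ts) (.ris D φ p)))
  | ext_ext (t s : L.Term ℕ) (A B : STerm L) :
      NeqRule n (.ext t A) (.ext s B) (differ n (.ext t A) (.ext s B))
  | ris_any (D : STerm L) (φ : QF L (Option ℕ)) (p : Pat L) (A : STerm L) :
      NeqRule n (.ris D φ p) A (differ n (.ris D φ p) A)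
  | any_ris (D : STerm L) (φ : QF L (Option ℕ)) (p : Pat L) (A : STerm L) :
      NeqRule n A (.ris D φ p) (differ n A (.ris D φ p))

/-- Rules for `t ∈ A`. -/
inductive MemRule (pr : L.Functions 2) (n N : ℕ) (t : L.Term ℕ) : STerm L → Form L → Prop
  | emp {A : STerm L} : A.IsEmp → MemRule pr n N t A .fls
  | ext (s : L.Term ℕ) (A : STerm L) : MemRule pr n N t (.ext s A) (teqF t s ⩒ memF t A)
  | var (X : ℕ) : MemRule pr n N t (.var X) (eqF (.var X) (.ext t (.var N)))
  | ris (D : STerm L) (φ : QF L (Option ℕ)) (p : Pat L) :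
      MemRule pr n N t (.ris D φ p)
        (memF (FirstOrder.Language.Term.var n) D ⩑ posF φ (FirstOrder.Language.Term.var n)
          ⩑ teqF t (p.app pr (FirstOrder.Language.Term.var n)))

/-- Rules for `t ∉ A`. -/
inductive NmemRule (pr : L.Functions 2) (t : L.Term ℕ) : STerm L → Form L → Prop
  | emp {A : STerm L} : A.IsEmp → NmemRule pr t A .tru
  | ext (s : L.Term ℕ) (A : STerm L) : NmemRule pr t (.ext s A) (tneF t s ⩑ nmemF t A)
  | ris (d : L.Term ℕ) (D : STerm L) (φ : QF L (Option ℕ)) (p : Pat L) :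
      NmemRule pr t (.ris (.ext d D) φ p)
        ((posF φ d ⩑ tneF t (p.app pr d) ⩑ nmemF t (.ris D φ p))
          ⩒ (negF φ d ⩑ nmemF t (.ris D φ p)))

/-- A RIS with domain `{d ⊔ D}` is replaced by the fresh variable `N`; other terms are kept. -/
def unTerm (N : ℕ) : STerm L → STerm L
  | .ris (.ext _ _) _ _ => .var N
  | A => A

/-- The constraint that describes the fresh variable introduced by `unTerm`. -/
def unConstr (pr : L.Functions 2) (N : ℕ) : STerm L → Form L
  | .ris (.ext d D) φ p =>
      (eqF (.var N) (.ext (p.app pr d) (.ris D φ p)) ⩑ posF φ d)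
        ⩒ (eqF (.var N) (.ris D φ p) ⩑ negF φ d)
  | _ => .tru

/-- Rules for `A ∪ B = C`. -/
inductive UnRule (pr : L.Functions 2) (N N₁ N₂ : ℕ) :
    STerm L → STerm L → STerm L → Form L → Prop
  | same_var (X : ℕ) (B : STerm L) : UnRule pr N N₁ N₂ (.var X) (.var X) B (eqF (.var X) B)
  | emp_right (A B : STerm L) {C : STerm L} : C.IsEmp →
      UnRule pr N N₁ N₂ A B C (eqF A .emp ⩑ eqF B .emp)
  | emp_fst {E : STerm L} (A B : STerm L) : E.IsEmp → UnRule pr N N₁ N₂ E A B (eqF B A)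
  | emp_snd {E : STerm L} (A B : STerm L) : E.IsEmp → UnRule pr N N₁ N₂ A E B (eqF B A)
  | ext_fst (t : L.Term ℕ) (C A : STerm L) {B : STerm L} : B.IsBar →
      UnRule pr N N₁ N₂ (.ext t C) A B
        (eqF (.ext t C) (.ext t (.var N₁)) ⩑ nmemF t (.var N₁) ⩑ eqF B (.ext t (.var N))
          ⩑ ((nmemF t A ⩑ unF (.var N₁) A (.var N))
              ⩒ (eqF A (.ext t (.var N₂)) ⩑ nmemF t (.var N₂)
                  ⩑ unF (.var N₁) (.var N₂) (.var N))))
  | ext_snd (t : L.Term ℕ) (C A : STerm L) {B : STerm L} : B.IsBar →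
      UnRule pr N N₁ N₂ A (.ext t C) B
        (eqF (.ext t C) (.ext t (.var N₁)) ⩑ nmemF t (.var N₁) ⩑ eqF B (.ext t (.var N))
          ⩑ ((nmemF t A ⩑ unF (.var N₁) A (.var N))
              ⩒ (eqF A (.ext t (.var N₂)) ⩑ nmemF t (.var N₂)
                  ⩑ unF (.var N₁) (.var N₂) (.var N))))
  | ext_right (t : L.Term ℕ) (A B C : STerm L) :
      UnRule pr N N₁ N₂ A B (.ext t C)
        (eqF (.ext t C) (.ext t (.var N))
          ⩑ ((eqF A (.ext t (.var N₁)) ⩑ nmemF t (.var N₁) ⩑ unF (.var N₁) B (.var N))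
              ⩒ (eqF B (.ext t (.var N₁)) ⩑ nmemF t (.var N₁) ⩑ unF A (.var N₁) (.var N))
              ⩒ (eqF A (.ext t (.var N₁)) ⩑ nmemF t (.var N₁)
                  ⩑ eqF B (.ext t (.var N₂)) ⩑ nmemF t (.var N₂)
                  ⩑ unF (.var N₁) (.var N₂) (.var N))))
  | ris (A B C : STerm L) : A.IsExtRIS ∨ B.IsExtRIS ∨ C.IsExtRIS →
      UnRule pr N N₁ N₂ A B C
        (unF (unTerm N A) (unTerm N₁ B) (unTerm N₂ C)
          ⩑ unConstr pr N A ⩑ unConstr pr N₁ B ⩑ unConstr pr N₂ C)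

/-- Rules for `A ∩ B = ∅`. -/
inductive DisjRule (pr : L.Functions 2) : STerm L → STerm L → Form L → Prop
  | same_var (X : ℕ) : DisjRule pr (.var X) (.var X) (eqF (.var X) .emp)
  | any_emp (A : STerm L) {E : STerm L} : E.IsEmp → DisjRule pr A E .tru
  | emp_any (A : STerm L) {E : STerm L} : E.IsEmp → DisjRule pr E A .tru
  | any_ext (A : STerm L) (t : L.Term ℕ) (B : STerm L) :
      DisjRule pr A (.ext t B) (nmemF t A ⩑ disjF A B)
  | ext_any (t : L.Term ℕ) (B A : STerm L) :
      DisjRule pr (.ext t B) A (nmemF t A ⩑ disjF A B)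
  | any_ris (A : STerm L) (d : L.Term ℕ) (D : STerm L) (φ : QF L (Option ℕ)) (p : Pat L) :
      DisjRule pr A (.ris (.ext d D) φ p)
        ((posF φ d ⩑ nmemF (p.app pr d) A ⩑ disjF A (.ris D φ p))
          ⩒ (negF φ d ⩑ disjF A (.ris D φ p)))
  | ris_any (d : L.Term ℕ) (D : STerm L) (φ : QF L (Option ℕ)) (p : Pat L) (A : STerm L) :
      DisjRule pr (.ris (.ext d D) φ p) A
        ((posF φ d ⩑ nmemF (p.app pr d) A ⩑ disjF (.ris D φ p) A)
          ⩒ (negF φ d ⩑ disjF (.ris D φ p) A))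

/-- Rules for the sort constraints. -/
inductive SortRule : Constr L → Form L → Prop
  | set_emp : SortRule (.isSet (.ofSet .emp)) .tru
  | set_ext (t : L.Term ℕ) (A : STerm L) :
      SortRule (.isSet (.ofSet (.ext t A))) (.con (.isSet (.ofSet A)))
  | set_ris (D : STerm L) (φ : QF L (Option ℕ)) (p : Pat L) :
      SortRule (.isSet (.ofSet (.ris D φ p))) .tru
  | set_x (t : L.Term ℕ) : SortRule (.isSet (.ofX t)) .fls
  | x_emp : SortRule (.isX (.ofSet .emp)) .fls
  | x_ext (t : L.Term ℕ) (A : STerm L) : SortRule (.isX (.ofSet (.ext t A))) .fls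
  | x_ris (D : STerm L) (φ : QF L (Option ℕ)) (p : Pat L) :
      SortRule (.isX (.ofSet (.ris D φ p))) .fls
  | x_x {t : L.Term ℕ} : (∀ x, t ≠ FirstOrder.Language.Term.var x) → SortRule (.isX (.ofX t)) .tru

/-- Constraints with a hole at the place of one of their set arguments. -/
inductive Hole : (STerm L → Constr L) → Prop
  | eq_fst (B : STerm L) : Hole (fun A => .eq A B)
  | eq_snd (B : STerm L) : Hole (fun A => .eq B A)
  | nmem (t : L.Term ℕ) : Hole (fun A => .nmem t A)
  | un_fst (B C : STerm L) : Hole (fun A => .un A B C)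
  | un_snd (B C : STerm L) : Hole (fun A => .un B A C)
  | un_trd (B C : STerm L) : Hole (fun A => .un B C A)
  | disj_fst (B : STerm L) : Hole (fun A => .disj A B)
  | disj_snd (B : STerm L) : Hole (fun A => .disj B A)

/-- All rules that rewrite a single constraint.  The last one treats a RIS whose domain `E` is
itself a RIS, neither a variable-RIS nor one with empty domain: either `E` has an element, and is
replaced by `{n ⊔ N}`, or it is empty. -/
inductive Rule (pr : L.Functions 2) (n N N₁ N₂ : ℕ) : Constr L → Form L → Prop
  | eq {A B : STerm L} {Ψ : Form L} : EqRule pr n N N₁ N₂ A B Ψ →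
      Rule pr n N N₁ N₂ (.eq A B) Ψ
  | eq_left {A B : STerm L} {Ψ : Form L} : EqRuleSym pr n N A B Ψ →
      Rule pr n N N₁ N₂ (.eq A B) Ψ
  | eq_right {A B : STerm L} {Ψ : Form L} : EqRuleSym pr n N A B Ψ →
      Rule pr n N N₁ N₂ (.eq B A) Ψ
  | neq {A B : STerm L} {Ψ : Form L} : NeqRule n A B Ψ → Rule pr n N N₁ N₂ (.neq A B) Ψ
  | mem {t : L.Term ℕ} {A : STerm L} {Ψ : Form L} : MemRule pr n N t A Ψ →
      Rule pr n N N₁ N₂ (.mem t A) Ψ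
  | nmem {t : L.Term ℕ} {A : STerm L} {Ψ : Form L} : NmemRule pr t A Ψ →
      Rule pr n N N₁ N₂ (.nmem t A) Ψ
  | un {A B C : STerm L} {Ψ : Form L} : UnRule pr N N₁ N₂ A B C Ψ →
      Rule pr n N N₁ N₂ (.un A B C) Ψ
  | disj {A B : STerm L} {Ψ : Form L} : DisjRule pr A B Ψ → Rule pr n N N₁ N₂ (.disj A B) Ψ
  | sort {c : Constr L} {Ψ : Form L} : SortRule c Ψ → Rule pr n N N₁ N₂ c Ψ
  | nested {f : STerm L → Constr L} {E : STerm L} (φ : QF L (Option ℕ)) (p : Pat L) :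
      Hole f → E.IsRIS → ¬ E.IsVarRIS → ¬ E.IsEmp →
      Rule pr n N N₁ N₂ (f (.ris E φ p))
        ((eqF E (.ext (FirstOrder.Language.Term.var n) (.var N))
            ⩑ .con (f (.ris (.ext (FirstOrder.Language.Term.var n) (.var N)) φ p)))
          ⩒ (eqF E .emp ⩑ .con (f (.ris .emp φ p))))

/-! ## The solver -/

/-- The formulas handled along one non-deterministic branch are conjunctions, stored as lists. -/
def dnf : Form L → List (List (Lit L))
  | .tru => [[]]
  | .fls => [[.fls]]
  | .con c => [[.con c]]
  | .xf φ => [[.xf φ]]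
  | .and Φ Ψ => (dnf Φ).flatMap fun a => (dnf Ψ).map fun b => a ++ b
  | .or Φ Ψ => dnf Φ ++ dnf Ψ

/-- One non-deterministic branch: the current conjunction and the variables used so far. -/
structure State (L : FirstOrder.Language.{u, v}) where
  lits : List (Lit L)
  usedX : Finset ℕ
  usedS : Finset ℕ

/-- `n`, `N`, `N₁`, `N₂` are new and pairwise distinct. -/
def State.Fresh (s : State L) (n N N₁ N₂ : ℕ) : Prop :=
  n ∉ s.usedX ∧ N ∉ s.usedS ∧ N₁ ∉ s.usedS ∧ N₂ ∉ s.usedS ∧ N ≠ N₁ ∧ N ≠ N₂ ∧ N₁ ≠ N₂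

/-- The branches obtained by replacing one literal of `Γ ++ [·] ++ Δ` by the formula `Ψ`. -/
def State.branches (s : State L) (n N N₁ N₂ : ℕ) (Γ Δ : List (Lit L)) (Ψ : Form L) :
    List (State L) :=
  (dnf Ψ).map fun ψ => ⟨Γ ++ ψ ++ Δ, insert n s.usedX, insert N (insert N₁ (insert N₂ s.usedS))⟩

/-- `X` occurs in some constraint of `Γ` based on one of `=`, `≠`, `∈`, `∉`, `∪`, `∥`. -/
def OccursIn (X : ℕ) (Γ : List (Lit L)) : Prop :=
  ∃ c : Constr L, Lit.con c ∈ Γ ∧ c.pred.IsSetPred ∧ X ∈ c.svars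

/-- Application of one rule to one `π`-constraint of the current conjunction.  The rules `subst`
and `substSym` also substitute `X` by `A` in the rest of the conjunction. -/
inductive Step (pr : L.Functions 2) (π : Pred) : State L → List (State L) → Prop
  | rule {s : State L} {Γ Δ : List (Lit L)} {c : Constr L} {Ψ : Form L} {n N N₁ N₂ : ℕ} :
      s.lits = Γ ++ Lit.con c :: Δ → c.pred = π → s.Fresh n N N₁ N₂ →
      Rule pr n N N₁ N₂ c Ψ → Step pr π s (s.branches n N N₁ N₂ Γ Δ Ψ)
  | subst {s : State L} {Γ Δ : List (Lit L)} {X : ℕ} {A : STerm L} :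
      s.lits = Γ ++ Lit.con (.eq (.var X) A) :: Δ → π = .eq → OccursIn X (Γ ++ Δ) →
      ¬ A.IsExtRIS →
      Step pr π s [⟨Γ.map (Lit.subst X A) ++ Lit.con (.eq (.var X) A) :: Δ.map (Lit.subst X A),
        s.usedX, s.usedS⟩]
  | substSym {s : State L} {Γ Δ : List (Lit L)} {X : ℕ} {A : STerm L} :
      s.lits = Γ ++ Lit.con (.eq A (.var X)) :: Δ → π = .eq → OccursIn X (Γ ++ Δ) →
      ¬ A.IsExtRIS → ¬ A.IsVar →
      Step pr π s [⟨Γ.map (Lit.subst X A) ++ Lit.con (.eq (.var X) A) :: Δ.map (Lit.subst X A),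
        s.usedX, s.usedS⟩]

/-- The condition on `X` under which `remove_neq` rewrites `X ≠ B`: `X` is an argument of a
`∪`-constraint or the domain of a variable-RIS that is an argument of a `=`, `∉` or `∪`
constraint. -/
def NeqActive (X : ℕ) (Γ : List (Lit L)) : Prop :=
  (∃ A B C : STerm L, Lit.con (.un A B C) ∈ Γ ∧
    (A = .var X ∨ B = .var X ∨ C = .var X ∨
      (A.IsVarRIS ∧ A.HasDomVar X) ∨ (B.IsVarRIS ∧ B.HasDomVar X) ∨
      (C.IsVarRIS ∧ C.HasDomVar X))) ∨
  (∃ A B : STerm L, Lit.con (.eq A B) ∈ Γ ∧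
    ((A.IsVarRIS ∧ A.HasDomVar X) ∨ (B.IsVarRIS ∧ B.HasDomVar X))) ∨
  (∃ (t : L.Term ℕ) (A : STerm L), Lit.con (.nmem t A) ∈ Γ ∧ A.IsVarRIS ∧ A.HasDomVar X)

/-- One application of the rule of `remove_neq`. -/
inductive NeqStep : State L → List (State L) → Prop
  | rule {s : State L} {Γ Δ : List (Lit L)} {X : ℕ} {B : STerm L} {n N N₁ N₂ : ℕ} :
      s.lits = Γ ++ Lit.con (.neq (.var X) B) :: Δ → NeqActive X s.lits →
      s.Fresh n N N₁ N₂ →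
      NeqStep s (s.branches n N N₁ N₂ Γ Δ
        ((memF (FirstOrder.Language.Term.var n) (.var X) ⩑ nmemF (FirstOrder.Language.Term.var n) B)
          ⩒ (memF (FirstOrder.Language.Term.var n) B ⩑ nmemF (FirstOrder.Language.Term.var n) (.var X))))

/-- Exhaustive application of the relation `R` to each branch of a list, all non-deterministic
alternatives being explored; a conjunction that contains `false` becomes `false`. -/
inductive Exhaust (R : State L → List (State L) → Prop) : List (State L) → List (State L) → Prop
  | nil : Exhaust R [] []
  | fls {s : State L} {ss ts : List (State L)} : Lit.fls ∈ s.lits → Exhaust R ss ts →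
      Exhaust R (s :: ss) (⟨[.fls], s.usedX, s.usedS⟩ :: ts)
  | done {s : State L} {ss ts : List (State L)} : Lit.fls ∉ s.lits → (¬ ∃ bs, R s bs) →
      Exhaust R ss ts → Exhaust R (s :: ss) (s :: ts)
  | step {s : State L} {bs ss ts : List (State L)} : Lit.fls ∉ s.lits → R s bs →
      Exhaust R (bs ++ ss) ts → Exhaust R (s :: ss) ts

/-- The rewriting procedures of the given predicate symbols, one after the other. -/
def rewriteAll (pr : L.Functions 2) : List Pred → List (State L) → List (State L) → Prop
  | [], ss, ts => ts = ss
  | π :: πs, ss, ts => ∃ us, Exhaust (Step pr π) ss us ∧ rewriteAll pr πs us ts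

open Classical in
/-- Adds the sort constraints `set(X)` and `isX(x)`, where missing, for the variables that occur
in the constraints of the conjunction. -/
def sortInfer (s : State L) : State L :=
  let cs : List (Constr L) := s.lits.filterMap fun l => match l with
    | .con c => some c
    | _ => none
  let sv : List (Lit L) := (cs.foldr (fun c V => c.svars ∪ V) (∅ : Finset ℕ)).toList.map
    fun X => .con (.isSet (.ofSet (.var X)))
  let xv : List (Lit L) := (cs.foldr (fun c V => c.xvars ∪ V) (∅ : Finset ℕ)).toList.map
    fun x => .con (.isX (.ofX (FirstOrder.Language.Term.var x)))
  { s with lits := s.lits ++ (sv ++ xv).filter fun l => l ∉ s.lits }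

/-- Sort constraints that no assignment satisfies. -/
def IllSorted : Lit L → Prop
  | .con (.isSet (.ofX _)) => True
  | .con (.isX (.ofSet _)) => True
  | _ => False

open Classical in
/-- Turns the conjunction into `false` if its sort constraints are unsatisfiable. -/
def sortCheck (s : State L) : State L :=
  if ∃ l ∈ s.lits, IllSorted l then { s with lits := [.fls] } else s

/-- The procedure `STEP`, applied to each branch of a list. -/
def STEP (pr : L.Functions 2) (ss ts : List (State L)) : Prop :=
  ∃ us, rewriteAll pr [.eq, .neq, .mem, .nmem, .un, .disj, .isSet, .isX] ss us ∧
    ts = us.map fun s => sortCheck (sortInfer s)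

/-- Two branches carry the same conjunction, up to order and repetition of conjuncts. -/
def Same (s t : State L) : Prop := ∀ l, l ∈ s.lits ↔ l ∈ t.lits

open Classical in
/-- `repeat Φ' ← Φ; Φ ← body(Φ) until Φ = Φ'`, along all branches. -/
inductive RepeatUntil (body : State L → List (State L) → Prop) :
    List (State L) → List (State L) → Prop
  | nil : RepeatUntil body [] []
  | cons {s : State L} {ts ss us : List (State L)} : body s ts →
      RepeatUntil body (ts.filter (fun t => ¬ Same s t) ++ ss) us →
      RepeatUntil body (s :: ss) (ts.filter (fun t => Same s t) ++ us)

/-- The body of the outer loop: iterate `STEP` until nothing changes, then `remove_neq`. -/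
def outerBody (pr : L.Functions 2) (s : State L) (ts : List (State L)) : Prop :=
  ∃ us, RepeatUntil (fun s ts => STEP pr [s] ts) [s] us ∧ Exhaust NeqStep us ts

/-- Conjunction of a list of formulas. -/
def conjForm (l : List (Form L)) : Form L := l.foldr Form.and .tru

/-- `Φ_S ∧ Φ_X` is turned into `Φ_S ∧ SAT_X(Φ_X)`, where the decision procedure `satX` of the
parameter theory keeps `Φ_X` if it is satisfiable and replaces it by `false` otherwise. -/
def finish (satX : QF L ℕ → Bool) (s : State L) : Form L :=
  let ΦX : QF L ℕ := QF.conj (s.lits.filterMap fun l => match l with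
    | .xf φ => some φ
    | _ => none)
  let ΦS : Form L := conjForm (s.lits.filterMap fun l => match l with
    | .fls => some .fls
    | .con c => some (.con c)
    | .xf _ => none)
  ΦS ⩑ (if satX ΦX then .xf ΦX else .fls)

/-- `SatRIS pr satX Φ outs`: some run of the solver on `Φ` terminates along all its
non-deterministic branches and returns the collection `outs`. -/
def SatRIS (pr : L.Functions 2) (satX : QF L ℕ → Bool) (Φ : Form L) (outs : List (Form L)) :
    Prop :=
  ∃ ts, RepeatUntil (outerBody pr)
      ((dnf Φ).map fun l => sortInfer ⟨l, Φ.xvars, Φ.svars⟩) ts ∧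
    outs = ts.map (finish satX)

end

end RIS

/-!
Every step of the solver preserves the solutions in the following one-sided sense, which composes
along a run (`Equi`): each solution of a branch becomes a solution of one of the branches that
replace it once suitable values are given to the new variables, and each solution of a new branch,
as it stands, is a solution of the old one.  Termination enters only through the inductive
definitions of `Exhaust` and `RepeatUntil`, so that it suffices to treat a single rewrite rule
(`Rule.sound`, `Rule.complete`).  All variables of a conjunction are recorded as used (`State.Good`,
`Rule.rhs_in`), hence new variables can be assigned any value without changing the values of the
other conjuncts.

Soundness of a rule is a computation with unions in which the new variables are arbitrary.  For
completeness one has to find the values of the new variables.  The equations whose two sides share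
a domain variable `X` are the delicate ones.  There `t₀` lies in the value of the left-hand side
`{t₀, ts ⊔ R}`.  If it equals one of the listed elements of the other side, then one of six cases
applies, according to where else `t₀` occurs (`sixBranches_complete`).  Otherwise `t₀` is the
pattern of an element `n` of `X` that passes the filter.  If `t₀` is redundant on the left, the new
variable may keep the value of `X`; if not, it gets `X` without `n`, which removes exactly `t₀` from
one side and leaves the other RIS as it is, except that `p(n)` may be lost when the rule itself puts
it back (`exists_shared`, `sharedPairRhs_complete`).  This uses that patterns are
injective, and that two patterns of the form `(c, t)` with equal values have the same control
element; both follow from the injectivity of pairing.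
-/

namespace RIS
open FirstOrder.Language

variable {L : FirstOrder.Language.{u, v}} {M : Type w} [L.Structure M]

/-! ### Terms and formulas whose variables lie in given sets -/

/-- All variables of the term `t` belong to `U`. -/
def TermIn (U : Finset ℕ) (t : L.Term ℕ) : Prop := t.varFinset ⊆ U

/-- All variables of the filter `φ`, except the control variable, belong to `U`. -/
def FilterIn (U : Finset ℕ) (φ : QF L (Option ℕ)) : Prop := ∀ x, some x ∈ φ.vars → x ∈ U

/-- All variables of the pattern `p`, except the control variable, belong to `U`. -/
def PatIn (U : Finset ℕ) (p : Pat L) : Prop := ∀ x, some x ∈ p.vars → x ∈ U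

/-- All variables of the set term `A` belong to `U` (sort `X`) or `V` (sort `Set`). -/
def STerm.In (U V : Finset ℕ) (A : STerm L) : Prop := A.xvars ⊆ U ∧ A.svars ⊆ V

/-- All variables of the constraint `c` belong to `U` (sort `X`) or `V` (sort `Set`). -/
def Constr.In (U V : Finset ℕ) (c : Constr L) : Prop := c.xvars ⊆ U ∧ c.svars ⊆ V

/-- All variables of the formula `Φ` belong to `U` (sort `X`) or `V` (sort `Set`). -/
def Form.In (U V : Finset ℕ) (Φ : Form L) : Prop := Φ.xvars ⊆ U ∧ Φ.svars ⊆ V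

/-- All variables of the literal `l` belong to `U` (sort `X`) or `V` (sort `Set`). -/
def Lit.In (U V : Finset ℕ) : Lit L → Prop
  | .fls => True
  | .con c => c.In U V
  | .xf φ => φ.vars ⊆ U

section In

variable {U V : Finset ℕ}

@[simp] theorem termIn_var (x : ℕ) : TermIn U (Term.var x : L.Term ℕ) ↔ x ∈ U := by
  simp [TermIn, Term.varFinset]

@[simp] theorem STerm.in_var (X : ℕ) : (STerm.var X : STerm L).In U V ↔ X ∈ V := by
  simp [STerm.In, STerm.xvars, STerm.svars]

@[simp] theorem STerm.in_emp : (STerm.emp : STerm L).In U V := by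
  simp [STerm.In, STerm.xvars, STerm.svars]

@[simp] theorem STerm.in_ext (t : L.Term ℕ) (A : STerm L) :
    (STerm.ext t A).In U V ↔ TermIn U t ∧ A.In U V := by
  simp [STerm.In, STerm.xvars, STerm.svars, TermIn, Finset.union_subset_iff, and_assoc]

@[simp] theorem STerm.in_ris (D : STerm L) (φ : QF L (Option ℕ)) (p : Pat L) :
    (STerm.ris D φ p).In U V ↔ D.In U V ∧ FilterIn U φ ∧ PatIn U p := by
  have h : ∀ s : Finset (Option ℕ), Finset.eraseNone s ⊆ U ↔ ∀ x, some x ∈ s → x ∈ U := by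
    intro s
    simp [Finset.subset_iff]
  simp only [STerm.In, STerm.xvars, STerm.svars, FilterIn, PatIn, Finset.union_subset_iff, h]
  tauto

@[simp] theorem STerm.in_extL (ts : List (L.Term ℕ)) (A : STerm L) :
    (extL ts A).In U V ↔ (∀ t ∈ ts, TermIn U t) ∧ A.In U V := by
  induction ts with
  | nil => simp [extL]
  | cons t ts ih =>
    have : extL (t :: ts) A = .ext t (extL ts A) := rfl
    simp [this, ih, and_assoc]

@[simp] theorem Constr.in_eq (A B : STerm L) :
    (Constr.eq A B).In U V ↔ A.In U V ∧ B.In U V := by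
  simp only [Constr.In, STerm.In, Constr.xvars, Constr.svars, Finset.union_subset_iff]; tauto

@[simp] theorem Constr.in_neq (A B : STerm L) :
    (Constr.neq A B).In U V ↔ A.In U V ∧ B.In U V := by
  simp only [Constr.In, STerm.In, Constr.xvars, Constr.svars, Finset.union_subset_iff]; tauto

@[simp] theorem Constr.in_mem (t : L.Term ℕ) (A : STerm L) :
    (Constr.mem t A).In U V ↔ TermIn U t ∧ A.In U V := by
  simp only [Constr.In, STerm.In, TermIn, Constr.xvars, Constr.svars, Finset.union_subset_iff]
  tauto

@[simp] theorem Constr.in_nmem (t : L.Term ℕ) (A : STerm L) :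
    (Constr.nmem t A).In U V ↔ TermIn U t ∧ A.In U V := by
  simp only [Constr.In, STerm.In, TermIn, Constr.xvars, Constr.svars, Finset.union_subset_iff]
  tauto

@[simp] theorem Constr.in_un (A B C : STerm L) :
    (Constr.un A B C).In U V ↔ A.In U V ∧ B.In U V ∧ C.In U V := by
  simp only [Constr.In, STerm.In, Constr.xvars, Constr.svars, Finset.union_subset_iff]; tauto

@[simp] theorem Constr.in_disj (A B : STerm L) :
    (Constr.disj A B).In U V ↔ A.In U V ∧ B.In U V := by
  simp only [Constr.In, STerm.In, Constr.xvars, Constr.svars, Finset.union_subset_iff]; tauto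

@[simp] theorem Constr.in_isSet_ofSet (A : STerm L) :
    (Constr.isSet (.ofSet A)).In U V ↔ A.In U V := Iff.rfl

@[simp] theorem Constr.in_isX_ofX (t : L.Term ℕ) :
    (Constr.isX (.ofX t)).In U V ↔ TermIn U t := by
  simp [Constr.In, TermIn, Constr.xvars, Constr.svars, Arg.xvars, Arg.svars]

@[simp] theorem Form.in_tru : (Form.tru : Form L).In U V := by
  simp [Form.In, Form.xvars, Form.svars]

@[simp] theorem Form.in_fls : (Form.fls : Form L).In U V := by
  simp [Form.In, Form.xvars, Form.svars]

@[simp] theorem Form.in_con (c : Constr L) : (Form.con c).In U V ↔ c.In U V := Iff.rfl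

@[simp] theorem Form.in_xf (φ : QF L ℕ) : (Form.xf φ).In U V ↔ φ.vars ⊆ U := by
  simp [Form.In, Form.xvars, Form.svars]

@[simp] theorem Form.in_and (Φ Ψ : Form L) : (Φ ⩑ Ψ).In U V ↔ Φ.In U V ∧ Ψ.In U V := by
  simp only [Form.In, Form.xvars, Form.svars, Finset.union_subset_iff]; tauto

@[simp] theorem Form.in_or (Φ Ψ : Form L) : (Φ ⩒ Ψ).In U V ↔ Φ.In U V ∧ Ψ.In U V := by
  simp only [Form.In, Form.xvars, Form.svars, Finset.union_subset_iff]; tauto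

@[simp] theorem vars_neg_subset (φ : QF L ℕ) : φ.neg.vars ⊆ U ↔ φ.vars ⊆ U := Iff.rfl

@[simp] theorem vars_eq_subset (t s : L.Term ℕ) :
    (QF.eq t s).vars ⊆ U ↔ TermIn U t ∧ TermIn U s := by
  simp [QF.vars, TermIn, Finset.union_subset_iff]

theorem Constr.In.mono {U' V' : Finset ℕ} {c : Constr L} (h : c.In U V) (hU : U ⊆ U')
    (hV : V ⊆ V') : c.In U' V' :=
  ⟨h.1.trans hU, h.2.trans hV⟩

theorem Lit.In.mono {U' V' : Finset ℕ} {l : Lit L} (h : l.In U V) (hU : U ⊆ U')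
    (hV : V ⊆ V') : l.In U' V' := by
  cases l with
  | fls => trivial
  | con c => exact Constr.In.mono h hU hV
  | xf φ => exact Finset.Subset.trans h hU

theorem mem_varFinset_subst {α β : Type} [DecidableEq α] [DecidableEq β] (f : α → L.Term β)
    (t : L.Term α) (y : β) (hy : y ∈ (t.subst f).varFinset) :
    ∃ x ∈ t.varFinset, y ∈ (f x).varFinset := by
  induction t with
  | var x => exact ⟨x, by simp [Term.varFinset], hy⟩
  | func F ts ih =>
    simp only [Term.subst, Term.varFinset, Finset.mem_biUnion, Finset.mem_univ, true_and] at hy ⊢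
    obtain ⟨i, hi⟩ := hy
    obtain ⟨x, hx, hyx⟩ := ih i hi
    exact ⟨x, ⟨i, hx⟩, hyx⟩

theorem QF.mem_vars_subst {α β : Type} [DecidableEq α] [DecidableEq β] (f : α → L.Term β)
    (φ : QF L α) (y : β) (hy : y ∈ (φ.subst f).vars) : ∃ x ∈ φ.vars, y ∈ (f x).varFinset := by
  induction φ with
  | tru => simp [QF.subst, QF.vars] at hy
  | eq t s =>
    simp only [QF.subst, QF.vars, Finset.mem_union] at hy ⊢
    rcases hy with hy | hy
    · obtain ⟨x, hx, h⟩ := mem_varFinset_subst f _ y hy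
      exact ⟨x, .inl hx, h⟩
    · obtain ⟨x, hx, h⟩ := mem_varFinset_subst f _ y hy
      exact ⟨x, .inr hx, h⟩
  | rel R ts =>
    simp only [QF.subst, QF.vars, Finset.mem_biUnion, Finset.mem_univ, true_and] at hy ⊢
    obtain ⟨i, hi⟩ := hy
    obtain ⟨x, hx, h⟩ := mem_varFinset_subst f _ y hi
    exact ⟨x, ⟨i, hx⟩, h⟩
  | neg φ ih => exact ih hy
  | and φ ψ ih₁ ih₂ | or φ ψ ih₁ ih₂ =>
    simp only [QF.subst, QF.vars, Finset.mem_union] at hy ⊢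
    rcases hy with hy | hy
    · obtain ⟨x, hx, h⟩ := ih₁ hy
      exact ⟨x, .inl hx, h⟩
    · obtain ⟨x, hx, h⟩ := ih₂ hy
      exact ⟨x, .inr hx, h⟩

theorem at'_in {φ : QF L (Option ℕ)} {d : L.Term ℕ} (hφ : FilterIn U φ) (hd : TermIn U d) :
    (at' φ d).vars ⊆ U := by
  intro y hy
  obtain ⟨x, hx, h⟩ := QF.mem_vars_subst _ _ _ hy
  cases x with
  | none => exact hd h
  | some x =>
    simp only [inst, Term.varFinset, Finset.mem_singleton] at h
    exact hφ y (h ▸ hx)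

theorem Pat.app_in {pr : L.Functions 2} {p : Pat L} {d : L.Term ℕ} (hp : PatIn U p)
    (hd : TermIn U d) : TermIn U (p.app pr d) := by
  cases p with
  | ctrl => exact hd
  | pair t =>
    intro y hy
    simp only [Pat.app, Functions.apply₂, Term.varFinset, Finset.mem_biUnion, Finset.mem_univ,
      true_and, Fin.exists_fin_two, Matrix.cons_val_zero, Matrix.cons_val_one] at hy
    rcases hy with hy | hy
    · exact hd hy
    · obtain ⟨x, hx, h⟩ := mem_varFinset_subst _ _ _ hy
      cases x with
      | none => exact hd h
      | some x =>
        simp only [inst, Term.varFinset, Finset.mem_singleton] at h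
        exact hp y (by rw [h]; simpa [Pat.vars] using hx)

theorem bigOr_in {l : List (Form L)} (h : ∀ Ψ ∈ l, Ψ.In U V) : (bigOr l).In U V := by
  induction l with
  | nil => simp [bigOr]
  | cons Φ l ih =>
    cases l with
    | nil => simpa [bigOr] using h
    | cons Ψ l =>
      rw [bigOr, Form.in_or]
      exact ⟨h _ (by simp), ih fun Ψ' h' => h _ (List.mem_cons_of_mem _ h')⟩

end In

/-! ### Agreement of assignments -/

/-- `σ` and `τ` agree on the variables in `U` (sort `X`) and in `V` (sort `Set`). -/
def Agree (U V : Finset ℕ) (σ τ : Val M) : Prop :=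
  (∀ x ∈ U, τ.x x = σ.x x) ∧ ∀ X ∈ V, τ.s X = σ.s X

section Agree

variable {U V : Finset ℕ} {σ τ : Val M}

theorem realize_congr {α : Type} [DecidableEq α] {e e' : α → M} (t : L.Term α)
    (h : ∀ x ∈ t.varFinset, e' x = e x) : t.realize e' = t.realize e := by
  induction t with
  | var x => exact h x (by simp [Term.varFinset])
  | func F ts ih =>
    simp only [Term.realize]
    congr 1
    funext i
    exact ih i fun x hx => h x (by
      simp only [Term.varFinset, Finset.mem_biUnion, Finset.mem_univ, true_and]
      exact ⟨i, hx⟩)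

theorem QF.realize_congr {α : Type} [DecidableEq α] {e e' : α → M} (φ : QF L α)
    (h : ∀ x ∈ φ.vars, e' x = e x) : φ.Realize e' ↔ φ.Realize e := by
  induction φ with
  | tru => rfl
  | eq t s =>
    simp only [QF.vars, Finset.mem_union] at h
    simp only [QF.Realize]
    rw [RIS.realize_congr t fun x hx => h x (.inl hx),
      RIS.realize_congr s fun x hx => h x (.inr hx)]
  | rel R ts =>
    simp only [QF.vars, Finset.mem_biUnion, Finset.mem_univ, true_and] at h
    have : (fun i => (ts i).realize e') = fun i => (ts i).realize e := by
      funext i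
      exact RIS.realize_congr (ts i) fun x hx => h x ⟨i, hx⟩
    simp only [QF.Realize, this]
  | neg φ ih => exact not_congr (ih h)
  | and φ ψ ih₁ ih₂ =>
    simp only [QF.vars, Finset.mem_union] at h
    exact and_congr (ih₁ fun x hx => h x (.inl hx)) (ih₂ fun x hx => h x (.inr hx))
  | or φ ψ ih₁ ih₂ =>
    simp only [QF.vars, Finset.mem_union] at h
    exact or_congr (ih₁ fun x hx => h x (.inl hx)) (ih₂ fun x hx => h x (.inr hx))

theorem Agree.term (h : Agree U V σ τ) {t : L.Term ℕ} (ht : TermIn U t) :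
    t.realize τ.x = t.realize σ.x :=
  realize_congr t fun x hx => h.1 x (ht hx)

theorem Agree.env_eq (h : Agree U V σ τ) (d : M) {s : Finset (Option ℕ)}
    (hs : ∀ x, some x ∈ s → x ∈ U) : ∀ x ∈ s, env τ.x d x = env σ.x d x := by
  rintro (_ | x) hx
  · rfl
  · exact h.1 x (hs x hx)

/-- The filter `φ` as a predicate of the control element. -/
def QF.At (φ : QF L (Option ℕ)) (e : ℕ → M) (d : M) : Prop := φ.Realize (env e d)

theorem Agree.filter (h : Agree U V σ τ) {φ : QF L (Option ℕ)} (hφ : FilterIn U φ) :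
    φ.At τ.x = φ.At σ.x :=
  funext fun d => propext (QF.realize_congr φ (h.env_eq d hφ))

theorem Agree.pat (h : Agree U V σ τ) (pr : L.Functions 2) {p : Pat L} (hp : PatIn U p) (d : M) :
    p.eval pr τ.x d = p.eval pr σ.x d := by
  cases p with
  | ctrl => rfl
  | pair t =>
    have : t.realize (env τ.x d) = t.realize (env σ.x d) :=
      realize_congr t (h.env_eq d fun x hx => hp x (by simp [Pat.vars, hx]))
    simp only [Pat.eval, this]

theorem Agree.set (h : Agree U V σ τ) (pr : L.Functions 2) {A : STerm L} (hA : A.In U V) :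
    A.eval pr τ = A.eval pr σ := by
  induction A with
  | var X =>
    simp only [STerm.in_var] at hA
    simp only [STerm.eval, h.2 X hA]
  | emp => rfl
  | ext t A ih =>
    simp only [STerm.in_ext] at hA
    simp only [STerm.eval, ih hA.2, h.term hA.1]
  | ris D φ p ih =>
    simp only [STerm.in_ris] at hA
    have hφ : ∀ d, φ.Realize (env τ.x d) = φ.Realize (env σ.x d) :=
      fun d => congrFun (h.filter hA.2.1) d
    simp only [STerm.eval, ih hA.1, hφ, h.pat pr hA.2.2]

theorem Agree.constr (h : Agree U V σ τ) (pr : L.Functions 2) {c : Constr L} (hc : c.In U V) :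
    c.Holds pr τ ↔ c.Holds pr σ := by
  cases c with
  | eq A B | neq A B | disj A B =>
    simp at hc
    simp only [Constr.Holds, h.set pr hc.1, h.set pr hc.2]
  | un A B C =>
    simp at hc
    simp only [Constr.Holds, h.set pr hc.1, h.set pr hc.2.1, h.set pr hc.2.2]
  | mem t A | nmem t A =>
    simp at hc
    simp only [Constr.Holds, h.set pr hc.2, h.term hc.1]
  | isSet a | isX a => cases a <;> rfl

/-- Truth of a literal. -/
def Lit.Holds (pr : L.Functions 2) (σ : Val M) : Lit L → Prop
  | .fls => False
  | .con c => c.Holds pr σ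
  | .xf φ => φ.Realize σ.x

theorem Agree.lit (h : Agree U V σ τ) (pr : L.Functions 2) {l : Lit L} (hl : l.In U V) :
    l.Holds pr τ ↔ l.Holds pr σ := by
  cases l with
  | fls => rfl
  | con c => exact h.constr pr hl
  | xf φ => exact QF.realize_congr φ fun x hx => h.1 x (hl hx)

theorem Agree.mono {U' V' : Finset ℕ} (h : Agree U V σ τ) (hU : U' ⊆ U) (hV : V' ⊆ V) :
    Agree U' V' σ τ :=
  ⟨fun x hx => h.1 x (hU hx), fun X hX => h.2 X (hV hX)⟩

theorem Agree.trans {ρ : Val M} (h : Agree U V σ τ) (h' : Agree U V τ ρ) : Agree U V σ ρ :=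
  ⟨fun x hx => (h'.1 x hx).trans (h.1 x hx), fun X hX => (h'.2 X hX).trans (h.2 X hX)⟩

theorem Agree.refl (U V : Finset ℕ) (σ : Val M) : Agree U V σ σ :=
  ⟨fun _ _ => rfl, fun _ _ => rfl⟩

/-- New variables can be given arbitrary values without changing the values of the old ones. -/
theorem exists_agree {n N N₁ N₂ : ℕ} (hn : n ∉ U) (hN : N ∉ V) (hN₁ : N₁ ∉ V) (hN₂ : N₂ ∉ V)
    (h₁ : N ≠ N₁) (h₂ : N ≠ N₂) (h₃ : N₁ ≠ N₂) (σ : Val M) (a : M) {A B C : Set M}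
    (hA : A.Finite) (hB : B.Finite) (hC : C.Finite) :
    ∃ τ : Val M, Agree U V σ τ ∧ τ.x n = a ∧ (τ.s N : Set M) = A ∧ (τ.s N₁ : Set M) = B ∧
      (τ.s N₂ : Set M) = C := by
  classical
  refine ⟨⟨Function.update σ.x n a, Function.update (Function.update (Function.update σ.s N
    hA.toFinset) N₁ hB.toFinset) N₂ hC.toFinset⟩, ⟨?_, ?_⟩, ?_, ?_, ?_, ?_⟩
  · intro x hx
    simp only [Function.update_apply]
    rw [if_neg (by rintro rfl; exact hn hx)]
  · intro X hX
    simp only [Function.update_apply]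
    rw [if_neg (by rintro rfl; exact hN₂ hX), if_neg (by rintro rfl; exact hN₁ hX),
      if_neg (by rintro rfl; exact hN hX)]
  all_goals simp [h₁, h₂, h₃]

end Agree

/-! ### Values of instances and iterated extensions -/

theorem realize_inst (e : ℕ → M) (d : L.Term ℕ) :
    (fun x => (inst d x).realize e) = env e (d.realize e) := by
  funext x
  cases x <;> rfl

@[simp] theorem realize_at' (e : ℕ → M) (φ : QF L (Option ℕ)) (d : L.Term ℕ) :
    (at' φ d).Realize e ↔ φ.At e (d.realize e) := by
  have h : ∀ ψ : QF L (Option ℕ),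
      (ψ.subst (inst d)).Realize e ↔ ψ.Realize (env e (d.realize e)) := by
    intro ψ
    induction ψ with
    | tru => rfl
    | eq t s => simp only [QF.subst, QF.Realize, Term.realize_subst, realize_inst]
    | rel R ts => simp only [QF.subst, QF.Realize, Term.realize_subst, realize_inst]
    | neg ψ ih => exact not_congr ih
    | and ψ χ ih₁ ih₂ => exact and_congr ih₁ ih₂
    | or ψ χ ih₁ ih₂ => exact or_congr ih₁ ih₂
  exact h φ

@[simp] theorem Pat.realize_app (pr : L.Functions 2) (e : ℕ → M) (p : Pat L) (d : L.Term ℕ) :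
    (p.app pr d).realize e = p.eval pr e (d.realize e) := by
  cases p with
  | ctrl => rfl
  | pair t =>
    simp only [Pat.app, Pat.eval, Functions.apply₂, Term.realize]
    congr 1
    funext i
    fin_cases i
    · rfl
    · simp [realize_inst]

/-- The set of values of a list of terms. -/
def vals (e : ℕ → M) (ts : List (L.Term ℕ)) : Set M := {y | ∃ t ∈ ts, t.realize e = y}

@[simp] theorem vals_nil (e : ℕ → M) : vals e ([] : List (L.Term ℕ)) = ∅ := by
  simp [vals]

@[simp] theorem vals_cons (e : ℕ → M) (t : L.Term ℕ) (ts : List (L.Term ℕ)) :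
    vals e (t :: ts) = {t.realize e} ∪ vals e ts := by
  ext y
  simp [vals, eq_comm]

theorem vals_eraseIdx (e : ℕ → M) (ts : List (L.Term ℕ)) (j : Fin ts.length) :
    vals e ts = {(ts.get j).realize e} ∪ vals e (ts.eraseIdx j) := by
  rw [← vals_cons]
  ext y
  simp only [vals, Set.mem_ofPred_eq]
  constructor
  all_goals
    rintro ⟨t, ht, rfl⟩
    exact ⟨t, by first | exact (List.getElem_cons_eraseIdx_perm j.isLt).mem_iff.1 ht
                       | exact (List.getElem_cons_eraseIdx_perm j.isLt).mem_iff.2 ht, rfl⟩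

theorem Agree.vals {U V : Finset ℕ} {σ τ : Val M} (h : Agree U V σ τ) {ts : List (L.Term ℕ)}
    (hts : ∀ t ∈ ts, TermIn U t) : vals τ.x ts = vals σ.x ts := by
  ext y
  simp only [RIS.vals, Set.mem_ofPred_eq]
  exact exists_congr fun t => and_congr_right fun ht => by rw [h.term (hts t ht)]

@[simp] theorem eval_extL (pr : L.Functions 2) (σ : Val M) (ts : List (L.Term ℕ)) (A : STerm L) :
    (extL ts A).eval pr σ = vals σ.x ts ∪ A.eval pr σ := by
  induction ts with
  | nil => simp [extL]
  | cons t ts ih =>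
    have : extL (t :: ts) A = .ext t (extL ts A) := rfl
    rw [this, STerm.eval, ih, vals_cons, Set.union_assoc]

theorem STerm.IsEmp.eval_eq (pr : L.Functions 2) (σ : Val M) {A : STerm L} (h : A.IsEmp) :
    A.eval pr σ = ∅ := by
  induction A with
  | var X => exact h.elim
  | emp => rfl
  | ext t A => exact h.elim
  | ris D φ p ih => simp [STerm.eval, ih h]

@[simp] theorem bigOr_holds (pr : L.Functions 2) (σ : Val M) (l : List (Form L)) :
    (bigOr l).Holds pr σ ↔ ∃ Ψ ∈ l, Ψ.Holds pr σ := by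
  induction l with
  | nil => simp [bigOr, Form.Holds]
  | cons Φ l ih =>
    cases l with
    | nil => simp [bigOr]
    | cons Ψ l => rw [bigOr, Form.Holds, ih]; simp

/-- Patterns are injective: the pairing function is injective in its first argument. -/
theorem Pat.eval_injective {pr : L.Functions 2}
    (hpr : ∀ a b c d : M, Structure.funMap pr ![a, b] = Structure.funMap pr ![c, d] →
      a = c ∧ b = d) {e : ℕ → M} {p : Pat L} {d d' : M}
    (h : p.eval pr e d = p.eval pr e d') : d = d' := by
  cases p with
  | ctrl => exact h
  | pair t => exact (hpr _ _ _ _ h).1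

/-- Values of two proper pair patterns coincide only at the same control element. -/
theorem Pat.eval_eq_eval {pr : L.Functions 2}
    (hpr : ∀ a b c d : M, Structure.funMap pr ![a, b] = Structure.funMap pr ![c, d] →
      a = c ∧ b = d) {e : ℕ → M} {p q : Pat L} (hp : p ≠ .ctrl) (hq : q ≠ .ctrl) {d d' : M}
    (h : p.eval pr e d = q.eval pr e d') : d = d' := by
  cases p with
  | ctrl => exact (hp rfl).elim
  | pair t =>
    cases q with
    | ctrl => exact (hq rfl).elim
    | pair s => exact (hpr _ _ _ _ h).1

/-! ### Filtered images -/

/-- The set `{f d : d ∈ D, P d}`, the value of a RIS. -/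
def img (D : Set M) (P : M → Prop) (f : M → M) : Set M := {y | ∃ d, d ∈ D ∧ P d ∧ y = f d}

theorem mem_img {D : Set M} {P : M → Prop} {f : M → M} {y : M} :
    y ∈ img D P f ↔ ∃ d, d ∈ D ∧ P d ∧ y = f d := Iff.rfl

theorem img_union (A B : Set M) (P : M → Prop) (f : M → M) :
    img (A ∪ B) P f = img A P f ∪ img B P f := by
  ext y
  simp only [mem_img, Set.mem_union]
  grind

theorem img_singleton_of_pos {P : M → Prop} {a : M} (h : P a) (f : M → M) :
    img {a} P f = {f a} := by
  ext y
  simp only [mem_img, Set.mem_singleton_iff]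
  grind

theorem img_singleton_of_neg {P : M → Prop} {a : M} (h : ¬ P a) (f : M → M) :
    img {a} P f = ∅ := by
  ext y
  simp only [mem_img, Set.mem_singleton_iff, Set.mem_empty_iff_false]
  grind

theorem mem_img_id {D : Set M} {P : M → Prop} {y : M} :
    y ∈ img D P (fun d => d) ↔ y ∈ D ∧ P y := by
  simp only [mem_img]
  grind

theorem img_union_diff_of_neg {P : M → Prop} {a : M} (h : ¬ P a) (B X : Set M) (f : M → M) :
    img (B ∪ X \ {a}) P f = img (B ∪ X) P f := by
  ext y
  simp only [mem_img, Set.mem_union, Set.mem_sdiff, Set.mem_singleton_iff]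
  grind

theorem img_diff {f : M → M} (hf : ∀ d d', f d = f d' → d = d') (X : Set M) (P : M → Prop)
    (a : M) : img (X \ {a}) P f = img X P f \ {f a} := by
  ext y
  simp only [mem_img, Set.mem_sdiff, Set.mem_singleton_iff]
  grind

theorem eval_var (pr : L.Functions 2) (σ : Val M) (X : ℕ) :
    (STerm.var X : STerm L).eval pr σ = σ.s X := rfl

theorem eval_emp (pr : L.Functions 2) (σ : Val M) : (STerm.emp : STerm L).eval pr σ = ∅ := rfl

theorem eval_ext (pr : L.Functions 2) (σ : Val M) (t : L.Term ℕ) (A : STerm L) :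
    (STerm.ext t A).eval pr σ = {t.realize σ.x} ∪ A.eval pr σ := rfl

theorem eval_ris (pr : L.Functions 2) (σ : Val M) (D : STerm L) (φ : QF L (Option ℕ))
    (p : Pat L) :
    (STerm.ris D φ p).eval pr σ = img (D.eval pr σ) (φ.At σ.x) (p.eval pr σ.x) := rfl

theorem eval_ctrl (pr : L.Functions 2) (e : ℕ → M) (d : M) :
    (Pat.ctrl : Pat L).eval pr e d = d := rfl

/-! ### Deleting an element from the shared domain -/

/-- If `{t} ∪ T ∪ R = U ∪ S` where `R = r X` and `S = s X` depend on `X` and `t ∈ X` is not in `U`,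
then either `t` is redundant on the left and `X` may be kept, or `t` may be deleted from `X`. -/
theorem exists_shared {t n : M} {T U X : Set M} (r s : Set M → Set M)
    (h : {t} ∪ T ∪ r X = U ∪ s X) (hU : t ∉ U) (hn : n ∈ X)
    (hr : t ∉ r X → r (X \ {n}) = r X) (hs : s (X \ {n}) = s X \ {t}) :
    ∃ F ⊆ X, X = {n} ∪ F ∧ T ∪ r F = U ∪ s F := by
  by_cases ht : t ∈ T ∪ r X
  · refine ⟨X, subset_rfl, ?_, ?_⟩
    · ext y; simp only [Set.mem_union, Set.mem_singleton_iff]; grind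
    · rw [← h]
      ext y
      simp only [Set.mem_union, Set.mem_singleton_iff] at ht ⊢
      grind
  · refine ⟨X \ {n}, Set.sdiff_subset, ?_, ?_⟩
    · ext y
      simp only [Set.mem_union, Set.mem_singleton_iff, Set.mem_sdiff]
      grind
    · simp only [Set.mem_union, not_or] at ht
      rw [hr ht.2, hs]
      ext y
      have := Set.ext_iff.1 h y
      simp only [Set.mem_union, Set.mem_singleton_iff, Set.mem_sdiff] at this ⊢
      grind

/-! ### Solutions with suitable values of the fresh variables -/

/-- `σ`, changed on the variables `n`, `N`, `N₁`, `N₂` only, solves `Ψ`: with suitable values for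
these four variables, every assignment that agrees with `σ` on `U` and `V` is a solution. -/
def HoldsExt (pr : L.Functions 2) (U V : Finset ℕ) (n N N₁ N₂ : ℕ) (σ : Val M)
    (Ψ : Form L) : Prop :=
  ∃ (a : M) (A B C : Set M), A.Finite ∧ B.Finite ∧ C.Finite ∧
    ∀ τ : Val M, Agree U V σ τ → τ.x n = a → (τ.s N : Set M) = A → (τ.s N₁ : Set M) = B →
      (τ.s N₂ : Set M) = C → Ψ.Holds pr τ

section HoldsExt

variable {pr : L.Functions 2} {U V : Finset ℕ} {n N N₁ N₂ : ℕ} {σ : Val M} {Φ Ψ : Form L}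

theorem HoldsExt.of_forall (h : ∀ τ, Agree U V σ τ → Ψ.Holds pr τ) :
    HoldsExt pr U V n N N₁ N₂ σ Ψ :=
  ⟨σ.x n, ∅, ∅, ∅, Set.finite_empty, Set.finite_empty, Set.finite_empty,
    fun τ hτ _ _ _ _ => h τ hτ⟩

theorem HoldsExt.of_x (a : M) (h : ∀ τ, Agree U V σ τ → τ.x n = a → Ψ.Holds pr τ) :
    HoldsExt pr U V n N N₁ N₂ σ Ψ :=
  ⟨a, ∅, ∅, ∅, Set.finite_empty, Set.finite_empty, Set.finite_empty,
    fun τ hτ ha _ _ _ => h τ hτ ha⟩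

theorem HoldsExt.of_s {A : Set M} (hA : A.Finite)
    (h : ∀ τ, Agree U V σ τ → (τ.s N : Set M) = A → Ψ.Holds pr τ) :
    HoldsExt pr U V n N N₁ N₂ σ Ψ :=
  ⟨σ.x n, A, ∅, ∅, hA, Set.finite_empty, Set.finite_empty,
    fun τ hτ _ h' _ _ => h τ hτ h'⟩

theorem HoldsExt.of_xs (a : M) {A : Set M} (hA : A.Finite)
    (h : ∀ τ, Agree U V σ τ → τ.x n = a → (τ.s N : Set M) = A → Ψ.Holds pr τ) :
    HoldsExt pr U V n N N₁ N₂ σ Ψ :=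
  ⟨a, A, ∅, ∅, hA, Set.finite_empty, Set.finite_empty,
    fun τ hτ ha h' _ _ => h τ hτ ha h'⟩

theorem HoldsExt.of_sss {A B C : Set M} (hA : A.Finite) (hB : B.Finite) (hC : C.Finite)
    (h : ∀ τ, Agree U V σ τ → (τ.s N : Set M) = A → (τ.s N₁ : Set M) = B →
      (τ.s N₂ : Set M) = C → Ψ.Holds pr τ) :
    HoldsExt pr U V n N N₁ N₂ σ Ψ :=
  ⟨σ.x n, A, B, C, hA, hB, hC, fun τ hτ _ h' => h τ hτ h'⟩

theorem HoldsExt.imp (h : HoldsExt pr U V n N N₁ N₂ σ Φ)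
    (hi : ∀ τ : Val M, Φ.Holds pr τ → Ψ.Holds pr τ) : HoldsExt pr U V n N N₁ N₂ σ Ψ := by
  obtain ⟨a, A, B, C, hA, hB, hC, h⟩ := h
  exact ⟨a, A, B, C, hA, hB, hC, fun τ h₁ h₂ h₃ h₄ h₅ => hi τ (h τ h₁ h₂ h₃ h₄ h₅)⟩

theorem HoldsExt.inl (h : HoldsExt pr U V n N N₁ N₂ σ Φ) :
    HoldsExt pr U V n N N₁ N₂ σ (Φ ⩒ Ψ) := h.imp fun _ => Or.inl

theorem HoldsExt.inr (h : HoldsExt pr U V n N N₁ N₂ σ Ψ) :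
    HoldsExt pr U V n N N₁ N₂ σ (Φ ⩒ Ψ) := h.imp fun _ => Or.inr

theorem HoldsExt.bigOr {l : List (Form L)} (hΨ : Ψ ∈ l)
    (h : HoldsExt pr U V n N N₁ N₂ σ Ψ) :
    HoldsExt pr U V n N N₁ N₂ σ (bigOr l) :=
  h.imp fun _ h => (bigOr_holds ..).2 ⟨Ψ, hΨ, h⟩

end HoldsExt

/-! ### Equality of iterated extensions -/

section Six

variable {pr : L.Functions 2} {U V : Finset ℕ} {n N N₁ N₂ : ℕ} {σ : Val M}
  {t₀ : L.Term ℕ} {ts ss : List (L.Term ℕ)} {R S : STerm L}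

theorem sixBranches_sound (h : (sixBranches N N₁ N₂ t₀ ts ss R S).Holds pr σ) :
    (extL (t₀ :: ts) R).eval pr σ = (extL ss S).eval pr σ := by
  simp only [sixBranches, bigOr_holds, List.mem_map, List.mem_finRange, true_and] at h
  obtain ⟨Ψ, ⟨j, rfl⟩, h⟩ := h
  simp only [Form.Holds, Constr.Holds, QF.Realize, eval_extL, eval_var, eval_ext, vals_cons] at h
  simp only [eval_extL, vals_cons, vals_eraseIdx σ.x ss j]
  generalize hW : vals σ.x (ss.eraseIdx j) = W at *
  generalize vals σ.x ts = T at *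
  rcases h with ⟨h₀, h₁, -, h₂, -, h⟩ | ⟨h₀, -, -, h⟩ | ⟨h₀, h₁, -, -, h⟩ | ⟨h₀, -, h₂, -, h⟩ |
    ⟨h₀, h⟩ | ⟨h₀, h⟩
  · rw [← h₁, ← h₂, ← h₀, Set.union_assoc, Set.union_left_comm T, h]
    ext y; simp only [Set.mem_union]; tauto
  · rw [← h₀, Set.union_assoc, h, Set.union_assoc]
  · rw [← h₁, ← h₀, Set.union_assoc, Set.union_left_comm T, h]
    ext y; simp only [Set.mem_union]; tauto
  · rw [← h₂, ← h₀, Set.union_assoc, h]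
    ext y; simp only [Set.mem_union]; tauto
  · rw [vals_eraseIdx σ.x ss j, hW] at h
    rw [Set.union_assoc, h, ← h₀]
    ext y; simp only [Set.mem_union]; tauto
  · rw [h, Set.union_assoc, ← h, ← h₀]
    ext y; simp only [Set.mem_union]; tauto

/-- If `t₀` equals some `sⱼ`, the fifth branch applies when `t₀` is among the `ts`, the sixth when
it is among the other `ss`, and the first four according to whether it belongs to `R` and `S`. -/
theorem sixBranches_complete (hR : R.In U V) (hS : S.In U V) (h₀ : TermIn U t₀)
    (hts : ∀ t ∈ ts, TermIn U t) (hss : ∀ s ∈ ss, TermIn U s)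
    (h : (extL (t₀ :: ts) R).eval pr σ = (extL ss S).eval pr σ)
    (ht : t₀.realize σ.x ∈ vals σ.x ss) :
    HoldsExt pr U V n N N₁ N₂ σ (sixBranches N N₁ N₂ t₀ ts ss R S) := by
  obtain ⟨s, hs, hst⟩ := ht
  obtain ⟨j, rfl⟩ := List.get_of_mem hs
  refine HoldsExt.bigOr (List.mem_map_of_mem (List.mem_finRange j)) ?_
  -- the new variables get the values of `R` and `S` without `t₀`
  have hfin : ∀ A : STerm L, (A.eval pr σ \ {t₀.realize σ.x}).Finite :=
    fun A => (A.eval_finite pr σ).sdiff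
  have hss' : ∀ s ∈ ss.eraseIdx j, TermIn U s := fun s h => hss s (List.mem_of_mem_eraseIdx h)
  have hval := vals_eraseIdx σ.x ss j
  rw [hst] at hval
  simp only [eval_extL, vals_cons, hval] at h
  have key : ∀ y, (y = t₀.realize σ.x ∨ y ∈ vals σ.x ts ∨ y ∈ R.eval pr σ) ↔
      (y = t₀.realize σ.x ∨ y ∈ vals σ.x (ss.eraseIdx j) ∨ y ∈ S.eval pr σ) := by
    intro y
    have := Set.ext_iff.1 h y
    simpa only [Set.mem_union, Set.mem_singleton_iff, or_assoc] using this
  by_cases hT : t₀.realize σ.x ∈ vals σ.x ts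
  · refine .inr (.inr (.inr (.inr (.inl (.of_forall fun τ hτ => ?_)))))
    simp only [Form.Holds, Constr.Holds, QF.Realize, eval_extL, hτ.term h₀, hτ.term (hss _ hs),
      hst, hτ.vals hts, hτ.vals hss, hτ.set pr hR, hτ.set pr hS, hval, true_and]
    ext y
    simp only [Set.mem_union, Set.mem_singleton_iff]
    grind
  by_cases hW : t₀.realize σ.x ∈ vals σ.x (ss.eraseIdx j)
  · refine .inr (.inr (.inr (.inr (.inr (.of_forall fun τ hτ => ?_)))))
    simp only [Form.Holds, Constr.Holds, QF.Realize, eval_extL, hτ.term h₀, hτ.term (hss _ hs),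
      hst, hτ.vals hts, hτ.vals hss', hτ.set pr hR, hτ.set pr hS, true_and, vals_cons]
    ext y
    simp only [Set.mem_union, Set.mem_singleton_iff]
    grind
  by_cases hR₀ : t₀.realize σ.x ∈ R.eval pr σ <;> by_cases hS₀ : t₀.realize σ.x ∈ S.eval pr σ
  · refine .inl (.of_sss Set.finite_empty (hfin R) (hfin S) fun τ hτ _ h₁ h₂ => ?_)
    simp only [Form.Holds, Constr.Holds, QF.Realize, eval_extL, eval_var, eval_ext, hτ.term h₀,
      hτ.term (hss _ hs), hst, hτ.vals hts, hτ.vals hss', hτ.set pr hR, hτ.set pr hS, true_and,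
      h₁, h₂, Set.ext_iff, Set.mem_union, Set.mem_singleton_iff, Set.mem_sdiff]
    grind
  · refine .inr (.inr (.inl (.of_s (hfin R) fun τ hτ h₁ => ?_)))
    simp only [Form.Holds, Constr.Holds, QF.Realize, eval_extL, eval_var, eval_ext, hτ.term h₀,
      hτ.term (hss _ hs), hst, hτ.vals hts, hτ.vals hss', hτ.set pr hR, hτ.set pr hS, true_and,
      h₁, Set.ext_iff, Set.mem_union, Set.mem_singleton_iff, Set.mem_sdiff]
    grind
  · refine .inr (.inr (.inr (.inl (.of_s (hfin S) fun τ hτ h₁ => ?_))))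
    simp only [Form.Holds, Constr.Holds, QF.Realize, eval_extL, eval_var, eval_ext, hτ.term h₀,
      hτ.term (hss _ hs), hst, hτ.vals hts, hτ.vals hss', hτ.set pr hR, hτ.set pr hS, true_and,
      h₁, Set.ext_iff, Set.mem_union, Set.mem_singleton_iff, Set.mem_sdiff]
    grind
  · refine .inr (.inl (.of_forall fun τ hτ => ?_))
    simp only [Form.Holds, Constr.Holds, QF.Realize, eval_extL, hτ.term h₀,
      hτ.term (hss _ hs), hst, hτ.vals hts, hτ.vals hss', hτ.set pr hR, hτ.set pr hS, true_and,
      Set.ext_iff, Set.mem_union]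
    grind

theorem sixBranches_in (hN : N ∈ V) (hN₁ : N₁ ∈ V) (hN₂ : N₂ ∈ V) (hR : R.In U V)
    (hS : S.In U V) (h₀ : TermIn U t₀) (hts : ∀ t ∈ ts, TermIn U t)
    (hss : ∀ s ∈ ss, TermIn U s) : (sixBranches N N₁ N₂ t₀ ts ss R S).In U V := by
  refine bigOr_in fun Ψ hΨ => ?_
  obtain ⟨j, -, rfl⟩ := List.mem_map.1 hΨ
  have hj : TermIn U (ss.get j) := hss _ (List.get_mem ss j)
  have hss' : ∀ s ∈ ss.eraseIdx j, TermIn U s := fun s h => hss s (List.mem_of_mem_eraseIdx h)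
  simp only [Form.in_or, Form.in_and, Form.in_con, Form.in_xf, vars_eq_subset, Constr.in_eq,
    Constr.in_nmem, STerm.in_ext, STerm.in_var, STerm.in_extL, List.forall_mem_cons]
  tauto

end Six

/-! ### Equality of extensions with a shared domain variable -/

section Eq

variable {pr : L.Functions 2} {U V : Finset ℕ} {n N N₁ N₂ : ℕ} {σ : Val M}

/-- The last branch of `sharedCtrlRhs` adds the value of `t₀` to both sides: on the left it is
already there, and on the right it comes back through `S`. -/
theorem sharedCtrlRhs_sound {X : ℕ} {t₀ : L.Term ℕ} {ts ss : List (L.Term ℕ)}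
    {R S R' S' : STerm L} {g : Form L}
    (hR : (σ.s X : Set M) = {t₀.realize σ.x} ∪ (σ.s N : Set M) →
      {t₀.realize σ.x} ∪ R.eval pr σ = {t₀.realize σ.x} ∪ R'.eval pr σ)
    (hS : (σ.s X : Set M) = {t₀.realize σ.x} ∪ (σ.s N : Set M) → g.Holds pr σ →
      S.eval pr σ = {t₀.realize σ.x} ∪ S'.eval pr σ)
    (h : (sharedCtrlRhs N N₁ N₂ X t₀ ts ss R S R' S' g).Holds pr σ) :
    (extL (t₀ :: ts) R).eval pr σ = (extL ss S).eval pr σ := by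
  rcases h with h | ⟨h₁, h₂, h₃⟩
  · exact sixBranches_sound h
  · simp only [Form.Holds, Constr.Holds, eval_var, eval_ext, eval_extL] at h₁ h₃
    rw [eval_extL, eval_extL, hS h₁ h₂, vals_cons, Set.union_left_comm, ← h₃,
      Set.union_right_comm, hR h₁]
    ext y; simp only [Set.mem_union]; tauto

/-- Here `R` and `S` take the values `r X` and `s X`, and `R'` and `S'` the values `r N` and `s N`.
The hypotheses `hrd` and `hsd` describe the effect of deleting the value of `t₀` from `X`. -/
theorem sharedCtrlRhs_complete {X : ℕ} {t₀ : L.Term ℕ} {ts ss : List (L.Term ℕ)}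
    {R S R' S' : STerm L} {g : Form L} (r s : Set M → Set M) (hX : X ∈ V)
    (hR : R.In U V) (hS : S.In U V) (h₀ : TermIn U t₀)
    (hts : ∀ t ∈ ts, TermIn U t) (hss : ∀ s ∈ ss, TermIn U s)
    (hr : R.eval pr σ = r (σ.s X)) (hs : S.eval pr σ = s (σ.s X))
    (hr' : ∀ τ : Val M, Agree U V σ τ → R'.eval pr τ = r (τ.s N))
    (hs' : ∀ τ : Val M, Agree U V σ τ → S'.eval pr τ = s (τ.s N))
    (hmem : t₀.realize σ.x ∈ s (σ.s X) →
      t₀.realize σ.x ∈ (σ.s X : Set M) ∧ ∀ τ : Val M, Agree U V σ τ → g.Holds pr τ)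
    (hrd : t₀.realize σ.x ∈ (σ.s X : Set M) → t₀.realize σ.x ∉ r (σ.s X) →
      r (↑(σ.s X) \ {t₀.realize σ.x}) = r (σ.s X))
    (hsd : s (↑(σ.s X) \ {t₀.realize σ.x}) = s (σ.s X) \ {t₀.realize σ.x})
    (h : (extL (t₀ :: ts) R).eval pr σ = (extL ss S).eval pr σ) :
    HoldsExt pr U V n N N₁ N₂ σ (sharedCtrlRhs N N₁ N₂ X t₀ ts ss R S R' S' g) := by
  by_cases ht : t₀.realize σ.x ∈ vals σ.x ss
  · exact .inl (sixBranches_complete hR hS h₀ hts hss h ht)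
  simp only [eval_extL, vals_cons, hr, hs] at h
  have hmem' : t₀.realize σ.x ∈ s (σ.s X) := by
    have := (Set.ext_iff.1 h (t₀.realize σ.x)).1 (.inl (.inl rfl))
    exact this.resolve_left ht
  obtain ⟨hX', hg⟩ := hmem hmem'
  obtain ⟨F, hF, hXF, hE⟩ := exists_shared r s h ht hX' (hrd hX') hsd
  refine .inr (.of_s ((σ.s X).finite_toSet.subset hF) fun τ hτ hN => ⟨?_, hg τ hτ, ?_⟩)
  · simp only [Form.Holds, Constr.Holds, eval_var, eval_ext, hN, hτ.term h₀, hτ.2 X hX]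
    exact hXF
  · simp only [Form.Holds, Constr.Holds, eval_extL, hr' τ hτ, hs' τ hτ, hN, hτ.vals hts,
      hτ.vals hss]
    exact hE

/-- Adding an element to the domain of a RIS whose pattern is the control variable adds at most
that element to its value. -/
theorem singleton_union_img_id {a : M} {B X F : Set M} {P : M → Prop} (h : X = {a} ∪ F) :
    {a} ∪ img (B ∪ X) P (fun d => d) = {a} ∪ img (B ∪ F) P (fun d => d) := by
  ext y
  simp only [h, Set.mem_union, mem_img_id, Set.mem_singleton_iff]
  grind

theorem img_singleton_union {a : M} {X F : Set M} {P : M → Prop} {f : M → M} (h : X = {a} ∪ F)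
    (ha : P a) : img X P f = {f a} ∪ img F P f := by
  rw [h, img_union, img_singleton_of_pos ha]

theorem img_union_singleton_union {a : M} {B X F : Set M} {P : M → Prop} {f : M → M}
    (h : X = {a} ∪ F) (ha : P a) : img (B ∪ X) P f = {f a} ∪ img (B ∪ F) P f := by
  rw [h, Set.union_left_comm, img_union, img_singleton_of_pos ha]

theorem img_union_singleton_union_of_neg {a : M} {B X F : Set M} {P : M → Prop} {f : M → M}
    (h : X = {a} ∪ F) (ha : ¬ P a) : img (B ∪ X) P f = img (B ∪ F) P f := by
  rw [h, Set.union_left_comm, img_union, img_singleton_of_neg ha, Set.empty_union]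

theorem img_id_union_diff {a : M} {B X : Set M} {P : M → Prop} (ha : a ∈ X)
    (h : a ∉ img (B ∪ X) P (fun d => d)) :
    img (B ∪ X \ {a}) P (fun d => d) = img (B ∪ X) P (fun d => d) :=
  img_union_diff_of_neg (fun hP => h (mem_img_id.2 ⟨.inr ha, hP⟩)) B X _

theorem img_id_diff (a : M) (X : Set M) (P : M → Prop) :
    img (X \ {a}) P (fun d => d) = img X P (fun d => d) \ {a} :=
  img_diff (fun _ _ h => h) X P a

theorem sharedPairRhs_sound {X : ℕ} {t₀ : L.Term ℕ} {ts ss bs : List (L.Term ℕ)}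
    {φ γ : QF L (Option ℕ)} {p q : Pat L}
    (h : (sharedPairRhs pr n N N₁ N₂ X t₀ ts ss bs φ γ p q).Holds pr σ) :
    (extL (t₀ :: ts) (.ris (extL bs (.var X)) φ p)).eval pr σ =
      (extL ss (.ris (.var X) γ q)).eval pr σ := by
  rcases h with h | h | h
  · exact sixBranches_sound h
  · obtain ⟨hX, hγ, ht, hφ, h⟩ := h
    simp only [Form.Holds, Constr.Holds, QF.Realize, eval_var, eval_emp, eval_ext, eval_ris,
      eval_extL,
      realize_at', Pat.realize_app, Term.realize_var] at hX hγ ht hφ h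
    simp only [eval_ris, eval_extL, vals_cons, eval_var, img_singleton_union hX hγ]
    rw [ht, Set.union_left_comm, ← h]
    rcases hφ with hφ | ⟨hφ, -, htp⟩
    · rw [img_union_singleton_union_of_neg hX hφ]
      ext y; simp only [Set.mem_union]; tauto
    · rw [img_union_singleton_union hX hφ, ← htp, ht]
      ext y; simp only [Set.mem_union]; tauto
  · simp only [bigOr_holds, List.mem_map] at h
    obtain ⟨Ψ, ⟨s, hs, rfl⟩, hX, hγ, ht, hφ, hp, h⟩ := h
    simp only [Form.Holds, Constr.Holds, QF.Realize, eval_var, eval_ext, eval_ris, eval_extL,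
      realize_at', Pat.realize_app, Term.realize_var, vals_cons] at hX hγ ht hφ h hp
    simp only [eval_ris, eval_extL, vals_cons, eval_var, img_singleton_union hX hγ]
    rw [ht, Set.union_left_comm, ← h, img_union_singleton_union hX hφ]
    ext y; simp only [Set.mem_union]; tauto

variable (hpr : ∀ a b c d : M, Structure.funMap pr ![a, b] = Structure.funMap pr ![c, d] →
  a = c ∧ b = d)

include hpr in
/-- If `t₀` is none of the `ss`, then it is `q(a)` for some `a` in `X`.  The cases are: `φ(a)`
fails; `p(a)` is one of the `ss`; or `p(a)` is a value `q(b)`, and then `b = a` and `p(a) = t₀`. -/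
theorem sharedPairRhs_complete {X : ℕ} {t₀ : L.Term ℕ} {ts ss bs : List (L.Term ℕ)}
    {φ γ : QF L (Option ℕ)} {p q : Pat L} (hp : p ≠ .ctrl) (hq : q ≠ .ctrl)
    (hX : X ∈ V) (h₀ : TermIn U t₀) (hts : ∀ t ∈ ts, TermIn U t) (hss : ∀ s ∈ ss, TermIn U s)
    (hbs : ∀ s ∈ bs, TermIn U s) (hφ : FilterIn U φ) (hγ : FilterIn U γ) (hpU : PatIn U p)
    (hqU : PatIn U q)
    (h : (extL (t₀ :: ts) (.ris (extL bs (.var X)) φ p)).eval pr σ =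
      (extL ss (.ris (.var X) γ q)).eval pr σ) :
    HoldsExt pr U V n N N₁ N₂ σ (sharedPairRhs pr n N N₁ N₂ X t₀ ts ss bs φ γ p q) := by
  by_cases ht : t₀.realize σ.x ∈ vals σ.x ss
  · refine .inl (sixBranches_complete ?_ ?_ h₀ hts hss h ht)
    · exact (STerm.in_ris ..).2 ⟨(STerm.in_extL ..).2 ⟨hbs, (STerm.in_var X).2 hX⟩, hφ, hpU⟩
    · exact (STerm.in_ris ..).2 ⟨(STerm.in_var X).2 hX, hγ, hqU⟩
  simp only [eval_extL, vals_cons, eval_ris, eval_var] at h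
  have hmem : t₀.realize σ.x ∈ img (σ.s X) (γ.At σ.x) (q.eval pr σ.x) := by
    have := (Set.ext_iff.1 h (t₀.realize σ.x)).1 (.inl (.inl rfl))
    exact this.resolve_left ht
  obtain ⟨a, ha, hγa, hqa⟩ := mem_img.1 hmem
  have hpq : ∀ d d', p.eval pr σ.x d = q.eval pr σ.x d' → d = d' := fun d d' =>
    Pat.eval_eq_eval hpr hp hq
  have hsd := img_diff (fun d d' => Pat.eval_injective hpr (e := σ.x) (p := q) (d := d) (d' := d'))
    (σ.s X) (γ.At σ.x) a
  rw [← hqa] at hsd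
  have hsub : ∀ {F : Set M}, F ⊆ σ.s X → F.Finite := fun hF => (σ.s X).finite_toSet.subset hF
  by_cases hφa : φ.At σ.x a
  · have hpR : p.eval pr σ.x a ∈ img (vals σ.x bs ∪ σ.s X) (φ.At σ.x) (p.eval pr σ.x) :=
      ⟨a, .inr ha, hφa, rfl⟩
    by_cases hpss : p.eval pr σ.x a ∈ vals σ.x ss
    · obtain ⟨s, hs, hsp⟩ := hpss
      -- deleting `a` from `X` may delete `p(a)` from the left-hand side, so it is put back
      obtain ⟨F, hF, hXF, hE⟩ := exists_shared (t := t₀.realize σ.x) (n := a)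
        (T := {p.eval pr σ.x a} ∪ vals σ.x ts) (U := vals σ.x ss)
        (fun Y => img (vals σ.x bs ∪ Y) (φ.At σ.x) (p.eval pr σ.x) \ {p.eval pr σ.x a})
        (fun Y => img Y (γ.At σ.x) (q.eval pr σ.x)) (X := σ.s X) (by
          rw [← h]
          ext y
          simp only [Set.mem_union, Set.mem_sdiff, Set.mem_singleton_iff]
          grind) ht ha (fun _ => by
          ext y
          simp only [mem_img, Set.mem_union, Set.mem_sdiff, Set.mem_singleton_iff]
          grind) hsd
      refine .inr (.inr (.bigOr (List.mem_map_of_mem hs) (.of_xs a (hsub hF)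
        fun τ hτ hn hN => ?_)))
      simp only [Form.Holds, Constr.Holds, QF.Realize, eval_var, eval_ext, eval_ris, eval_extL,
        realize_at', Pat.realize_app, Term.realize_var, vals_cons, hn, hN, hτ.2 X hX,
        hτ.pat pr hpU, hτ.pat pr hqU, hτ.filter hφ, hτ.filter hγ, hτ.term h₀, hτ.vals hts,
        hτ.vals hss, hτ.vals hbs, hτ.term (hss s hs)]
      refine ⟨hXF, hγa, hqa, hφa, hsp.symm, ?_⟩
      rw [← hE]
      ext y
      simp only [Set.mem_union, Set.mem_sdiff, Set.mem_singleton_iff]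
      grind
    · have hpS : p.eval pr σ.x a ∈ img (σ.s X) (γ.At σ.x) (q.eval pr σ.x) := by
        have := (Set.ext_iff.1 h (p.eval pr σ.x a)).1 (.inr hpR)
        exact this.resolve_left hpss
      obtain ⟨b, -, -, hb⟩ := mem_img.1 hpS
      have htp : t₀.realize σ.x = p.eval pr σ.x a := by
        rw [hb, ← hpq a b hb, hqa]
      obtain ⟨F, hF, hXF, hE⟩ := exists_shared
        (fun Y => img (vals σ.x bs ∪ Y) (φ.At σ.x) (p.eval pr σ.x))
        (fun Y => img Y (γ.At σ.x) (q.eval pr σ.x)) h ht ha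
        (fun hn => absurd (htp ▸ hpR) hn) hsd
      refine .inr (.inl (.of_xs a (hsub hF) fun τ hτ hn hN => ?_))
      simp only [Form.Holds, Constr.Holds, QF.Realize, eval_var, eval_emp, eval_ext, eval_ris,
        eval_extL,
        realize_at', Pat.realize_app, Term.realize_var, hn, hN, hτ.2 X hX,
        hτ.pat pr hpU, hτ.pat pr hqU, hτ.filter hφ, hτ.filter hγ, hτ.term h₀, hτ.vals hts,
        hτ.vals hss, hτ.vals hbs, Set.union_empty]
      exact ⟨hXF, hγa, hqa, .inr ⟨hφa, hpss, htp⟩, hE⟩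
  · obtain ⟨F, hF, hXF, hE⟩ := exists_shared
      (fun Y => img (vals σ.x bs ∪ Y) (φ.At σ.x) (p.eval pr σ.x))
      (fun Y => img Y (γ.At σ.x) (q.eval pr σ.x)) h ht ha
      (fun _ => img_union_diff_of_neg hφa _ _ _) hsd
    refine .inr (.inl (.of_xs a (hsub hF) fun τ hτ hn hN => ?_))
    simp only [Form.Holds, Constr.Holds, QF.Realize, eval_var, eval_emp, eval_ext, eval_ris,
      eval_extL,
      realize_at', Pat.realize_app, Term.realize_var, hn, hN, hτ.2 X hX,
      hτ.pat pr hpU, hτ.pat pr hqU, hτ.filter hφ, hτ.filter hγ, hτ.term h₀, hτ.vals hts,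
      hτ.vals hss, hτ.vals hbs]
    exact ⟨hXF, hγa, hqa, .inl hφa, hE⟩

/-! ### The rules for equality -/

theorem EqRule.sound {A B : STerm L} {Ψ : Form L} (hr : EqRule pr n N N₁ N₂ A B Ψ)
    (h : Ψ.Holds pr σ) : A.eval pr σ = B.eval pr σ := by
  cases hr with
  | emp_emp hA hB => rw [hA.eval_eq, hB.eval_eq]
  | var_self X => rfl
  | shared_var_var X t₀ s₀ ts ss =>
    exact sharedCtrlRhs_sound (fun h => by
      rw [eval_var, eval_var, h, ← Set.union_assoc, Set.union_self])
      (fun h _ => by simpa only [eval_var] using h) h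
  | shared_ris_var X t₀ s₀ ts ss bs φ =>
    refine sharedCtrlRhs_sound (fun h => ?_) (fun h _ => by simpa only [eval_var] using h) h
    simpa only [eval_ris, eval_extL, eval_ctrl, eval_var] using singleton_union_img_id h
  | shared_ris_ris X t₀ s₀ ts ss bs φ γ =>
    refine sharedCtrlRhs_sound (fun h => ?_) (fun h hg => ?_) h
    · simpa only [eval_ris, eval_extL, eval_ctrl, eval_var] using singleton_union_img_id h
    · simp only [Form.Holds, realize_at'] at hg
      exact img_singleton_union (f := fun d => d) h hg
  | shared_var_ris X t₀ s₀ ts ss γ => exact Eq.symm h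
  | shared_pair X t₀ s₀ ts ss bs φ γ p q hp hq => exact sharedPairRhs_sound h
  | ext_ext t s A B =>
    simp only [Form.Holds, Constr.Holds, QF.Realize, eval_var, eval_ext] at h ⊢
    rcases h with ⟨h₁, h₂⟩ | ⟨h₁, h₂⟩ | ⟨h₁, h₂⟩ | ⟨h₁, h₂⟩
    · rw [h₂, h₁, ← Set.union_assoc, Set.union_self]
    · rw [← h₂, h₁, ← Set.union_assoc, Set.union_self]
    · rw [h₁, h₂]
    · rw [h₁, ← h₂, Set.union_left_comm]

include hpr in
theorem EqRule.complete {A B : STerm L} {Ψ : Form L} (hr : EqRule pr n N N₁ N₂ A B Ψ)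
    (hA : A.In U V) (hB : B.In U V) (h : A.eval pr σ = B.eval pr σ) :
    HoldsExt pr U V n N N₁ N₂ σ Ψ := by
  cases hr with
  | emp_emp => exact .of_forall fun _ _ => trivial
  | var_self X => exact .of_forall fun _ _ => trivial
  | shared_var_var X t₀ s₀ ts ss =>
    simp only [STerm.in_extL, List.forall_mem_cons, STerm.in_var] at hA hB
    exact sharedCtrlRhs_complete (fun Y => Y) (fun Y => Y) hA.2 (by simpa using hA.2)
      (by simpa using hA.2) hA.1.1 hA.1.2 (by simpa using hB.1) rfl rfl (fun _ _ => rfl)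
      (fun _ _ => rfl) (fun h => ⟨h, fun _ _ => trivial⟩) (fun h h' => absurd h h') rfl h
  | shared_ris_var X t₀ s₀ ts ss bs φ =>
    simp only [STerm.in_extL, List.forall_mem_cons, STerm.in_var, STerm.in_ris] at hA hB
    obtain ⟨⟨h₀, hts⟩, ⟨hbs, hX⟩, hφ, hp⟩ := hA
    refine sharedCtrlRhs_complete
      (fun Y => img (vals σ.x bs ∪ Y) (φ.At σ.x) (fun d => d)) (fun Y => Y) hX
      (by simp [hX, hφ, hp]; exact hbs)
      (by simpa using hX) h₀ hts (by simpa using hB.1)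
      (by simp only [eval_ris, eval_extL, eval_ctrl, eval_var]) rfl (fun τ hτ => ?_)
      (fun _ _ => rfl) (fun h => ⟨h, fun _ _ => trivial⟩) img_id_union_diff rfl h
    simp only [eval_ris, eval_extL, eval_ctrl, eval_var, hτ.vals hbs, hτ.filter hφ]
  | shared_ris_ris X t₀ s₀ ts ss bs φ γ =>
    simp only [STerm.in_extL, List.forall_mem_cons, STerm.in_var, STerm.in_ris] at hA hB
    obtain ⟨⟨h₀, hts⟩, ⟨hbs, hX⟩, hφ, hp⟩ := hA
    refine sharedCtrlRhs_complete
      (fun Y => img (vals σ.x bs ∪ Y) (φ.At σ.x) (fun d => d))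
      (fun Y => img Y (γ.At σ.x) (fun d => d)) hX (by simp [hX, hφ, hp]; exact hbs)
      (by simpa using hB.2) h₀ hts (by simpa using hB.1)
      (by simp only [eval_ris, eval_extL, eval_ctrl, eval_var]) rfl (fun τ hτ => ?_)
      (fun τ hτ => ?_) (fun h => ?_) img_id_union_diff (img_id_diff _ _ _) h
    · simp only [eval_ris, eval_extL, eval_ctrl, eval_var, hτ.vals hbs, hτ.filter hφ]
    · simp only [eval_ris, eval_ctrl, eval_var, hτ.filter hB.2.2.1]
    · obtain ⟨h₁, h₂⟩ := mem_img_id.1 h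
      refine ⟨h₁, fun τ hτ => ?_⟩
      simpa only [Form.Holds, realize_at', hτ.term h₀, hτ.filter hB.2.2.1] using h₂
  | shared_var_ris X t₀ s₀ ts ss γ =>
    exact .of_forall fun τ hτ => ((hτ.set pr hB).trans h.symm).trans (hτ.set pr hA).symm
  | shared_pair X t₀ s₀ ts ss bs φ γ p q hp hq =>
    simp only [STerm.in_extL, List.forall_mem_cons, STerm.in_var, STerm.in_ris] at hA hB
    exact sharedPairRhs_complete hpr hp hq hB.2.1 hA.1.1 hA.1.2 (by simpa using hB.1) hA.2.1.1
      hA.2.2.1 hB.2.2.1 hA.2.2.2 hB.2.2.2 h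
  | ext_ext t s A B =>
    simp only [STerm.in_ext] at hA hB
    have key := Set.ext_iff.1 h
    simp only [eval_ext, Set.mem_union, Set.mem_singleton_iff] at key
    by_cases hts : t.realize σ.x = s.realize σ.x
    · by_cases htA : t.realize σ.x ∈ A.eval pr σ
      · refine .inl (.of_forall fun τ hτ => ?_)
        simp only [Form.Holds, Constr.Holds, QF.Realize, eval_ext, hτ.term hA.1,
          hτ.term hB.1, hτ.set pr hA.2, hτ.set pr hB.2, Set.ext_iff, Set.mem_union,
          Set.mem_singleton_iff]
        grind
      by_cases htB : t.realize σ.x ∈ B.eval pr σ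
      · refine .inr (.inl (.of_forall fun τ hτ => ?_))
        simp only [Form.Holds, Constr.Holds, QF.Realize, eval_ext, hτ.term hA.1,
          hτ.term hB.1, hτ.set pr hA.2, hτ.set pr hB.2, Set.ext_iff, Set.mem_union,
          Set.mem_singleton_iff]
        grind
      · refine .inr (.inr (.inl (.of_forall fun τ hτ => ?_)))
        simp only [Form.Holds, Constr.Holds, QF.Realize, hτ.term hA.1,
          hτ.term hB.1, hτ.set pr hA.2, hτ.set pr hB.2, Set.ext_iff]
        grind
    -- here `s ∈ A` and `t ∈ B`, and the remaining elements are common to `A` and `B`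
    · refine .inr (.inr (.inr (.of_s ((A.eval_finite pr σ).inter_of_left (B.eval pr σ))
        fun τ hτ hN => ?_)))
      simp only [Form.Holds, Constr.Holds, eval_var, eval_ext, hτ.term hA.1, hN,
        hτ.term hB.1, hτ.set pr hA.2, hτ.set pr hB.2, Set.ext_iff, Set.mem_union,
        Set.mem_singleton_iff, Set.mem_inter_iff]
      grind

theorem EqRuleSym.sound {A B : STerm L} {Ψ : Form L} (hr : EqRuleSym pr n N A B Ψ)
    (h : Ψ.Holds pr σ) : A.eval pr σ = B.eval pr σ := by
  cases hr with
  | var_ext_var X t₀ ts =>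
    simp only [Form.Holds, Constr.Holds, eval_var, eval_extL] at h ⊢
    rw [h, ← Set.union_assoc, Set.union_self]
  | var_ext_ris X t₀ ts bs φ =>
    simp only [Form.Holds, Constr.Holds, eval_var, eval_extL, eval_ris, eval_ctrl] at h ⊢
    ext y
    have := Set.ext_iff.1 h y
    simp only [Set.mem_union, mem_img_id] at this ⊢
    have h₂ := Set.ext_iff.1 h
    simp only [Set.mem_union, mem_img_id] at h₂
    grind
  | emp_ext t B hA => exact h.elim
  | ris_emp d D φ p hB =>
    simp only [Form.Holds, Constr.Holds, QF.Realize, realize_at'] at h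
    rw [eval_ris, eval_ext, img_union, img_singleton_of_neg h.1, ← eval_ris, h.2, hB.eval_eq]
    simp [eval_emp]
  | ris_any d D φ p hB =>
    simp only [Form.Holds, Constr.Holds, QF.Realize, realize_at'] at h
    rw [eval_ris, eval_ext, img_union, ← eval_ris]
    rcases h with ⟨h₁, h₂⟩ | ⟨h₁, h₂⟩
    · rw [img_singleton_of_pos h₁, ← h₂, eval_ext, Pat.realize_app]
    · rw [img_singleton_of_neg h₁, h₂, Set.empty_union]
  | varris_shared_var X t₀ ts γ =>
    obtain ⟨hX, hγ, h⟩ := h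
    simp only [Form.Holds, Constr.Holds, eval_var, eval_ext, eval_extL, eval_ris, eval_ctrl,
      realize_at'] at hX hγ h
    simp only [eval_ris, eval_var, eval_ctrl, eval_extL, vals_cons, img_singleton_union hX hγ, h]
    rw [hX, Set.union_assoc, Set.union_left_comm (vals _ _), ← Set.union_assoc {_} {_},
      Set.union_self]
  | varris_shared_ris X t₀ ts bs φ γ =>
    obtain ⟨hX, hγ, h⟩ := h
    simp only [Form.Holds, Constr.Holds, eval_var, eval_ext, eval_extL, eval_ris, eval_ctrl,
      realize_at'] at hX hγ h
    simp only [eval_ris, eval_var, eval_ctrl, eval_extL, vals_cons, img_singleton_union hX hγ, h]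
    rw [Set.union_right_comm, singleton_union_img_id hX]
    ext y; simp only [Set.mem_union]; tauto
  | varris_shared_pair X t₀ ts bs φ γ p q hp hq =>
    obtain ⟨hX, hγ, ht, hφ, h⟩ := h
    simp only [Form.Holds, Constr.Holds, QF.Realize, eval_var, eval_ext, eval_ris, eval_extL,
      realize_at', Pat.realize_app, Term.realize_var] at hX hγ ht hφ h
    simp only [eval_ris, eval_var, eval_extL, vals_cons, img_singleton_union hX hγ, h]
    by_cases hφ' : φ.At σ.x (σ.x n)
    · have ht' := hφ.resolve_left (not_not.2 hφ')
      rw [img_union_singleton_union hX hφ', ← ht', ht]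
      ext y; simp only [Set.mem_union]; tauto
    · rw [img_union_singleton_union_of_neg hX hφ', ht, Set.union_assoc]
  | varris_ext φ p t A hD =>
    obtain ⟨hX, hφ, ht, h⟩ := h
    simp only [Form.Holds, Constr.Holds, QF.Realize, eval_var, eval_ext, eval_ris,
      realize_at', Pat.realize_app, Term.realize_var] at hX hφ ht h
    rw [eval_ris, img_singleton_union hX hφ, h, eval_ext, ht]

include hpr in
theorem EqRuleSym.complete {A B : STerm L} {Ψ : Form L} (hr : EqRuleSym pr n N A B Ψ)
    (hA : A.In U V) (hB : B.In U V) (h : A.eval pr σ = B.eval pr σ) :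
    HoldsExt pr U V n N N₁ N₂ σ Ψ := by
  cases hr with
  | var_ext_var X t₀ ts =>
    simp only [STerm.in_extL, STerm.in_var] at hA hB
    refine .of_s (σ.s X).finite_toSet fun τ hτ hN => ?_
    simp only [Form.Holds, Constr.Holds, eval_var, eval_extL, hN, hτ.vals hB.1,
      hτ.2 X hA] at h ⊢
    exact h
  | var_ext_ris X t₀ ts bs φ =>
    simp only [STerm.in_extL, STerm.in_var, STerm.in_ris] at hA hB
    refine .of_s (σ.s X).finite_toSet fun τ hτ hN => ?_
    simp only [Form.Holds, Constr.Holds, eval_var, eval_extL, hN, hτ.vals hB.1,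
      hτ.2 X hA, hτ.vals hB.2.1.1, hτ.filter hB.2.2.1, eval_ris, eval_ctrl] at h ⊢
    exact h
  | emp_ext t B hE =>
    rw [hE.eval_eq, eval_ext] at h
    exact absurd (Set.union_empty_iff.1 h.symm).1 (Set.singleton_ne_empty _)
  | ris_emp d D φ p hE =>
    simp only [STerm.in_ris, STerm.in_ext] at hA
    rw [hE.eval_eq, eval_ris, eval_ext, img_union, Set.union_empty_iff] at h
    refine .of_forall fun τ hτ => ?_
    simp only [Form.Holds, Constr.Holds, QF.Realize, realize_at', hτ.term hA.1.1,
      hτ.filter hA.2.1, hτ.set pr (STerm.in_ris D φ p |>.2 ⟨hA.1.2, hA.2⟩)]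
    refine ⟨fun hφ => ?_, h.2⟩
    rw [img_singleton_of_pos hφ] at h
    exact Set.singleton_ne_empty _ h.1
  | ris_any d D φ p hE =>
    simp only [STerm.in_ris, STerm.in_ext] at hA
    rw [eval_ris, eval_ext, img_union, ← eval_ris] at h
    have hD := STerm.in_ris D φ p |>.2 ⟨hA.1.2, hA.2⟩
    refine .of_forall fun τ hτ => ?_
    simp only [Form.Holds, Constr.Holds, QF.Realize, realize_at', hτ.term hA.1.1,
      hτ.filter hA.2.1, hτ.set pr hD, hτ.set pr hB, eval_ext, Pat.realize_app,
      hτ.pat pr hA.2.2]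
    by_cases hφ : φ.At σ.x (d.realize σ.x)
    · rw [img_singleton_of_pos hφ] at h
      exact .inl ⟨hφ, h⟩
    · rw [img_singleton_of_neg hφ, Set.empty_union] at h
      exact .inr ⟨hφ, h⟩
  | varris_shared_var X t₀ ts γ =>
    simp only [STerm.in_extL, STerm.in_var, STerm.in_ris, List.forall_mem_cons] at hA hB
    have h' := h
    simp only [eval_ris, eval_ctrl, eval_var, eval_extL, vals_cons] at h'
    have key := Set.ext_iff.1 h'
    simp only [mem_img_id, Set.mem_union, Set.mem_singleton_iff] at key
    refine .of_s (σ.s X).finite_toSet fun τ hτ hN => ?_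
    simp only [Form.Holds, Constr.Holds, eval_var, eval_ext, eval_ris, eval_ctrl, eval_extL, hN,
      realize_at', hτ.vals hB.1.2, hτ.2 X hA.1, hτ.filter hA.2.1, hτ.term hB.1.1,
      Set.ext_iff, mem_img_id, Set.mem_union, Set.mem_singleton_iff]
    grind
  | varris_shared_ris X t₀ ts bs φ γ =>
    simp only [STerm.in_extL, STerm.in_var, STerm.in_ris, List.forall_mem_cons] at hA hB
    have h' := h
    simp only [eval_ris, eval_ctrl, eval_var, eval_extL, vals_cons] at h'
    have hmem := (Set.ext_iff.1 h' (t₀.realize σ.x)).2 (.inl (.inl rfl))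
    obtain ⟨hX, hγ⟩ := mem_img_id.1 hmem
    obtain ⟨F, hF, hXF, hE⟩ := exists_shared (U := ∅)
      (fun Y => img (vals σ.x bs ∪ Y) (φ.At σ.x) (fun d => d))
      (fun Y => img Y (γ.At σ.x) (fun d => d)) (by rw [Set.empty_union, h'])
      (Set.notMem_empty _) hX (img_id_union_diff hX) (img_id_diff _ _ _)
    refine .of_s ((σ.s X).finite_toSet.subset hF) fun τ hτ hN => ?_
    simp only [Form.Holds, Constr.Holds, eval_var, eval_ext, eval_ris, eval_ctrl, eval_extL, hN,
      realize_at', hτ.vals hB.1.2, hτ.vals hB.2.1.1, hτ.2 X hA.1, hτ.filter hA.2.1,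
      hτ.filter hB.2.2.1, hτ.term hB.1.1]
    rw [Set.empty_union] at hE
    exact ⟨hXF, hγ, hE.symm⟩
  | varris_shared_pair X t₀ ts bs φ γ p q hp hq =>
    simp only [STerm.in_extL, STerm.in_var, STerm.in_ris, List.forall_mem_cons] at hA hB
    have h' := h
    simp only [eval_ris, eval_var, eval_extL, vals_cons] at h'
    have hmem := (Set.ext_iff.1 h' (t₀.realize σ.x)).2 (.inl (.inl rfl))
    obtain ⟨a, ha, hγa, hqa⟩ := mem_img.1 hmem
    have hsd := img_diff
      (fun d d' => Pat.eval_injective hpr (e := σ.x) (p := q) (d := d) (d' := d'))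
      (σ.s X) (γ.At σ.x) a
    rw [← hqa] at hsd
    have hφ : φ.At σ.x a → t₀.realize σ.x = p.eval pr σ.x a := by
      intro hφa
      obtain ⟨b, -, -, hb⟩ := mem_img.1 ((Set.ext_iff.1 h' (p.eval pr σ.x a)).2
        (.inr ⟨a, .inr ha, hφa, rfl⟩))
      rw [hb, ← Pat.eval_eq_eval hpr hp hq hb, hqa]
    obtain ⟨F, hF, hXF, hE⟩ := exists_shared (U := ∅)
      (fun Y => img (vals σ.x bs ∪ Y) (φ.At σ.x) (p.eval pr σ.x))
      (fun Y => img Y (γ.At σ.x) (q.eval pr σ.x)) (by rw [Set.empty_union, h'])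
      (Set.notMem_empty _) ha
      (fun hn => img_union_diff_of_neg
        (fun hφa => hn ⟨a, .inr ha, hφa, hφ hφa⟩) _ _ _) hsd
    refine .of_xs a ((σ.s X).finite_toSet.subset hF) fun τ hτ hn hN => ?_
    simp only [Form.Holds, Constr.Holds, QF.Realize, eval_var, eval_ext, eval_ris, eval_extL, hN,
      hn,
      realize_at', hτ.vals hB.1.2, hτ.vals hB.2.1.1, hτ.2 X hA.1, hτ.filter hA.2.1,
      hτ.filter hB.2.2.1, hτ.term hB.1.1, Pat.realize_app, hτ.pat pr hA.2.2,
      hτ.pat pr hB.2.2.2, Term.realize_var]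
    rw [Set.empty_union] at hE
    exact ⟨hXF, hγa, hqa, imp_iff_not_or.1 hφ, hE.symm⟩
  | @varris_ext D φ p t A hD =>
    simp only [STerm.in_ext, STerm.in_ris] at hA hB
    have h' := h
    simp only [eval_ris, eval_ext] at h'
    have hmem := (Set.ext_iff.1 h' (t.realize σ.x)).2 (.inl rfl)
    obtain ⟨a, ha, hφa, hpa⟩ := mem_img.1 hmem
    have hsd := img_diff
      (fun d d' => Pat.eval_injective hpr (e := σ.x) (p := p) (d := d) (d' := d'))
      (D.eval pr σ) (φ.At σ.x) a
    rw [← hpa] at hsd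
    obtain ⟨F, hF, hXF, hE⟩ := exists_shared (U := ∅) (T := ∅) (fun _ => A.eval pr σ)
      (fun Y => img Y (φ.At σ.x) (p.eval pr σ.x))
      (by rw [Set.empty_union, h', Set.union_empty])
      (Set.notMem_empty _) ha (fun _ => rfl) hsd
    refine .of_xs a ((D.eval_finite pr σ).subset hF) fun τ hτ hn hN => ?_
    simp only [Form.Holds, Constr.Holds, QF.Realize, eval_var, eval_ext, eval_ris, hN, hn,
      realize_at', hτ.set pr hA.1, hτ.filter hA.2.1, hτ.set pr hB.2,
      hτ.term hB.1, Pat.realize_app, hτ.pat pr hA.2.2, Term.realize_var]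
    rw [Set.empty_union, Set.empty_union] at hE
    exact ⟨hXF, hφa, hpa, hE.symm⟩

end Eq

section Rules

variable {pr : L.Functions 2} {U V : Finset ℕ} {n N N₁ N₂ : ℕ} {σ : Val M}

/-! ### The rules for the other predicates -/

theorem differ_iff {A B : STerm L} (n : ℕ) :
    (differ n A B).Holds pr σ ↔ ¬ (σ.x n ∈ A.eval pr σ ↔ σ.x n ∈ B.eval pr σ) := by
  simp only [differ, Form.Holds, Constr.Holds, Term.realize_var]
  tauto

theorem differ_sound {A B : STerm L} (h : (differ n A B).Holds pr σ) :
    ¬ A.eval pr σ = B.eval pr σ := by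
  intro hAB
  rw [differ_iff, hAB] at h
  exact h Iff.rfl

theorem differ_complete {A B : STerm L} (hA : A.In U V) (hB : B.In U V)
    (h : ¬ A.eval pr σ = B.eval pr σ) : HoldsExt pr U V n N N₁ N₂ σ (differ n A B) := by
  rw [Set.ext_iff, not_forall] at h
  obtain ⟨a, ha⟩ := h
  refine .of_x a fun τ hτ hn => ?_
  rwa [differ_iff, hn, hτ.set pr hA, hτ.set pr hB]

theorem NeqRule.sound {A B : STerm L} {Ψ : Form L} (hr : NeqRule n A B Ψ)
    (h : Ψ.Holds pr σ) : ¬ A.eval pr σ = B.eval pr σ := by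
  cases hr with
  | emp_emp | var_self => exact h.elim
  | swap X hA hA' => exact fun h' => h h'.symm
  | emp_ext t B hE =>
    rw [hE.eval_eq, eval_ext]
    exact fun h => absurd (Set.union_empty_iff.1 h.symm).1 (Set.singleton_ne_empty _)
  | ext_emp t B hE =>
    rw [hE.eval_eq, eval_ext]
    exact fun h => absurd (Set.union_empty_iff.1 h).1 (Set.singleton_ne_empty _)
  | var_ext_var | var_ext_ris | ext_ext | ris_any | any_ris => exact differ_sound h

theorem NeqRule.complete {A B : STerm L} {Ψ : Form L} (hr : NeqRule n A B Ψ)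
    (hA : A.In U V) (hB : B.In U V) (h : ¬ A.eval pr σ = B.eval pr σ) :
    HoldsExt pr U V n N N₁ N₂ σ Ψ := by
  cases hr with
  | emp_emp hA hB => exact (h (by rw [hA.eval_eq, hB.eval_eq])).elim
  | var_self X => exact (h rfl).elim
  | swap X hA' hA'' =>
    refine .of_forall fun τ hτ h' => h ?_
    rw [← hτ.set pr hA, ← hτ.set pr hB]
    exact Eq.symm h'
  | emp_ext t B hE => exact .of_forall fun _ _ => trivial
  | ext_emp t B hE => exact .of_forall fun _ _ => trivial
  | var_ext_var | var_ext_ris | ext_ext | ris_any | any_ris => exact differ_complete hA hB h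

theorem MemRule.sound {t : L.Term ℕ} {A : STerm L} {Ψ : Form L} (hr : MemRule pr n N t A Ψ)
    (h : Ψ.Holds pr σ) : t.realize σ.x ∈ A.eval pr σ := by
  cases hr with
  | emp hA => exact h.elim
  | ext s A => exact h
  | var X =>
    simp only [Form.Holds, Constr.Holds, eval_ext] at h
    rw [h]
    exact .inl rfl
  | ris D φ p =>
    simp only [Form.Holds, Constr.Holds, QF.Realize, realize_at', Pat.realize_app,
      Term.realize_var] at h
    exact ⟨_, h⟩

theorem MemRule.complete {t : L.Term ℕ} {A : STerm L} {Ψ : Form L} (hr : MemRule pr n N t A Ψ)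
    (ht : TermIn U t) (hA : A.In U V) (h : t.realize σ.x ∈ A.eval pr σ) :
    HoldsExt pr U V n N N₁ N₂ σ Ψ := by
  cases hr with
  | emp hE => rw [hE.eval_eq] at h; exact h.elim
  | ext s A =>
    simp only [STerm.in_ext] at hA
    refine .of_forall fun τ hτ => ?_
    simp only [Form.Holds, Constr.Holds, QF.Realize, hτ.term ht, hτ.term hA.1, hτ.set pr hA.2]
    exact h
  | var X =>
    simp only [STerm.in_var] at hA
    refine .of_s (σ.s X).finite_toSet fun τ hτ hN => ?_
    simp only [Form.Holds, Constr.Holds, eval_var, eval_ext, hτ.term ht, hN, hτ.2 X hA]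
    exact (Set.union_eq_self_of_subset_left (Set.singleton_subset_iff.2 h)).symm
  | ris D φ p =>
    simp only [STerm.in_ris] at hA
    obtain ⟨a, ha, hφ, hp⟩ := h
    refine .of_x a fun τ hτ hn => ?_
    simp only [Form.Holds, Constr.Holds, QF.Realize, realize_at', Pat.realize_app,
      Term.realize_var, hn, hτ.term ht, hτ.set pr hA.1, hτ.filter hA.2.1, hτ.pat pr hA.2.2]
    exact ⟨ha, hφ, hp⟩

/-- The value of a RIS whose domain has a first element `d`. -/
theorem eval_ris_ext (D : STerm L) (d : L.Term ℕ) (φ : QF L (Option ℕ)) (p : Pat L) :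
    (φ.At σ.x (d.realize σ.x) → (STerm.ris (.ext d D) φ p).eval pr σ =
      {p.eval pr σ.x (d.realize σ.x)} ∪ (STerm.ris D φ p).eval pr σ) ∧
    (¬ φ.At σ.x (d.realize σ.x) → (STerm.ris (.ext d D) φ p).eval pr σ =
      (STerm.ris D φ p).eval pr σ) := by
  rw [eval_ris, eval_ris, eval_ext, img_union]
  refine ⟨fun h => ?_, fun h => ?_⟩
  · rw [img_singleton_of_pos h]
  · rw [img_singleton_of_neg h, Set.empty_union]

theorem NmemRule.holds_iff {t : L.Term ℕ} {A : STerm L} {Ψ : Form L} (hr : NmemRule pr t A Ψ) :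
    Ψ.Holds pr σ ↔ t.realize σ.x ∉ A.eval pr σ := by
  cases hr with
  | emp hE => simp [hE.eval_eq, Form.Holds]
  | ext s A =>
    simp only [Form.Holds, Constr.Holds, QF.Realize, eval_ext, Set.mem_union,
      Set.mem_singleton_iff, not_or]
  | ris d D φ p =>
    simp only [Form.Holds, Constr.Holds, QF.Realize, realize_at', Pat.realize_app]
    by_cases hφ : φ.At σ.x (d.realize σ.x)
    · simp [(eval_ris_ext D d φ p).1 hφ, hφ]
    · simp [(eval_ris_ext D d φ p).2 hφ, hφ]

theorem inter_singleton_union_eq_empty {a : M} {A B : Set M} :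
    A ∩ ({a} ∪ B) = ∅ ↔ a ∉ A ∧ A ∩ B = ∅ := by
  rw [Set.inter_union_distrib_left, Set.union_empty_iff, Set.inter_singleton_eq_empty]

theorem DisjRule.holds_iff {A B : STerm L} {Ψ : Form L} (hr : DisjRule pr A B Ψ) :
    Ψ.Holds pr σ ↔ A.eval pr σ ∩ B.eval pr σ = ∅ := by
  cases hr with
  | same_var X => simp [Form.Holds, Constr.Holds, eval_var, eval_emp]
  | any_emp A hE => simp [hE.eval_eq, Form.Holds]
  | emp_any A hE => simp [hE.eval_eq, Form.Holds]
  | any_ext A t B =>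
    simp only [Form.Holds, Constr.Holds, eval_ext, inter_singleton_union_eq_empty]
  | ext_any t B A =>
    rw [Set.inter_comm]
    simp only [Form.Holds, Constr.Holds, eval_ext, inter_singleton_union_eq_empty]
  | any_ris A d D φ p =>
    simp only [Form.Holds, Constr.Holds, QF.Realize, realize_at', Pat.realize_app]
    by_cases hφ : φ.At σ.x (d.realize σ.x)
    · simp only [(eval_ris_ext D d φ p).1 hφ, hφ, inter_singleton_union_eq_empty]
      tauto
    · simp only [(eval_ris_ext D d φ p).2 hφ, hφ]
      tauto
  | ris_any d D φ p A =>
    rw [Set.inter_comm]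
    simp only [Form.Holds, Constr.Holds, QF.Realize, realize_at', Pat.realize_app,
      Set.inter_comm _ (STerm.eval pr σ B)]
    by_cases hφ : φ.At σ.x (d.realize σ.x)
    · simp only [(eval_ris_ext D d φ p).1 hφ, hφ, inter_singleton_union_eq_empty]
      tauto
    · simp only [(eval_ris_ext D d φ p).2 hφ, hφ]
      tauto

theorem SortRule.holds_iff {c : Constr L} {Ψ : Form L} (hr : SortRule c Ψ) :
    Ψ.Holds pr σ ↔ c.Holds pr σ := by
  cases hr <;> simp [Form.Holds, Constr.Holds]

/-- The constraint `unConstr` forces the replaced term to keep its value. -/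
theorem unTerm_eval (A : STerm L) (h : (unConstr pr N A).Holds pr σ) :
    (unTerm N A).eval pr σ = A.eval pr σ := by
  rcases A with _ | _ | _ | ⟨_ | _ | ⟨d, D⟩ | _, φ, p⟩ <;> try rfl
  simp only [unConstr, Form.Holds, Constr.Holds, realize_at', QF.Realize, eval_ext,
    Pat.realize_app] at h
  rcases h with ⟨h, hφ⟩ | ⟨h, hφ⟩
  · rw [(eval_ris_ext D d φ p).1 hφ, ← h, unTerm]
  · rw [(eval_ris_ext D d φ p).2 hφ, ← h, unTerm]

/-- If the fresh variable `K` is assigned the value of `A`, then it may replace `A`. -/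
theorem unTerm_complete {A : STerm L} {K : ℕ} {τ : Val M} (hA : A.In U V) (hτ : Agree U V σ τ)
    (hK : (τ.s K : Set M) = A.eval pr σ) :
    (unTerm K A).eval pr τ = A.eval pr σ ∧ (unConstr pr K A).Holds pr τ := by
  have hA' := hτ.set pr hA
  rw [← hA'] at hK ⊢
  rcases A with _ | _ | _ | ⟨_ | _ | ⟨d, D⟩ | _, φ, p⟩ <;> try exact ⟨rfl, trivial⟩
  refine ⟨hK, ?_⟩
  simp only [unConstr, Form.Holds, Constr.Holds, realize_at', QF.Realize, eval_ext,
    Pat.realize_app, eval_var, hK]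
  by_cases hφ : φ.At τ.x (d.realize τ.x)
  · exact .inl ⟨(eval_ris_ext D d φ p).1 hφ, hφ⟩
  · exact .inr ⟨(eval_ris_ext D d φ p).2 hφ, hφ⟩

theorem UnRule.sound {A B C : STerm L} {Ψ : Form L} (hr : UnRule pr N N₁ N₂ A B C Ψ)
    (h : Ψ.Holds pr σ) : A.eval pr σ ∪ B.eval pr σ = C.eval pr σ := by
  cases hr with
  | same_var X B => rw [Set.union_self]; exact h
  | emp_right A B hE =>
    simp only [Form.Holds, Constr.Holds, eval_emp] at h
    rw [h.1, h.2, hE.eval_eq, Set.union_self]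
  | emp_fst A B hE => rw [hE.eval_eq, Set.empty_union]; exact Eq.symm h
  | emp_snd A B hE => rw [hE.eval_eq, Set.union_empty]; exact Eq.symm h
  | ext_fst t C A hB =>
    simp only [Form.Holds, Constr.Holds, eval_ext, eval_var, Set.ext_iff, Set.mem_union,
      Set.mem_singleton_iff] at h ⊢
    grind
  | ext_snd t C A hB =>
    simp only [Form.Holds, Constr.Holds, eval_ext, eval_var, Set.ext_iff, Set.mem_union,
      Set.mem_singleton_iff] at h ⊢
    grind
  | ext_right t A B C =>
    simp only [Form.Holds, Constr.Holds, eval_ext, eval_var, Set.ext_iff, Set.mem_union,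
      Set.mem_singleton_iff] at h ⊢
    grind
  | ris A B C hE =>
    obtain ⟨h, hA, hB, hC⟩ := h
    rw [← unTerm_eval A hA, ← unTerm_eval B hB, ← unTerm_eval C hC]
    exact h

/-- In the rules for an extension `{t ⊔ C}` the new variables get the values of the three arguments
without `t`. -/
theorem UnRule.complete {A B C : STerm L} {Ψ : Form L} (hr : UnRule pr N N₁ N₂ A B C Ψ)
    (hA : A.In U V) (hB : B.In U V) (hC : C.In U V)
    (h : A.eval pr σ ∪ B.eval pr σ = C.eval pr σ) : HoldsExt pr U V n N N₁ N₂ σ Ψ := by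
  have key := Set.ext_iff.1 h
  simp only [Set.mem_union] at key
  have hfin : ∀ (A : STerm L) (a : M), (A.eval pr σ \ {a}).Finite :=
    fun A a => (A.eval_finite pr σ).sdiff
  cases hr with
  | same_var X B =>
    rw [Set.union_self] at h
    refine .of_forall fun τ hτ => ?_
    simp only [Form.Holds, Constr.Holds, hτ.set pr hA, hτ.set pr hC]
    exact h
  | emp_right A B hE =>
    rw [hE.eval_eq, Set.union_empty_iff] at h
    refine .of_forall fun τ hτ => ?_
    simpa only [Form.Holds, Constr.Holds, hτ.set pr hA, hτ.set pr hB, eval_emp] using h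
  | emp_fst A B hE =>
    rw [hE.eval_eq, Set.empty_union] at h
    refine .of_forall fun τ hτ => ?_
    simpa only [Form.Holds, Constr.Holds, hτ.set pr hC, hτ.set pr hB] using h.symm
  | emp_snd A B hE =>
    rw [hE.eval_eq, Set.union_empty] at h
    refine .of_forall fun τ hτ => ?_
    simpa only [Form.Holds, Constr.Holds, hτ.set pr hC, hτ.set pr hA] using h.symm
  | ext_fst t D A hB' =>
    have ht := (STerm.in_ext t D).1 hA
    refine .of_sss (hfin C (t.realize σ.x)) (hfin (.ext t D) (t.realize σ.x))
      (hfin B (t.realize σ.x)) fun τ hτ h₀ h₁ h₂ => ?_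
    simp only [eval_ext, Set.mem_union, Set.mem_singleton_iff] at key
    simp only [Form.Holds, Constr.Holds, eval_ext, eval_var, hτ.set pr hB, hτ.set pr hC,
      hτ.set pr ht.2, hτ.term ht.1, h₀, h₁, h₂, Set.ext_iff, Set.mem_union, Set.mem_singleton_iff,
      Set.mem_sdiff]
    grind
  | ext_snd t D A hB' =>
    have ht := (STerm.in_ext t D).1 hB
    refine .of_sss (hfin C (t.realize σ.x)) (hfin (.ext t D) (t.realize σ.x))
      (hfin A (t.realize σ.x)) fun τ hτ h₀ h₁ h₂ => ?_
    simp only [eval_ext, Set.mem_union, Set.mem_singleton_iff] at key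
    simp only [Form.Holds, Constr.Holds, eval_ext, eval_var, hτ.set pr hA, hτ.set pr hC,
      hτ.set pr ht.2, hτ.term ht.1, h₀, h₁, h₂, Set.ext_iff, Set.mem_union, Set.mem_singleton_iff,
      Set.mem_sdiff]
    grind
  | ext_right t A B D =>
    have ht := (STerm.in_ext t D).1 hC
    simp only [eval_ext, Set.mem_union, Set.mem_singleton_iff] at key
    by_cases htA : t.realize σ.x ∈ A.eval pr σ
    · by_cases htB : t.realize σ.x ∈ B.eval pr σ
      · refine .of_sss (hfin (.ext t D) (t.realize σ.x)) (hfin A (t.realize σ.x))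
          (hfin B (t.realize σ.x)) fun τ hτ h₀ h₁ h₂ => ⟨?_, .inr (.inr ?_)⟩
        all_goals
          simp only [Form.Holds, Constr.Holds, eval_ext, eval_var, hτ.set pr hA, hτ.set pr hB,
            hτ.set pr ht.2, hτ.term ht.1, h₀, h₁, h₂, Set.ext_iff, Set.mem_union,
            Set.mem_singleton_iff, Set.mem_sdiff]
          grind
      · refine .of_sss (hfin (.ext t D) (t.realize σ.x)) (hfin A (t.realize σ.x))
          Set.finite_empty fun τ hτ h₀ h₁ _ => ⟨?_, .inl ?_⟩
        all_goals
          simp only [Form.Holds, Constr.Holds, eval_ext, eval_var, hτ.set pr hA, hτ.set pr hB,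
            hτ.set pr ht.2, hτ.term ht.1, h₀, h₁, Set.ext_iff, Set.mem_union,
            Set.mem_singleton_iff, Set.mem_sdiff]
          grind
    · refine .of_sss (hfin (.ext t D) (t.realize σ.x)) (hfin B (t.realize σ.x))
          Set.finite_empty fun τ hτ h₀ h₁ _ => ⟨?_, .inr (.inl ?_)⟩
      all_goals
        simp only [Form.Holds, Constr.Holds, eval_ext, eval_var, hτ.set pr hA, hτ.set pr hB,
          hτ.set pr ht.2, hτ.term ht.1, h₀, h₁, Set.ext_iff, Set.mem_union,
          Set.mem_singleton_iff, Set.mem_sdiff]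
        grind
  | ris A B C hE =>
    refine .of_sss (A.eval_finite pr σ) (B.eval_finite pr σ) (C.eval_finite pr σ)
      fun τ hτ h₀ h₁ h₂ => ?_
    have hA' := unTerm_complete hA hτ h₀
    have hB' := unTerm_complete hB hτ h₁
    have hC' := unTerm_complete hC hτ h₂
    refine ⟨?_, hA'.2, hB'.2, hC'.2⟩
    simp only [Form.Holds, Constr.Holds, hA'.1, hB'.1, hC'.1]
    exact h

/-! ### All rules -/

/-- The truth of a constraint with a hole depends only on the value of the term in the hole. -/
theorem Hole.holds_congr {f : STerm L → Constr L} (hf : Hole f) {A B : STerm L}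
    (h : A.eval pr σ = B.eval pr σ) : (f A).Holds pr σ ↔ (f B).Holds pr σ := by
  cases hf <;> simp only [Constr.Holds, h]

/-- The part `Q` of the condition that concerns the other arguments does not depend on the term in
the hole. -/
theorem Hole.in_iff {f : STerm L → Constr L} (hf : Hole f) :
    ∃ Q : Prop, ∀ A, (f A).In U V ↔ A.In U V ∧ Q := by
  cases hf with
  | eq_fst B => exact ⟨B.In U V, fun A => by rw [Constr.in_eq]⟩
  | eq_snd B => exact ⟨B.In U V, fun A => by rw [Constr.in_eq, and_comm]⟩
  | nmem t => exact ⟨TermIn U t, fun A => by rw [Constr.in_nmem, and_comm]⟩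
  | un_fst B C => exact ⟨B.In U V ∧ C.In U V, fun A => by rw [Constr.in_un]⟩
  | un_snd B C => exact ⟨B.In U V ∧ C.In U V, fun A => by rw [Constr.in_un, and_left_comm]⟩
  | un_trd B C => exact ⟨B.In U V ∧ C.In U V, fun A => by rw [Constr.in_un]; tauto⟩
  | disj_fst B => exact ⟨B.In U V, fun A => by rw [Constr.in_disj]⟩
  | disj_snd B => exact ⟨B.In U V, fun A => by rw [Constr.in_disj, and_comm]⟩

/-- Every rule is sound, for arbitrary values of the variables `n`, `N`, `N₁`, `N₂`. -/
theorem Rule.sound {c : Constr L} {Ψ : Form L} (hr : Rule pr n N N₁ N₂ c Ψ)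
    (h : Ψ.Holds pr σ) : c.Holds pr σ := by
  cases hr with
  | eq hr => exact hr.sound h
  | eq_left hr => exact hr.sound h
  | eq_right hr => exact (hr.sound h).symm
  | neq hr => exact hr.sound h
  | mem hr => exact hr.sound h
  | nmem hr => exact hr.holds_iff.1 h
  | un hr => exact hr.sound h
  | disj hr => exact hr.holds_iff.1 h
  | sort hr => exact hr.holds_iff.1 h
  | nested φ p hf _ _ _ =>
    rcases h with ⟨hE, h⟩ | ⟨hE, h⟩
    all_goals
      refine (hf.holds_congr ?_).2 h
      rw [eval_ris, eval_ris, hE]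

/-- Every solution of the left-hand side of a rule becomes a solution of the right-hand side when
`n`, `N`, `N₁`, `N₂` are given suitable values and the variables in `U` and `V` keep theirs. -/
theorem Rule.complete (hpr : ∀ a b c d : M,
      Structure.funMap pr ![a, b] = Structure.funMap pr ![c, d] → a = c ∧ b = d)
    {c : Constr L} {Ψ : Form L} (hr : Rule pr n N N₁ N₂ c Ψ) (hc : c.In U V)
    (h : c.Holds pr σ) : HoldsExt pr U V n N N₁ N₂ σ Ψ := by
  cases hr with
  | eq hr => rw [Constr.in_eq] at hc; exact hr.complete hpr hc.1 hc.2 h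
  | eq_left hr => rw [Constr.in_eq] at hc; exact hr.complete hpr hc.1 hc.2 h
  | eq_right hr => rw [Constr.in_eq] at hc; exact hr.complete hpr hc.2 hc.1 (Eq.symm h)
  | neq hr => rw [Constr.in_neq] at hc; exact hr.complete hc.1 hc.2 h
  | mem hr => rw [Constr.in_mem] at hc; exact hr.complete hc.1 hc.2 h
  | nmem hr => exact .of_forall fun τ hτ => hr.holds_iff.2 ((hτ.constr pr hc).2 h)
  | un hr => rw [Constr.in_un] at hc; exact hr.complete hc.1 hc.2.1 hc.2.2 h
  | disj hr => exact .of_forall fun τ hτ => hr.holds_iff.2 ((hτ.constr pr hc).2 h)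
  | sort hr => exact .of_forall fun τ hτ => hr.holds_iff.2 ((hτ.constr pr hc).2 h)
  | @nested f E φ p hf _ _ _ =>
    obtain ⟨Q, hQ⟩ := hf.in_iff (U := U) (V := V)
    have hE : E.In U V := ((STerm.in_ris E φ p).1 ((hQ _).1 hc).1).1
    rcases (E.eval pr σ).eq_empty_or_nonempty with hemp | ⟨a, ha⟩
    · refine .inr (.of_forall fun τ hτ => ?_)
      have hE' : E.eval pr τ = STerm.emp.eval pr τ := by rw [hτ.set pr hE, hemp, eval_emp]
      refine ⟨hE', (hf.holds_congr ?_).1 ((hτ.constr pr hc).2 h)⟩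
      rw [eval_ris, eval_ris, hE']
    · refine .inl (.of_xs a (E.eval_finite pr σ) fun τ hτ hn hN => ?_)
      have hE' : E.eval pr τ = (STerm.ext (Term.var n) (.var N)).eval pr τ := by
        rw [hτ.set pr hE, eval_ext, eval_var, hN, Term.realize_var, hn]
        exact (Set.union_eq_self_of_subset_left (Set.singleton_subset_iff.2 ha)).symm
      refine ⟨hE', (hf.holds_congr ?_).1 ((hτ.constr pr hc).2 h)⟩
      rw [eval_ris, eval_ris, hE']

/-! ### Variables of the right-hand sides -/

theorem sharedCtrlRhs_in {X : ℕ} {t₀ : L.Term ℕ} {ts ss : List (L.Term ℕ)}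
    {R S R' S' : STerm L} {g : Form L} (hN : N ∈ V) (hN₁ : N₁ ∈ V) (hN₂ : N₂ ∈ V) (hX : X ∈ V)
    (hR : R.In U V) (hS : S.In U V) (hR' : R'.In U V) (hS' : S'.In U V) (hg : g.In U V)
    (h₀ : TermIn U t₀) (hts : ∀ t ∈ ts, TermIn U t) (hss : ∀ s ∈ ss, TermIn U s) :
    (sharedCtrlRhs N N₁ N₂ X t₀ ts ss R S R' S' g).In U V := by
  have := sixBranches_in hN hN₁ hN₂ hR hS h₀ hts hss
  simp only [sharedCtrlRhs, Form.in_or, Form.in_and, Form.in_con, Constr.in_eq, STerm.in_var,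
    STerm.in_ext, STerm.in_extL]
  tauto

theorem EqRule.rhs_in {A B : STerm L} {Ψ : Form L} (hr : EqRule pr n N N₁ N₂ A B Ψ)
    (hn : n ∈ U) (hN : N ∈ V) (hN₁ : N₁ ∈ V) (hN₂ : N₂ ∈ V) (hA : A.In U V) (hB : B.In U V) :
    Ψ.In U V := by
  cases hr with
  | emp_emp | var_self => exact Form.in_tru
  | shared_var_var | shared_ris_var =>
    simp only [STerm.in_extL, List.forall_mem_cons, STerm.in_var, STerm.in_ris] at hA hB
    apply sharedCtrlRhs_in <;>
      try simp only [STerm.in_var, STerm.in_ris, STerm.in_extL, Form.in_tru, List.forall_mem_cons]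
    all_goals tauto
  | shared_ris_ris =>
    simp only [STerm.in_extL, List.forall_mem_cons, STerm.in_var, STerm.in_ris] at hA hB
    apply sharedCtrlRhs_in <;>
      try simp only [STerm.in_var, STerm.in_ris, STerm.in_extL, Form.in_xf, List.forall_mem_cons,
        at'_in hB.2.2.1 hA.1.1]
    all_goals tauto
  | shared_var_ris => exact (Constr.in_eq ..).2 ⟨hB, hA⟩
  | shared_pair X t₀ s₀ ts ss bs φ γ p q =>
    have hR := ((STerm.in_extL ..).1 hA).2
    have hS := ((STerm.in_extL ..).1 hB).2
    simp only [STerm.in_extL, List.forall_mem_cons, STerm.in_var, STerm.in_ris] at hA hB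
    obtain ⟨⟨h₀, hts⟩, ⟨hbs, hX⟩, hφ, hp⟩ := hA
    obtain ⟨hss, -, hγ, hq⟩ := hB
    have hss' : ∀ s ∈ s₀ :: ss, TermIn U s := List.forall_mem_cons.2 hss
    have hn' : TermIn U (Term.var n : L.Term ℕ) := (termIn_var n).2 hn
    have hpn := Pat.app_in (pr := pr) hp hn'
    have hqn := Pat.app_in (pr := pr) hq hn'
    refine (Form.in_or ..).2 ⟨sixBranches_in hN hN₁ hN₂ hR hS h₀ hts hss',
      (Form.in_or ..).2 ⟨?_, bigOr_in fun Ψ hΨ => ?_⟩⟩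
    · simp only [Form.in_or, Form.in_and, Form.in_con, Form.in_xf, Constr.in_eq, Constr.in_nmem,
        STerm.in_var, STerm.in_ext, STerm.in_extL, STerm.in_ris, STerm.in_emp, vars_eq_subset,
        vars_neg_subset, at'_in hφ hn', at'_in hγ hn']
      tauto
    · obtain ⟨s, hs, rfl⟩ := List.mem_map.1 hΨ
      have := hss' s hs
      simp only [Form.in_and, Form.in_con, Form.in_xf, Constr.in_eq,
        STerm.in_var, STerm.in_ext, STerm.in_extL, STerm.in_ris, vars_eq_subset,
        at'_in hφ hn', at'_in hγ hn', List.forall_mem_cons]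
      simp only [List.forall_mem_cons] at hss'
      tauto
  | ext_ext =>
    simp only [STerm.in_ext] at hA hB
    simp only [Form.in_or, Form.in_and, Form.in_con, Form.in_xf, Constr.in_eq,
        STerm.in_var, STerm.in_ext, vars_eq_subset]
    tauto

theorem EqRuleSym.rhs_in {A B : STerm L} {Ψ : Form L} (hr : EqRuleSym pr n N A B Ψ)
    (hn : n ∈ U) (hN : N ∈ V) (hA : A.In U V) (hB : B.In U V) : Ψ.In U V := by
  have hn' : TermIn U (Term.var n : L.Term ℕ) := (termIn_var n).2 hn
  cases hr <;>
    simp only [STerm.in_extL, List.forall_mem_cons, STerm.in_var, STerm.in_ris, STerm.in_ext]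
      at hA hB <;>
    simp only [Form.in_or, Form.in_and, Form.in_con, Form.in_xf, Form.in_fls, Constr.in_eq,
        STerm.in_var, STerm.in_ext, STerm.in_extL, STerm.in_ris, STerm.in_emp, vars_eq_subset,
        vars_neg_subset, List.forall_mem_cons, at'_in, Pat.app_in, *] <;>
    tauto

theorem differ_in {A B : STerm L} (hn : n ∈ U) (hA : A.In U V) (hB : B.In U V) :
    (differ n A B).In U V := by
  simp [differ, hn, hA, hB]

theorem NeqRule.rhs_in {A B : STerm L} {Ψ : Form L} (hr : NeqRule n A B Ψ)
    (hn : n ∈ U) (hA : A.In U V) (hB : B.In U V) : Ψ.In U V := by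
  cases hr with
  | emp_emp | var_self | emp_ext | ext_emp => simp
  | swap => exact (Constr.in_neq ..).2 ⟨hB, hA⟩
  | var_ext_var | var_ext_ris | ext_ext | ris_any | any_ris => exact differ_in hn hA hB

theorem MemRule.rhs_in {t : L.Term ℕ} {A : STerm L} {Ψ : Form L} (hr : MemRule pr n N t A Ψ)
    (hn : n ∈ U) (hN : N ∈ V) (ht : TermIn U t) (hA : A.In U V) : Ψ.In U V := by
  have hn' : TermIn U (Term.var n : L.Term ℕ) := (termIn_var n).2 hn
  cases hr <;> simp_all [at'_in, Pat.app_in]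

theorem NmemRule.rhs_in {t : L.Term ℕ} {A : STerm L} {Ψ : Form L} (hr : NmemRule pr t A Ψ)
    (ht : TermIn U t) (hA : A.In U V) : Ψ.In U V := by
  cases hr <;> simp_all [at'_in, Pat.app_in]

theorem unTerm_in {A : STerm L} (hN : N ∈ V) (hA : A.In U V) :
    (unTerm N A).In U V ∧ (unConstr pr N A).In U V := by
  rcases A with _ | _ | _ | ⟨_ | _ | ⟨d, D⟩ | _, φ, p⟩ <;>
    simp_all [unTerm, unConstr, at'_in, Pat.app_in]

theorem UnRule.rhs_in {A B C : STerm L} {Ψ : Form L} (hr : UnRule pr N N₁ N₂ A B C Ψ)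
    (hN : N ∈ V) (hN₁ : N₁ ∈ V) (hN₂ : N₂ ∈ V) (hA : A.In U V) (hB : B.In U V)
    (hC : C.In U V) : Ψ.In U V := by
  cases hr with
  | ris =>
    have h₁ := unTerm_in (pr := pr) hN hA
    have h₂ := unTerm_in (pr := pr) hN₁ hB
    have h₃ := unTerm_in (pr := pr) hN₂ hC
    simp only [Form.in_and, Form.in_con, Constr.in_un]
    tauto
  | _ => simp_all

theorem DisjRule.rhs_in {A B : STerm L} {Ψ : Form L} (hr : DisjRule pr A B Ψ)
    (hA : A.In U V) (hB : B.In U V) : Ψ.In U V := by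
  cases hr <;> simp_all [at'_in, Pat.app_in]

theorem SortRule.rhs_in {c : Constr L} {Ψ : Form L} (hr : SortRule c Ψ) (hc : c.In U V) :
    Ψ.In U V := by
  cases hr <;> simp_all

theorem Rule.rhs_in {c : Constr L} {Ψ : Form L} (hr : Rule pr n N N₁ N₂ c Ψ)
    (hn : n ∈ U) (hN : N ∈ V) (hN₁ : N₁ ∈ V) (hN₂ : N₂ ∈ V) (hc : c.In U V) : Ψ.In U V := by
  cases hr with
  | eq hr => rw [Constr.in_eq] at hc; exact hr.rhs_in hn hN hN₁ hN₂ hc.1 hc.2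
  | eq_left hr => rw [Constr.in_eq] at hc; exact hr.rhs_in hn hN hc.1 hc.2
  | eq_right hr => rw [Constr.in_eq] at hc; exact hr.rhs_in hn hN hc.2 hc.1
  | neq hr => rw [Constr.in_neq] at hc; exact hr.rhs_in hn hc.1 hc.2
  | mem hr => rw [Constr.in_mem] at hc; exact hr.rhs_in hn hN hc.1 hc.2
  | nmem hr => rw [Constr.in_nmem] at hc; exact hr.rhs_in hc.1 hc.2
  | un hr => rw [Constr.in_un] at hc; exact hr.rhs_in hN hN₁ hN₂ hc.1 hc.2.1 hc.2.2
  | disj hr => rw [Constr.in_disj] at hc; exact hr.rhs_in hc.1 hc.2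
  | sort hr => exact hr.rhs_in hc
  | nested φ p hf _ _ _ =>
    obtain ⟨Q, hQ⟩ := hf.in_iff (U := U) (V := V)
    rw [hQ, STerm.in_ris] at hc
    simp only [Form.in_or, Form.in_and, Form.in_con, Constr.in_eq, STerm.in_ext, STerm.in_var,
      STerm.in_emp, hQ, STerm.in_ris, termIn_var]
    tauto

end Rules

/-! ### Branches of the solver -/

section Solver

variable {pr : L.Functions 2} {U V : Finset ℕ} {σ : Val M}

theorem dnf_holds (Φ : Form L) :
    Φ.Holds pr σ ↔ ∃ a ∈ dnf Φ, ∀ l ∈ a, l.Holds pr σ := by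
  induction Φ with
  | tru | fls | con c | xf φ => simp [Form.Holds, dnf, Lit.Holds]
  | and Φ Ψ ih₁ ih₂ =>
    simp only [Form.Holds, ih₁, ih₂, dnf, List.mem_flatMap, List.mem_map]
    constructor
    · rintro ⟨⟨a, ha, ha'⟩, b, hb, hb'⟩
      exact ⟨a ++ b, ⟨a, ha, b, hb, rfl⟩, by simpa only [List.forall_mem_append] using ⟨ha', hb'⟩⟩
    · rintro ⟨_, ⟨a, ha, b, hb, rfl⟩, h⟩
      rw [List.forall_mem_append] at h
      exact ⟨⟨a, ha, h.1⟩, b, hb, h.2⟩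
  | or Φ Ψ ih₁ ih₂ =>
    simp only [Form.Holds, ih₁, ih₂, dnf, List.mem_append, or_and_right, exists_or]

theorem dnf_in {Φ : Form L} (h : Φ.In U V) : ∀ a ∈ dnf Φ, ∀ l ∈ a, l.In U V := by
  induction Φ with
  | tru => simp [dnf]
  | fls => simp [dnf, Lit.In]
  | con c => simpa [dnf, Lit.In] using h
  | xf φ => simpa [dnf, Lit.In] using h
  | and Φ Ψ ih₁ ih₂ =>
    rw [Form.in_and] at h
    simp only [dnf, List.mem_flatMap, List.mem_map]
    rintro _ ⟨a, ha, b, hb, rfl⟩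
    rw [List.forall_mem_append]
    exact ⟨ih₁ h.1 a ha, ih₂ h.2 b hb⟩
  | or Φ Ψ ih₁ ih₂ =>
    rw [Form.in_or] at h
    simp only [dnf, List.forall_mem_append]
    exact ⟨ih₁ h.1, ih₂ h.2⟩

/-- Truth of the conjunction carried by a branch. -/
def State.Holds (pr : L.Functions 2) (σ : Val M) (s : State L) : Prop :=
  ∀ l ∈ s.lits, l.Holds pr σ

/-- All variables of the conjunction, and those in `U₀` and `V₀`, are recorded as used. -/
def State.Good (U₀ V₀ : Finset ℕ) (s : State L) : Prop :=
  U₀ ⊆ s.usedX ∧ V₀ ⊆ s.usedS ∧ ∀ l ∈ s.lits, l.In s.usedX s.usedS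

/-- The lists of branches `ss` and `ts` have the same solutions, up to the values of variables
outside `U₀` and `V₀`.  The passage from `ss` to `ts` may introduce new variables, so a solution of
`ss` may have to be changed, but solutions of `ts` are solutions of `ss` as they are. -/
structure Equi (M : Type w) [L.Structure M] (pr : L.Functions 2) (U₀ V₀ : Finset ℕ)
    (ss ts : List (State L)) : Prop where
  good : (∀ s ∈ ss, s.Good U₀ V₀) → ∀ t ∈ ts, t.Good U₀ V₀
  complete : (∀ s ∈ ss, s.Good U₀ V₀) → ∀ σ : Val M, (∃ s ∈ ss, s.Holds pr σ) →
    ∃ t ∈ ts, ∃ τ : Val M, Agree U₀ V₀ σ τ ∧ t.Holds pr τ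
  sound : ∀ σ : Val M, (∃ t ∈ ts, t.Holds pr σ) → ∃ s ∈ ss, s.Holds pr σ

variable {U₀ V₀ : Finset ℕ} {ss ts us : List (State L)}

theorem Equi.of_mem_iff (h : ∀ s, s ∈ ss ↔ s ∈ ts) : Equi M pr U₀ V₀ ss ts where
  good hg t ht := hg t ((h t).2 ht)
  complete := fun _ σ ⟨s, hs, hσ⟩ => ⟨s, (h s).1 hs, σ, .refl _ _ σ, hσ⟩
  sound := fun _ ⟨t, ht, hσ⟩ => ⟨t, (h t).2 ht, hσ⟩

theorem Equi.refl (ss : List (State L)) : Equi M pr U₀ V₀ ss ss := .of_mem_iff fun _ => Iff.rfl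

theorem Equi.trans (h₁ : Equi M pr U₀ V₀ ss ts) (h₂ : Equi M pr U₀ V₀ ts us) :
    Equi M pr U₀ V₀ ss us where
  good hg := h₂.good (h₁.good hg)
  complete hg σ hσ := by
    obtain ⟨t, ht, τ, hτ, h⟩ := h₁.complete hg σ hσ
    obtain ⟨u, hu, ρ, hρ, h'⟩ := h₂.complete (h₁.good hg) τ ⟨t, ht, h⟩
    exact ⟨u, hu, ρ, hτ.trans hρ, h'⟩
  sound σ h := h₁.sound σ (h₂.sound σ h)

theorem Equi.append {ss' ts' : List (State L)} (h₁ : Equi M pr U₀ V₀ ss ts)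
    (h₂ : Equi M pr U₀ V₀ ss' ts') : Equi M pr U₀ V₀ (ss ++ ss') (ts ++ ts') where
  good hg := by
    rw [List.forall_mem_append] at hg ⊢
    exact ⟨h₁.good hg.1, h₂.good hg.2⟩
  complete hg σ := by
    rw [List.forall_mem_append] at hg
    rintro ⟨s, hs, hσ⟩
    rcases List.mem_append.1 hs with hs | hs
    · obtain ⟨t, ht, h⟩ := h₁.complete hg.1 σ ⟨s, hs, hσ⟩
      exact ⟨t, List.mem_append_left _ ht, h⟩
    · obtain ⟨t, ht, h⟩ := h₂.complete hg.2 σ ⟨s, hs, hσ⟩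
      exact ⟨t, List.mem_append_right _ ht, h⟩
  sound σ := by
    rintro ⟨t, ht, hσ⟩
    rcases List.mem_append.1 ht with ht | ht
    · obtain ⟨s, hs, h⟩ := h₁.sound σ ⟨t, ht, hσ⟩
      exact ⟨s, List.mem_append_left _ hs, h⟩
    · obtain ⟨s, hs, h⟩ := h₂.sound σ ⟨t, ht, hσ⟩
      exact ⟨s, List.mem_append_right _ hs, h⟩

/-- A transformation of single branches that keeps the solutions. -/
theorem Equi.singleton {s t : State L} (hg : s.Good U₀ V₀ → t.Good U₀ V₀)
    (h : ∀ σ : Val M, t.Holds pr σ ↔ s.Holds pr σ) : Equi M pr U₀ V₀ [s] [t] where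
  good := by simpa using hg
  complete _ σ := by
    rintro ⟨s', hs, hσ⟩
    rw [List.mem_singleton.1 hs] at hσ
    exact ⟨t, by simp, σ, .refl _ _ σ, (h σ).2 hσ⟩
  sound σ := by
    rintro ⟨t', ht, hσ⟩
    rw [List.mem_singleton.1 ht] at hσ
    exact ⟨s, by simp, (h σ).1 hσ⟩

theorem Equi.map {f : State L → State L} (h : ∀ s, Equi M pr U₀ V₀ [s] [f s])
    (ss : List (State L)) : Equi M pr U₀ V₀ ss (ss.map f) := by
  induction ss with
  | nil => exact .refl _
  | cons s ss ih => exact (h s).append ih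

/-! ### Rewriting one literal -/

theorem State.holds_split {s : State L} {Γ Δ ψ : List (Lit L)} (h : s.lits = Γ ++ ψ ++ Δ) :
    s.Holds pr σ ↔ (∀ l ∈ Γ ++ Δ, l.Holds pr σ) ∧ ∀ l ∈ ψ, l.Holds pr σ := by
  rw [State.Holds, h]
  simp only [List.forall_mem_append]
  tauto

/-- Replacing a constraint `c` by a formula `Ψ` that implies `c`, and that holds, with suitable
values of the fresh variables, whenever `c` does. -/
theorem Equi.branches {s : State L} {Γ Δ : List (Lit L)} {c : Constr L} {Ψ : Form L}
    {n N N₁ N₂ : ℕ} (hs : s.lits = Γ ++ Lit.con c :: Δ) (hf : s.Fresh n N N₁ N₂)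
    (hsound : ∀ σ : Val M, Ψ.Holds pr σ → c.Holds pr σ)
    (hcomplete : c.In s.usedX s.usedS → ∀ σ : Val M, c.Holds pr σ →
      HoldsExt pr s.usedX s.usedS n N N₁ N₂ σ Ψ)
    (hin : c.In s.usedX s.usedS →
      Ψ.In (insert n s.usedX) (insert N (insert N₁ (insert N₂ s.usedS)))) :
    Equi M pr U₀ V₀ [s] (s.branches n N N₁ N₂ Γ Δ Ψ) := by
  have hs' : s.lits = Γ ++ [Lit.con c] ++ Δ := by simp [hs]
  have hX : s.usedX ⊆ insert n s.usedX := Finset.subset_insert _ _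
  have hS : s.usedS ⊆ insert N (insert N₁ (insert N₂ s.usedS)) := by
    intro x hx
    simp [hx]
  refine ⟨fun hg => ?_, fun hg σ => ?_, fun σ => ?_⟩
  · obtain ⟨hU, hV, hl⟩ := hg s (by simp)
    rw [hs'] at hl
    simp only [List.forall_mem_append, List.forall_mem_singleton] at hl
    intro t ht
    obtain ⟨ψ, hψ, rfl⟩ := List.mem_map.1 ht
    refine ⟨hU.trans hX, hV.trans hS, ?_⟩
    simp only [List.forall_mem_append]
    exact ⟨⟨fun l h => (hl.1.1 l h).mono hX hS, dnf_in (hin hl.1.2) ψ hψ⟩,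
      fun l h => (hl.2 l h).mono hX hS⟩
  · rintro ⟨s', hs'', hσ⟩
    rw [List.mem_singleton.1 hs''] at hσ
    obtain ⟨hU, hV, hl⟩ := hg s (by simp)
    rw [State.holds_split hs', List.forall_mem_singleton] at hσ
    rw [hs'] at hl
    simp only [List.forall_mem_append, List.forall_mem_singleton] at hl
    obtain ⟨a, A, B, C, hA, hB, hC, h⟩ := hcomplete hl.1.2 σ hσ.2
    obtain ⟨hn, hN, hN₁, hN₂, h₁, h₂, h₃⟩ := hf
    obtain ⟨τ, hτ, e₀, e₁, e₂, e₃⟩ := exists_agree hn hN hN₁ hN₂ h₁ h₂ h₃ σ a hA hB hC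
    obtain ⟨ψ, hψ, hψ'⟩ := (dnf_holds Ψ).1 (h τ hτ e₀ e₁ e₂ e₃)
    refine ⟨_, List.mem_map_of_mem hψ, τ, hτ.mono hU hV,
      (State.holds_split rfl).2 ⟨fun l hl' => ?_, hψ'⟩⟩
    refine (hτ.lit pr ?_).2 (hσ.1 l hl')
    exact (List.mem_append.1 hl').elim (hl.1.1 l) (hl.2 l)
  · rintro ⟨t, ht, hσ⟩
    obtain ⟨ψ, hψ, rfl⟩ := List.mem_map.1 ht
    rw [State.holds_split rfl] at hσ
    refine ⟨s, by simp, (State.holds_split hs').2 ⟨hσ.1, ?_⟩⟩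
    rw [List.forall_mem_singleton]
    exact hsound σ ((dnf_holds Ψ).2 ⟨ψ, hψ, hσ.2⟩)

/-! ### Substitution -/

theorem STerm.eval_subst {X : ℕ} {A : STerm L} (h : (σ.s X : Set M) = A.eval pr σ)
    (B : STerm L) : (STerm.subst X A B).eval pr σ = B.eval pr σ := by
  induction B with
  | var Y =>
    rw [STerm.subst]
    split_ifs with hY
    · rw [hY, eval_var, h]
    · rfl
  | emp => rfl
  | ext t B ih => rw [STerm.subst, eval_ext, eval_ext, ih]
  | ris D φ p ih => rw [STerm.subst, eval_ris, eval_ris, ih]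

theorem Lit.holds_subst {X : ℕ} {A : STerm L} (h : (σ.s X : Set M) = A.eval pr σ)
    (l : Lit L) : (l.subst X A).Holds pr σ ↔ l.Holds pr σ := by
  rcases l with _ | c | φ
  · rfl
  · cases c with
    | isSet a | isX a => cases a <;> rfl
    | _ => simp only [Lit.subst, Constr.subst, Lit.Holds, Constr.Holds, STerm.eval_subst h]
  · rfl

theorem STerm.subst_in {X : ℕ} {A B : STerm L} (hA : A.In U V) (hB : B.In U V) :
    (STerm.subst X A B).In U V := by
  induction B with
  | var Y =>
    rw [STerm.subst]
    split_ifs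
    · exact hA
    · exact hB
  | emp => exact hB
  | ext t B ih =>
    rw [STerm.in_ext] at hB
    exact (STerm.in_ext ..).2 ⟨hB.1, ih hB.2⟩
  | ris D φ p ih =>
    rw [STerm.in_ris] at hB
    exact (STerm.in_ris ..).2 ⟨ih hB.1, hB.2⟩

theorem Lit.subst_in {X : ℕ} {A : STerm L} {l : Lit L} (hA : A.In U V) (hl : l.In U V) :
    (l.subst X A).In U V := by
  rcases l with _ | c | φ
  · trivial
  · cases c with
    | isSet a | isX a =>
      cases a with
      | ofSet B => exact STerm.subst_in (B := B) hA hl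
      | ofX t => exact hl
    | _ => simp_all [Lit.subst, Constr.subst, Lit.In, STerm.subst_in]
  · exact hl

theorem Equi.subst {s : State L} {Γ Δ : List (Lit L)} {c : Constr L} {X : ℕ} {A : STerm L}
    (hs : s.lits = Γ ++ Lit.con c :: Δ)
    (hc : ∀ σ : Val M, c.Holds pr σ ↔ (Constr.eq (.var X) A).Holds pr σ)
    (hin : ∀ U V : Finset ℕ, c.In U V → (Constr.eq (.var X) A).In U V) :
    Equi M pr U₀ V₀ [s] [⟨Γ.map (Lit.subst X A) ++ Lit.con (.eq (.var X) A) ::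
      Δ.map (Lit.subst X A), s.usedX, s.usedS⟩] := by
  refine .singleton (fun ⟨hU, hV, hl⟩ => ⟨hU, hV, ?_⟩) fun σ => ?_
  · rw [hs] at hl
    simp only [List.forall_mem_append, List.forall_mem_cons] at hl
    have hE : (Constr.eq (.var X) A).In s.usedX s.usedS := hin _ _ hl.2.1
    have hA := ((Constr.in_eq ..).1 hE).2
    simp only [List.forall_mem_append, List.forall_mem_cons, List.forall_mem_map]
    exact ⟨fun l h => Lit.subst_in hA (hl.1 l h), hE, fun l h => Lit.subst_in hA (hl.2.2 l h)⟩
  · simp only [State.Holds, hs, List.forall_mem_append, List.forall_mem_cons,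
      List.forall_mem_map, Lit.Holds, hc]
    refine ⟨fun ⟨h₁, h₂, h₃⟩ => ?_, fun ⟨h₁, h₂, h₃⟩ => ?_⟩
    · exact ⟨fun l h => (Lit.holds_subst h₂ l).1 (h₁ l h), h₂,
        fun l h => (Lit.holds_subst h₂ l).1 (h₃ l h)⟩
    · exact ⟨fun l h => (Lit.holds_subst h₂ l).2 (h₁ l h), h₂,
        fun l h => (Lit.holds_subst h₂ l).2 (h₃ l h)⟩

/-! ### The procedures of the solver -/

theorem NeqStep.equi {s : State L} {bs : List (State L)} (h : NeqStep s bs) :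
    Equi M pr U₀ V₀ [s] bs := by
  obtain @⟨Γ, Δ, X, B, n, N, N₁, N₂, hs, -, hf⟩ := h
  have hiff : ∀ σ : Val M,
      ((memF (Term.var n) (.var X) ⩑ nmemF (Term.var n) B) ⩒
        (memF (Term.var n) B ⩑ nmemF (Term.var n) (.var X)) : Form L).Holds pr σ ↔
      (differ n (.var X) B).Holds pr σ := by
    intro σ
    simp only [differ, Form.Holds]
    tauto
  refine .branches hs hf (fun σ h => differ_sound ((hiff σ).1 h)) (fun hc σ h => ?_) fun hc => ?_
  · rw [Constr.in_neq] at hc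
    exact (differ_complete hc.1 hc.2 h).imp fun τ => (hiff τ).2
  · have hc' := hc.mono (Finset.subset_insert n s.usedX)
      (V' := insert N (insert N₁ (insert N₂ s.usedS))) (fun x hx => by simp [hx])
    simp only [Constr.in_neq] at hc'
    simp only [Form.in_or, Form.in_and, Form.in_con, Constr.in_mem, Constr.in_nmem, termIn_var,
      hc', Finset.mem_insert_self, and_self]

theorem Exhaust.equi {R : State L → List (State L) → Prop}
    (hR : ∀ s bs, R s bs → Equi M pr U₀ V₀ [s] bs) (h : Exhaust R ss ts) :
    Equi M pr U₀ V₀ ss ts := by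
  induction h with
  | nil => exact .refl _
  | @fls s ss ts hf _ ih =>
    refine Equi.append (ss := [s]) (ts := [⟨[.fls], s.usedX, s.usedS⟩])
      (.singleton (fun hg => ⟨hg.1, hg.2.1, ?_⟩) fun σ => ?_) ih
    · rw [List.forall_mem_singleton]
      trivial
    · simp only [State.Holds, List.forall_mem_singleton, Lit.Holds, false_iff]
      exact fun h => h _ hf
  | @done s ss ts _ _ _ ih => exact Equi.append (ss := [s]) (ts := [s]) (.refl _) ih
  | @step s bs ss ts _ hs _ ih =>
    exact Equi.trans (Equi.append (ss := [s]) (hR s bs hs) (.refl ss)) ih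

theorem RepeatUntil.equi {body : State L → List (State L) → Prop}
    (hb : ∀ s bs, body s bs → Equi M pr U₀ V₀ [s] bs) (h : RepeatUntil body ss ts) :
    Equi M pr U₀ V₀ ss ts := by
  induction h with
  | nil => exact .refl _
  | @cons s ts ss us hs _ ih =>
    refine Equi.trans (Equi.append (ss := [s]) (hb s ts hs) (.refl ss)) ?_
    refine Equi.trans (.of_mem_iff fun t => ?_) (Equi.append (.refl _) ih)
    simp only [List.mem_append, List.mem_filter, decide_eq_true_eq]
    tauto

theorem sortInfer_equi (s : State L) : Equi M pr U₀ V₀ [s] [sortInfer s] := by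
  have hfold : ∀ (f : Constr L → Finset ℕ) (cs : List (Constr L)) (x : ℕ),
      x ∈ cs.foldr (fun c V => f c ∪ V) ∅ → ∃ c ∈ cs, x ∈ f c := by
    intro f cs x
    induction cs with
    | nil => simp
    | cons c cs ih =>
      simp only [List.foldr_cons, Finset.mem_union, List.exists_mem_cons_iff]
      exact Or.imp_right ih
  have hcs : ∀ c, c ∈ s.lits.filterMap (fun l => match l with
      | .con c => some c
      | _ => none) → Lit.con c ∈ s.lits := by
    intro c hc
    obtain ⟨l, hl, h⟩ := List.mem_filterMap.1 hc
    cases l <;> simp_all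
  refine .singleton (fun ⟨hU, hV, hl⟩ => ⟨hU, hV, ?_⟩) fun σ => ?_
  · simp only [sortInfer, List.forall_mem_append]
    refine ⟨hl, ?_⟩
    simp only [List.mem_filter, List.mem_append, List.mem_map, Finset.mem_toList]
    rintro l ⟨⟨x, hx, rfl⟩ | ⟨x, hx, rfl⟩, -⟩
    · obtain ⟨c, hc, hxc⟩ := hfold _ _ _ hx
      exact (STerm.in_var (L := L) x).2 ((hl _ (hcs c hc)).2 hxc)
    · obtain ⟨c, hc, hxc⟩ := hfold _ _ _ hx
      exact (Constr.in_isX_ofX _).2 ((termIn_var x).2 ((hl _ (hcs c hc)).1 hxc))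
  · simp only [State.Holds, sortInfer, List.forall_mem_append, and_iff_left_iff_imp]
    simp only [List.mem_filter, List.mem_append, List.mem_map]
    rintro - l ⟨⟨x, -, rfl⟩ | ⟨x, -, rfl⟩, -⟩ <;> trivial

theorem sortCheck_equi (s : State L) : Equi M pr U₀ V₀ [s] [sortCheck s] := by
  rw [sortCheck]
  split_ifs with h
  · obtain ⟨l, hl, hI⟩ := h
    refine .singleton (fun hg => ⟨hg.1, hg.2.1, ?_⟩) fun σ => ?_
    · rw [List.forall_mem_singleton]
      trivial
    · simp only [State.Holds, List.forall_mem_singleton, Lit.Holds, false_iff]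
      intro h
      have hh := h l hl
      rcases l with _ | (_ | _ | _ | _ | _ | _ | (_ | _) | (_ | _)) | _ <;>
        first | exact hI | exact hh
  · exact .refl _

variable (hpr : ∀ a b c d : M, Structure.funMap pr ![a, b] = Structure.funMap pr ![c, d] →
  a = c ∧ b = d)

include hpr

theorem Step.equi {π : Pred} {s : State L} {bs : List (State L)} (h : Step pr π s bs) :
    Equi M pr U₀ V₀ [s] bs := by
  cases h with
  | @rule Γ Δ c Ψ n N N₁ N₂ hs _ hf hr =>
    refine .branches hs hf (fun σ => hr.sound) (fun hc σ => hr.complete hpr hc) fun hc => ?_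
    exact hr.rhs_in (by simp) (by simp) (by simp) (by simp)
      (hc.mono (Finset.subset_insert _ _) fun x hx => by simp [hx])
  | subst hs => exact .subst hs (fun _ => Iff.rfl) fun _ _ => id
  | substSym hs =>
    refine .subst hs (fun _ => eq_comm) fun U V h => ?_
    rw [Constr.in_eq] at h ⊢
    exact h.symm

theorem rewriteAll_equi {πs : List Pred} (h : rewriteAll pr πs ss ts) :
    Equi M pr U₀ V₀ ss ts := by
  induction πs generalizing ss with
  | nil => rw [rewriteAll] at h; rw [h]; exact .refl _
  | cons π πs ih =>
    obtain ⟨us, h₁, h₂⟩ := h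
    exact (h₁.equi fun s bs => Step.equi hpr).trans (ih h₂)

theorem STEP_equi (h : STEP pr ss ts) : Equi M pr U₀ V₀ ss ts := by
  obtain ⟨us, h, rfl⟩ := h
  exact (rewriteAll_equi hpr h).trans
    (.map (fun s => (sortInfer_equi s).trans (sortCheck_equi _)) us)

theorem outerBody_equi {s : State L} (h : outerBody pr s ts) : Equi M pr U₀ V₀ [s] ts := by
  obtain ⟨us, h₁, h₂⟩ := h
  exact (h₁.equi fun s bs => STEP_equi hpr).trans (h₂.equi fun s bs => NeqStep.equi)

omit hpr

/-! ### The answer of the solver -/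

theorem conjForm_holds (l : List (Form L)) :
    (conjForm l).Holds pr σ ↔ ∀ Φ ∈ l, Φ.Holds pr σ := by
  induction l with
  | nil => simp [conjForm, Form.Holds]
  | cons Φ l ih =>
    rw [List.forall_mem_cons, ← ih]
    rfl

theorem QF.conj_realize (l : List (QF L ℕ)) (e : ℕ → M) :
    (QF.conj l).Realize e ↔ ∀ φ ∈ l, φ.Realize e := by
  induction l with
  | nil => simp [QF.conj, QF.Realize]
  | cons Φ l ih =>
    rw [List.forall_mem_cons, ← ih]
    rfl

/-- The test of the parameter theory does not change the solutions: it replaces only unsatisfiable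
formulas by `false`. -/
theorem finish_holds {satX : QF L ℕ → Bool}
    (hsatX : ∀ φ : QF L ℕ, satX φ = true ↔ ∃ e : ℕ → M, φ.Realize e) (s : State L) :
    (finish satX s).Holds pr σ ↔ s.Holds pr σ := by
  have hif : ∀ φ : QF L ℕ, (if satX φ then (Form.xf φ : Form L) else .fls).Holds pr σ ↔
      φ.Realize σ.x := by
    intro φ
    split_ifs with h
    · rfl
    · exact ⟨False.elim, fun h' => h ((hsatX φ).2 ⟨_, h'⟩)⟩
  simp only [finish, Form.Holds, hif, conjForm_holds, QF.conj_realize, State.Holds,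
    List.mem_filterMap]
  constructor
  · rintro ⟨h₁, h₂⟩ l hl
    cases l with
    | fls => exact h₁ _ ⟨_, hl, rfl⟩
    | con c => exact h₁ _ ⟨_, hl, rfl⟩
    | xf φ => exact h₂ _ ⟨_, hl, rfl⟩
  · intro h
    constructor
    · rintro Φ ⟨l, hl, hΦ⟩
      have := h l hl
      cases l <;> simp only [Option.some.injEq, reduceCtorEq] at hΦ <;> subst hΦ <;> exact this
    · rintro φ ⟨l, hl, hφ⟩
      have := h l hl
      cases l <;> simp only [Option.some.injEq, reduceCtorEq] at hφ
      subst hφ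
      exact this

end Solver

end RIS

theorem mainTheorem1 {L : FirstOrder.Language.{u, v}} {M : Type w} [L.Structure M]
    (pr : L.Functions 2)
    (hpr : ∀ a b c d : M,
      FirstOrder.Language.Structure.funMap pr ![a, b] =
        FirstOrder.Language.Structure.funMap pr ![c, d] → a = c ∧ b = d)
    (satX : RIS.QF L ℕ → Bool)
    (hsatX : ∀ φ : RIS.QF L ℕ, satX φ = true ↔ ∃ e : ℕ → M, φ.Realize e)
    (Φ : RIS.Form L) (outs : List (RIS.Form L)) (hrun : RIS.SatRIS pr satX Φ outs) :
    (∀ σ : RIS.Val M, Φ.Holds pr σ →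
      ∃ Ψ ∈ outs, ∃ σ' : RIS.Val M,
        (∀ x ∈ Φ.xvars, σ'.x x = σ.x x) ∧ (∀ X ∈ Φ.svars, σ'.s X = σ.s X) ∧ Ψ.Holds pr σ') ∧
    (∀ Ψ ∈ outs, ∀ σ : RIS.Val M, Ψ.Holds pr σ → Φ.Holds pr σ) := by
  obtain ⟨ts, h, rfl⟩ := hrun
  have hmap := RIS.Equi.map (M := M) (pr := pr) (U₀ := Φ.xvars) (V₀ := Φ.svars)
    RIS.sortInfer_equi ((RIS.dnf Φ).map fun l => ⟨l, Φ.xvars, Φ.svars⟩)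
  rw [List.map_map] at hmap
  have hE : RIS.Equi M pr Φ.xvars Φ.svars _ ts :=
    hmap.trans (h.equi fun s bs => RIS.outerBody_equi hpr)
  refine ⟨fun σ hσ => ?_, fun Ψ hΨ σ hσ => ?_⟩
  · obtain ⟨a, ha, ha'⟩ := (RIS.dnf_holds Φ).1 hσ
    obtain ⟨t, ht, τ, hτ, hτt⟩ := hE.complete (by
      intro s hs
      obtain ⟨l, hl, rfl⟩ := List.mem_map.1 hs
      exact ⟨subset_rfl, subset_rfl, RIS.dnf_in ⟨subset_rfl, subset_rfl⟩ l hl⟩) σ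
      ⟨_, List.mem_map_of_mem ha, ha'⟩
    exact ⟨_, List.mem_map_of_mem ht, τ, hτ.1, hτ.2, (RIS.finish_holds hsatX t).2 hτt⟩
  · obtain ⟨t, ht, rfl⟩ := List.mem_map.1 hΨ
    obtain ⟨s, hs, hsσ⟩ := hE.sound σ ⟨t, ht, (RIS.finish_holds hsatX t).1 hσ⟩
    obtain ⟨l, hl, rfl⟩ := List.mem_map.1 hs
    exact (RIS.dnf_holds Φ).2 ⟨l, hl, hsσ⟩
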